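/- **Setting.** Fix integers $p, K$, a window length $dT>0$, an open parameter set $\Theta\subseteq\mathbb R^p$, a true parameter $\theta^*$, and a family of block intensities $\lambda_{kl}(t;\theta)$, $k,l\in\{1,\dots,K\}$. For each $m\ge 1$ let $A=A_m\subseteq[m]\times[m]$ be a set of ordered pairs and $z^*=z^*_m\in\{1,\dots,K\}^m$ the true memberships. For $(i,j)\in A$ the events from $i$ to $j$ form a Poisson process $N_{ij}$ on $(0,\infty)$ with intensity $\lambda_{z^*_iz^*_j}(t;\theta^*)$, independently over the pairs in $A$. Put $$l_n(\theta\mid z)=\sum_{(i,j)\in A}\Big\{\int_{(n-1)dT}^{n\,dT}\log\lambda_{z_iz_j}(t;\theta)\,dN_{ij}(t)-\int_{(n-1)dT}^{n\,dT}\lambda_{z_iz_j}(t;\theta)\,dt\Big\},\qquad \tilde l_n=-\frac1{|A|}\,l_n .$$ **Algorithm.** Start from $\theta^{(0)}$, a product distribution $q^{(0)}=\prod_i q^{(0)}_i$ on $\{1,\dots,K\}^m$, $S_i^{(0)}(k)=1/K$, and a fixed probability vector $\pi^{(0)}$ with positive entries that does not depend on $m$. For $n=1,\dots,N$, where $T=N\,dT$,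 put $$S_i^{(n)}(k)=S_i^{(n-1)}(k)\exp\big\{\mathbb E_{q^{(n-1)}(z_{-i})}\,l_n(\theta^{(n-1)}\mid z_i=k,z_{-i})\big\},\qquad q_i^{(n)}(k)\propto\pi_k^{(n-1)}S_i^{(n)}(k),$$ $$\theta^{(n)}=\theta^{(n-1)}+\eta\,\frac1{|A|}\,\nabla_\theta\,\mathbb E_{q^{(n)}}l_n(\theta\mid z)\Big|_{\theta=\theta^{(n-1)}},\qquad \pi^{(n)}_k=\frac1m\sum_i q_i^{(n)}(k),$$ and define $$\mathrm{Regret}(T)=\sum_{n=1}^N\tilde l_n(\theta^{(n)}\mid z^*)-\sum_{n=1}^N\tilde l_n(\theta^*\mid z^*).$$ **Notation.** $\bar l(\theta\mid z)=\mathbb E^*\big[\tfrac1{|A|}l_1(\theta\mid z)\big]$, $Q(\theta,q)=\mathbb E_{q(z)}\tfrac1{|A|}l_1(\theta\mid z)$, $\bar Q=\mathbb E^*Q$, where $\mathbb E^*$ is the expectation under the true law of the data. $B(\theta,r)$ is the open Euclidean ball, $d(q,\delta_{z^*})$ the total variation distance between $q$ and the point mass at $z^*$, $d_i$ the number of nodes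 $j$ with $(i,j)\in A$ or $(j,i)\in A$, and $d_m=m^{r_d}$ with $r_d>0$. Below, $q$ always denotes a product distribution on $\{1,\dots,K\}^m$. **Conditions.** There are constants that do not depend on $m$, those that bound a gap, a radius, a curvature or the degrees from below being positive, such that $B(\theta^*,\delta)\subseteq\Theta$, C5 holds, and the other conditions hold for all large $m$. - (C0) The window length $dT$ is fixed. - (C1) $\mathbb E^*\big[\tfrac1{|A|}l_n(\theta\mid z)\big]=\bar l(\theta\mid z)$ for all $n\ge1$, $\theta\in\Theta$ and $z$. - (C2) $\bar l(\theta\mid z)\le\bar l(\theta\mid z^*)-c\,d_m\,\#\{i:z_i\ne z_i^*\}/|A|$ for all $z\ne z^*$ and $\theta\in B(\theta^*,\delta)$. - (C3) $\bar Q(\theta,q)-\bar l(\theta\mid z^*)\le c'\,d(q,\delta_{z^*})$ for all $q$ and $\theta\in B(\theta^*,\delta)$. For every $q$ with $d(q,\delta_{z^*})\le\rho$, the function $\bar Q(\cdot,q)$ has a maximiser $\theta(q)$ over $\Theta$ with $\|\theta(q)-\theta^*\|\le c''\,d(q,\delta_{z^*})$. - (C4) For the same $q$ and all $\theta\in B(\theta(q),\delta)\cap\Theta$: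 $\nabla_\theta\bar Q(\theta,q)^{\top}(\theta-\theta(q))\le-c'''\|\theta-\theta(q)\|^2$ and $\mathbb E^*\|\nabla_\theta Q(\theta,q)\|^2\le C$. - (C5) For $\theta\in\Theta$, $t\ge0$ and all $k,l$: $\lambda_{kl}(t;\theta)>0$ is measurable in $t$ and continuously differentiable in $\theta$, and $\lambda_{kl}$, $\log\lambda_{kl}$ and their $\theta$-gradients are bounded by a constant $M$. - (C6) $a\,d_m\le d_i\le b\,d_m$ for all nodes $i$. - (C7) $\mathbb E_{q^{(0)}(z_{-i})}\bar l(\theta^*\mid z_i=k,z_{-i})\le\mathbb E_{q^{(0)}(z_{-i})}\bar l(\theta^*\mid z_i=z_i^*,z_{-i})-c_1d_i/|A|$ for all $i$ and $k\ne z_i^*$. **Theorem.** Under these conditions there are a radius $\delta_0>0$ and a step-size threshold $\eta_0>0$ such that for every $c>0$ there is a constant $C_0>0$ with the following property. For all horizons $T=T_m$ (positive integer multiples of $dT$) with $c/\sqrt{T_m}\le\eta_0$ for all large $m$, and all starting points $\theta^{(0)}=\theta^{(0)}_m\in B(\theta^*,\delta_0)$, the algorithm with step size $\eta=c/\sqrt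 T$ satisfies $$\mathrm{Regret}(T)\le C_0\sqrt T\,\big(\log(T|A|)\big)^2$$ with probability tending to $1$ as $m\to\infty$. -/

import Mathlib

open MeasureTheory ProbabilityTheory Filter Topology

namespace OnlineNet

noncomputable section

/-! ## The data: Poisson processes on the edges of a network -/

/-- `N` is a Poisson process on `(0, ∞)` with intensity function `ρ`, given by its random counting
measure: `N ω B` is the number of events with time stamp in `B`. -/
structure IsPoissonProcess {Ω : Type*} [MeasurableSpace Ω] (P : Measure Ω)
    (N : Ω → Measure ℝ) (ρ : ℝ → ℝ) : Prop where
  measurable : Measurable N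
  law : ∀ B : Set ℝ, MeasurableSet B → Bornology.IsBounded B → B ⊆ Set.Ioi 0 →
    HasLaw (fun ω => N ω B)
      ((poissonMeasure (∫ t in B, ρ t).toNNReal).map (fun j : ℕ => (j : ENNReal))) P
  indep : ∀ (r : ℕ) (B : Fin r → Set ℝ), (∀ i, MeasurableSet (B i)) →
    (∀ i, B i ⊆ Set.Ioi 0) → Pairwise (fun i j => Disjoint (B i) (B j)) →
    iIndepFun (fun i ω => N ω (B i)) P

/-- A parametric family of block intensities: `lam θ k l t` is the intensity at time `t` of the
events directed from a node of class `k` to a node of class `l`. -/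
abbrev Intensity (p K : ℕ) := EuclideanSpace ℝ (Fin p) → Fin K → Fin K → ℝ → ℝ

/-- The block model: given the memberships `zs`, the event streams of the pairs in `A` are
independent Poisson processes with intensities `lam θs (zs i) (zs j)`. -/
structure IsBlockPoisson {p K m : ℕ} {Ω : Type*} [MeasurableSpace Ω] (P : Measure Ω)
    (lam : Intensity p K) (θs : EuclideanSpace ℝ (Fin p)) (A : Finset (Fin m × Fin m))
    (zs : Fin m → Fin K) (X : Ω → Fin m × Fin m → Measure ℝ) : Prop where
  poisson : ∀ e ∈ A, IsPoissonProcess P (fun ω => X ω e) (lam θs (zs e.1) (zs e.2))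
  indep : iIndepFun (fun (e : A) ω => X ω e.1) P

/-! ## Likelihoods -/

/-- The `n`-th time window (`n = 1, 2, …`). -/
def window (dT : ℝ) (n : ℕ) : Set ℝ := Set.Ioc (((n : ℝ) - 1) * dT) ((n : ℝ) * dT)

/-- The conditional log-likelihood `l_n(θ | z)` of the observations `x` in the `n`-th window. -/
def windowLL {p K m : ℕ} (lam : Intensity p K) (dT : ℝ) (A : Finset (Fin m × Fin m))
    (x : Fin m × Fin m → Measure ℝ) (n : ℕ) (θ : EuclideanSpace ℝ (Fin p))
    (z : Fin m → Fin K) : ℝ :=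
  ∑ e ∈ A, ((∫ t in window dT n, Real.log (lam θ (z e.1) (z e.2) t) ∂(x e))
    - ∫ t in window dT n, lam θ (z e.1) (z e.2) t)

/-- The log-likelihood of the `n`-th window, normalised by the number of pairs. -/
def normLL {p K m : ℕ} (lam : Intensity p K) (dT : ℝ) (A : Finset (Fin m × Fin m))
    (x : Fin m × Fin m → Measure ℝ) (n : ℕ) (θ : EuclideanSpace ℝ (Fin p))
    (z : Fin m → Fin K) : ℝ :=
  (1 / (A.card : ℝ)) * windowLL lam dT A x n θ z

/-- The loss over the `n`-th window: the negative normalised log-likelihood. -/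
def loss {p K m : ℕ} (lam : Intensity p K) (dT : ℝ) (A : Finset (Fin m × Fin m))
    (x : Fin m × Fin m → Measure ℝ) (n : ℕ) (θ : EuclideanSpace ℝ (Fin p))
    (z : Fin m → Fin K) : ℝ :=
  -normLL lam dT A x n θ z

/-! ## Product (mean-field) distributions on the memberships -/

/-- `q i` is a probability vector on the classes, for every node `i`. -/
def IsMeanField {K m : ℕ} (q : Fin m → Fin K → ℝ) : Prop :=
  ∀ i, (∀ k, 0 ≤ q i k) ∧ ∑ k, q i k = 1

/-- The probability of the configuration `z` under the product distribution `q`. -/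
def prodProb {K m : ℕ} (q : Fin m → Fin K → ℝ) (z : Fin m → Fin K) : ℝ := ∏ i, q i (z i)

/-- The expectation of `f z` for `z` with the product distribution `q`. -/
def expect {K m : ℕ} (q : Fin m → Fin K → ℝ) (f : (Fin m → Fin K) → ℝ) : ℝ :=
  ∑ z, prodProb q z * f z

/-- The expectation of `f z` for `z i = k` and the other coordinates with their law under `q`. -/
def expectAt {K m : ℕ} (q : Fin m → Fin K → ℝ) (i : Fin m) (k : Fin K)
    (f : (Fin m → Fin K) → ℝ) : ℝ :=
  expect (Function.update q i (Pi.single k 1)) f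

/-- The total variation distance between the product distribution `q` and the point mass at
`zs`. -/
def tvToPoint {K m : ℕ} (q : Fin m → Fin K → ℝ) (zs : Fin m → Fin K) : ℝ :=
  (1 / 2) * ∑ z, |prodProb q z - if z = zs then 1 else 0|

/-! ## The online variational algorithm -/

/-- The state kept by the algorithm: the parameter, the mean-field distribution, the cumulative
group evidence and the class weights. -/
structure State (p K m : ℕ) where
  θ : EuclideanSpace ℝ (Fin p)
  q : Fin m → Fin K → ℝ
  S : Fin m → Fin K → ℝ
  w : Fin K → ℝ

/-- The cumulative evidence after window `n`. -/
def nextS {p K m : ℕ} (lam : Intensity p K) (dT : ℝ) (A : Finset (Fin m × Fin m))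
    (x : Fin m × Fin m → Measure ℝ) (n : ℕ) (s : State p K m) : Fin m → Fin K → ℝ :=
  fun i k => s.S i k * Real.exp (expectAt s.q i k (windowLL lam dT A x n s.θ))

/-- The mean-field distribution after window `n`. -/
def nextQ {p K m : ℕ} (lam : Intensity p K) (dT : ℝ) (A : Finset (Fin m × Fin m))
    (x : Fin m × Fin m → Measure ℝ) (n : ℕ) (s : State p K m) : Fin m → Fin K → ℝ :=
  fun i k => s.w k * nextS lam dT A x n s i k / ∑ k', s.w k' * nextS lam dT A x n s i k'

/-- The processing of window `n`: approximation step, then gradient step with step size `η`, then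
update of the class weights. -/
def step {p K m : ℕ} (lam : Intensity p K) (dT : ℝ) (A : Finset (Fin m × Fin m))
    (x : Fin m × Fin m → Measure ℝ) (η : ℝ) (n : ℕ) (s : State p K m) : State p K m where
  S := nextS lam dT A x n s
  q := nextQ lam dT A x n s
  θ := s.θ + (η * (1 / (A.card : ℝ))) •
    gradient (fun θ => expect (nextQ lam dT A x n s) (windowLL lam dT A x n θ)) s.θ
  w := fun k => (1 / (m : ℝ)) * ∑ i, nextQ lam dT A x n s i k

/-- The state after `n` windows. -/
def run {p K m : ℕ} (lam : Intensity p K) (dT : ℝ) (A : Finset (Fin m × Fin m))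
    (x : Fin m × Fin m → Measure ℝ) (η : ℝ) (θ0 : EuclideanSpace ℝ (Fin p))
    (q0 : Fin m → Fin K → ℝ) (w0 : Fin K → ℝ) : ℕ → State p K m
  | 0 => { θ := θ0, q := q0, S := fun _ _ => 1 / (K : ℝ), w := w0 }
  | n + 1 => step lam dT A x η (n + 1) (run lam dT A x η θ0 q0 w0 n)

/-- The regret of the online estimator after `N` windows. -/
def regret {p K m : ℕ} (lam : Intensity p K) (dT : ℝ) (A : Finset (Fin m × Fin m))
    (x : Fin m × Fin m → Measure ℝ) (η : ℝ) (θ0 : EuclideanSpace ℝ (Fin p))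
    (q0 : Fin m → Fin K → ℝ) (w0 : Fin K → ℝ) (θs : EuclideanSpace ℝ (Fin p))
    (zs : Fin m → Fin K) (N : ℕ) : ℝ :=
  (∑ n ∈ Finset.Icc 1 N, loss lam dT A x n (run lam dT A x η θ0 q0 w0 n).θ zs)
    - ∑ n ∈ Finset.Icc 1 N, loss lam dT A x n θs zs

/-! ## Regularity conditions -/

/-- The constants in the regularity conditions; none of them depends on the network size. -/
structure Consts where
  /-- radius of the parameter balls -/
  δ : ℝ
  /-- radius, in total variation, around the point mass at the true memberships -/
  ρ : ℝ
  /-- bound for the intensities and their derivatives -/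
  M : ℝ
  /-- exponent of the degrees -/
  rd : ℝ
  /-- likelihood gap of wrong memberships -/
  cGap : ℝ
  /-- continuity constants -/
  cQ : ℝ
  cArg : ℝ
  /-- gradient constants -/
  cGrad : ℝ
  CGrad : ℝ
  /-- degree constants -/
  degLo : ℝ
  degHi : ℝ
  /-- likelihood gap at initialisation -/
  cInit : ℝ
  δ_pos : 0 < δ
  ρ_pos : 0 < ρ
  rd_pos : 0 < rd
  cGap_pos : 0 < cGap
  cGrad_pos : 0 < cGrad
  degLo_pos : 0 < degLo
  cInit_pos : 0 < cInit

/-- The intensities are positive on the parameter space `Θ`, continuously differentiable in the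
parameter, and they, their logarithms and the derivatives of both are bounded by `M`. -/
structure BoundedIntensity {p K : ℕ} (lam : Intensity p K)
    (Θ : Set (EuclideanSpace ℝ (Fin p))) (M : ℝ) : Prop where
  measurable : ∀ θ ∈ Θ, ∀ k l, Measurable (lam θ k l)
  pos : ∀ θ ∈ Θ, ∀ k l t, 0 ≤ t → 0 < lam θ k l t
  contDiff : ∀ k l t, 0 ≤ t → ContDiffOn ℝ 1 (fun θ => lam θ k l t) Θ
  bound : ∀ θ ∈ Θ, ∀ k l t, 0 ≤ t → |lam θ k l t| ≤ M
  bound_log : ∀ θ ∈ Θ, ∀ k l t, 0 ≤ t → |Real.log (lam θ k l t)| ≤ M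
  bound_grad : ∀ θ ∈ Θ, ∀ k l t, 0 ≤ t → ‖gradient (fun θ => lam θ k l t) θ‖ ≤ M
  bound_grad_log : ∀ θ ∈ Θ, ∀ k l t, 0 ≤ t →
    ‖gradient (fun θ => Real.log (lam θ k l t)) θ‖ ≤ M

/-- The number of nodes that node `i` connects to. -/
def degree {m : ℕ} (A : Finset (Fin m × Fin m)) (i : Fin m) : ℕ :=
  (Finset.univ.filter (fun j => (i, j) ∈ A ∨ (j, i) ∈ A)).card

/-- The expected normalised log-likelihood of one window (the first one). -/
def meanLL {p K m : ℕ} {Ω : Type*} [MeasurableSpace Ω] (P : Measure Ω) (lam : Intensity p K)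
    (dT : ℝ) (A : Finset (Fin m × Fin m)) (X : Ω → Fin m × Fin m → Measure ℝ)
    (θ : EuclideanSpace ℝ (Fin p)) (z : Fin m → Fin K) : ℝ :=
  ∫ ω, normLL lam dT A (X ω) 1 θ z ∂P

/-- The function `Q(θ, q)`: the normalised log-likelihood of one window averaged over `q`. -/
def Qfun {p K m : ℕ} (lam : Intensity p K) (dT : ℝ) (A : Finset (Fin m × Fin m))
    (x : Fin m × Fin m → Measure ℝ) (θ : EuclideanSpace ℝ (Fin p))
    (q : Fin m → Fin K → ℝ) : ℝ :=
  expect q (normLL lam dT A x 1 θ)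

/-- The expectation of `Q(θ, q)` under the true law of the data. -/
def Qbar {p K m : ℕ} {Ω : Type*} [MeasurableSpace Ω] (P : Measure Ω) (lam : Intensity p K)
    (dT : ℝ) (A : Finset (Fin m × Fin m)) (X : Ω → Fin m × Fin m → Measure ℝ)
    (θ : EuclideanSpace ℝ (Fin p)) (q : Fin m → Fin K → ℝ) : ℝ :=
  ∫ ω, Qfun lam dT A (X ω) θ q ∂P

/-- The regularity conditions on the network of size `m`, its event streams and the initial
distribution `q0`. -/
structure Regular {p K m : ℕ} {Ω : Type*} [MeasurableSpace Ω] (P : Measure Ω)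
    (lam : Intensity p K) (Θ : Set (EuclideanSpace ℝ (Fin p))) (θs : EuclideanSpace ℝ (Fin p))
    (dT : ℝ) (A : Finset (Fin m × Fin m)) (zs : Fin m → Fin K)
    (X : Ω → Fin m × Fin m → Measure ℝ) (q0 : Fin m → Fin K → ℝ) (κ : Consts) : Prop where
  /-- stationarity of the expectation -/
  stationary : ∀ n : ℕ, 1 ≤ n → ∀ θ ∈ Θ, ∀ z,
    ∫ ω, normLL lam dT A (X ω) n θ z ∂P = meanLL P lam dT A X θ z
  /-- identification of the memberships -/
  identification : ∀ z, z ≠ zs → ∀ θ ∈ Metric.ball θs κ.δ,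
    meanLL P lam dT A X θ z ≤ meanLL P lam dT A X θ zs
      - κ.cGap * ((m : ℝ) ^ κ.rd * (hammingDist z zs : ℝ) / (A.card : ℝ))
  /-- continuity of `Qbar` at the true memberships -/
  continuity : ∀ q, IsMeanField q → ∀ θ ∈ Metric.ball θs κ.δ,
    Qbar P lam dT A X θ q - meanLL P lam dT A X θ zs ≤ κ.cQ * tvToPoint q zs
  /-- for `q` near the true memberships, the maximiser `θq q` of `Qbar` is close to `θs`, and the
  gradient condition holds around it -/
  maximiser : ∃ θq : (Fin m → Fin K → ℝ) → EuclideanSpace ℝ (Fin p),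
    ∀ q, IsMeanField q → tvToPoint q zs ≤ κ.ρ →
      θq q ∈ Θ ∧ IsMaxOn (fun θ => Qbar P lam dT A X θ q) Θ (θq q) ∧
      ‖θq q - θs‖ ≤ κ.cArg * tvToPoint q zs ∧
      ∀ θ ∈ Metric.ball (θq q) κ.δ ∩ Θ,
        inner ℝ (gradient (fun θ => Qbar P lam dT A X θ q) θ) (θ - θq q)
            ≤ -κ.cGrad * ‖θ - θq q‖ ^ 2 ∧
        ∫ ω, ‖gradient (fun θ => Qfun lam dT A (X ω) θ q) θ‖ ^ 2 ∂P ≤ κ.CGrad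
  /-- all degrees are of the order `m ^ rd` -/
  degrees : ∀ i, κ.degLo * (m : ℝ) ^ κ.rd ≤ (degree A i : ℝ) ∧
    (degree A i : ℝ) ≤ κ.degHi * (m : ℝ) ^ κ.rd
  /-- good initialisation -/
  init_meanField : IsMeanField q0
  init_gap : ∀ i k, k ≠ zs i →
    expectAt q0 i k (meanLL P lam dT A X θs) ≤
      expectAt q0 i (zs i) (meanLL P lam dT A X θs)
        - κ.cInit * ((degree A i : ℝ) / (A.card : ℝ))

end

end OnlineNet

namespace OnlineNet

/-! ## Averages over product distributions -/

section MeanField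

variable {K m : ℕ} {q : Fin m → Fin K → ℝ}

/-! Each new window is independent of the past, and a linear statistic of it fluctuates around its
value at the mean data with variance at most of the order of the number of pairs that enter
(`PoissonData.integral_exp_le`, `PoissonData.centred_moments`). Three mechanisms turn this into the
regret bound.

Memberships. The log-evidence of a node for a wrong class against the true one is a sum of
increments whose conditional mean is at most `-γ d` with `d = m ^ rd`: in the first window by the
initial gap and the closeness of the starting point to `θs`, later because the mean-field
distribution is already concentrated and a change of a single membership costs likelihood. Only the
pairs that touch the node, of order `d`, contribute variance, so a small exponential moment shrinks
by a factor exponential in `d` per window. Markov's inequality and a union bound over nodes, classes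
and windows (`measure_lev_gt_le`) leave a failure probability of order `m K exp(-const * d)`. The
mass on wrong classes after window `n` is then at most `K max(W, 2m) exp(-γ d n / 4)` per node,
which is summable in `n` with a vanishing sum.

Parameter. At the point mass on the true memberships the maximiser of the mean objective is `θs`
itself, so the mean gradient contracts towards `θs`. The squared error therefore satisfies a
recursion with contraction `2 η curv`, martingale noise, a disturbance by wrong memberships and
atypical event counts, and a term of order `η ^ 2` (`sq_error_succ_le`). The accumulated noise has
variance of order `N η ^ 2 / |A|`, and `N η ^ 2 = c ^ 2 / dT` whatever the horizon, so it vanishes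
as the network grows. Hence the parameter never leaves the ball, and summation of the recursion
bounds the sum of the squared errors by a multiple of `1 / η + N η`, that is of `√T`.

Regret. The mean loss of likelihood at the true memberships is a relative entropy and so quadratic
in the error (`LL_mean_sub_le`); evaluation after instead of before the gradient step costs order
`η` per window on average; the martingale part is below `√N` with high probability. All three are of
order `√T`, and the squared logarithm only has to be at least one.

The argument looks circular, since the evidence needs the parameter in the ball and the parameter
needs concentrated memberships. This is resolved by the events `Good`, which depend on the past
only: all probabilistic estimates concern sums stopped on leaving them, and `mem_good` is a
deterministic induction showing that off the exceptional events the run never leaves them.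

To have a measurable run for all data, intensities are extended by zero off `Θ × [0, ∞)` and streams
are trimmed to finite measures; while the parameter stays in `Θ` this almost surely changes nothing
(`run_eq`, `ae_agreeAt`). -/

lemma prodProb_nonneg (hq : IsMeanField q) (z : Fin m → Fin K) : 0 ≤ prodProb q z :=
  Finset.prod_nonneg fun i _ => (hq i).1 _

lemma sum_prodProb (hq : IsMeanField q) : ∑ z, prodProb q z = 1 := by
  have h := Finset.prod_univ_sum (fun _ : Fin m => (Finset.univ : Finset (Fin K))) (fun i k => q i k)
  simp only [(hq _).2, Finset.prod_const_one, Fintype.piFinset_univ] at h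
  exact h.symm

lemma expect_add (f g : (Fin m → Fin K) → ℝ) :
    expect q (fun z => f z + g z) = expect q f + expect q g := by
  simp [expect, mul_add, Finset.sum_add_distrib]

lemma expect_sub (f g : (Fin m → Fin K) → ℝ) :
    expect q (fun z => f z - g z) = expect q f - expect q g := by
  simp [expect, mul_sub, Finset.sum_sub_distrib]

lemma expect_const_mul (c : ℝ) (f : (Fin m → Fin K) → ℝ) :
    expect q (fun z => c * f z) = c * expect q f := by
  simp only [expect, Finset.mul_sum]
  exact Finset.sum_congr rfl fun z _ => by ring

lemma expect_sum {ι : Type*} (s : Finset ι) (f : ι → (Fin m → Fin K) → ℝ) :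
    expect q (fun z => ∑ e ∈ s, f e z) = ∑ e ∈ s, expect q (f e) := by
  simp only [expect, Finset.mul_sum]
  exact Finset.sum_comm

lemma expect_const (hq : IsMeanField q) (c : ℝ) : expect q (fun _ => c) = c := by
  simp [expect, ← Finset.sum_mul, sum_prodProb hq]

lemma expect_mono (hq : IsMeanField q) {f g : (Fin m → Fin K) → ℝ} (h : ∀ z, f z ≤ g z) :
    expect q f ≤ expect q g :=
  Finset.sum_le_sum fun z _ => mul_le_mul_of_nonneg_left (h z) (prodProb_nonneg hq z)

lemma abs_expect_le (hq : IsMeanField q) {f : (Fin m → Fin K) → ℝ} {B : ℝ} (h : ∀ z, |f z| ≤ B) :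
    |expect q f| ≤ B := by
  rw [abs_le]
  constructor
  · calc -B = expect q (fun _ => -B) := (expect_const hq _).symm
      _ ≤ _ := expect_mono hq fun z => (abs_le.1 (h z)).1
  · calc expect q f ≤ expect q (fun _ => B) := expect_mono hq fun z => (abs_le.1 (h z)).2
      _ = B := expect_const hq _

lemma prodProb_update (q : Fin m → Fin K → ℝ) (i : Fin m) (v : Fin K → ℝ) (z : Fin m → Fin K) :
    prodProb (Function.update q i v) z = v (z i) * ∏ j ∈ Finset.univ.erase i, q j (z j) := by
  rw [prodProb, ← Finset.mul_prod_erase _ _ (Finset.mem_univ i), Function.update_self]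
  congr 1
  refine Finset.prod_congr rfl fun j hj => ?_
  rw [Function.update_of_ne (Finset.ne_of_mem_erase hj)]

lemma expect_eq_sum_expectAt (q : Fin m → Fin K → ℝ) (i : Fin m) (f : (Fin m → Fin K) → ℝ) :
    expect q f = ∑ k, q i k * expectAt q i k f := by
  simp only [expectAt, expect, Finset.mul_sum]
  rw [Finset.sum_comm]
  refine Finset.sum_congr rfl fun z _ => ?_
  rw [Finset.sum_eq_single (z i)]
  · rw [prodProb_update, prodProb, ← Finset.mul_prod_erase _ _ (Finset.mem_univ i)]
    simp
    ring
  · intro k _ hk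
    rw [prodProb_update, Pi.single_eq_of_ne hk.symm]
    simp
  · simp

lemma expectAt_congr {i : Fin m} {k : Fin K} {f g : (Fin m → Fin K) → ℝ}
    (h : ∀ z, z i = k → f z = g z) : expectAt q i k f = expectAt q i k g := by
  refine Finset.sum_congr rfl fun z _ => ?_
  by_cases hz : z i = k
  · rw [h z hz]
  · rw [prodProb_update, Pi.single_eq_of_ne hz]
    simp

/-- Swapping `k` and `k'` at coordinate `i` carries the configurations charged on the right, those
with `z i = k`, to the ones charged on the left, and leaves all other factors alone. -/
lemma expectAt_comp_update (i : Fin m) (k k' : Fin K) (f : (Fin m → Fin K) → ℝ) :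
    expectAt q i k' (fun z => f (Function.update z i k)) = expectAt q i k f := by
  let σ : (Fin m → Fin K) ≃ (Fin m → Fin K) :=
    Equiv.piCongrRight fun j => if j = i then Equiv.swap k k' else Equiv.refl _
  have hσ : ∀ z, σ z = Function.update z i (Equiv.swap k k' (z i)) := by
    intro z
    funext j
    by_cases hj : j = i
    · subst hj
      simp [σ]
    · simp [σ, hj]
  unfold expectAt expect
  rw [← Equiv.sum_comp σ]
  refine Finset.sum_congr rfl fun z _ => ?_
  rw [prodProb_update, prodProb_update, hσ]
  by_cases hz : z i = k
  · have h1 : ∏ j ∈ Finset.univ.erase i, q j (Function.update z i (Equiv.swap k k' (z i)) j)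
        = ∏ j ∈ Finset.univ.erase i, q j (z j) :=
      Finset.prod_congr rfl fun j hj => by rw [Function.update_of_ne (Finset.ne_of_mem_erase hj)]
    rw [h1]
    subst hz
    simp
  · have : Equiv.swap k k' (z i) ≠ k' := by
      intro h
      apply hz
      have := congrArg (Equiv.swap k k') h
      simpa using this
    simp [hz, this]

/-- Fixing a coordinate of a product distribution amounts to overwriting it. -/
lemma expectAt_eq_expect_update (i : Fin m) (h : ∑ k, q i k = 1) (k : Fin K)
    (f : (Fin m → Fin K) → ℝ) :
    expectAt q i k f = expect q (fun z => f (Function.update z i k)) := by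
  rw [expect_eq_sum_expectAt q i]
  simp only [expectAt_comp_update, ← Finset.sum_mul, h, one_mul]

lemma IsMeanField.update_single (hq : IsMeanField q) (i : Fin m) (k : Fin K) :
    IsMeanField (Function.update q i (Pi.single k 1)) := by
  intro j
  by_cases hj : j = i
  · subst hj
    rw [Function.update_self]
    refine ⟨fun k' => ?_, by simp⟩
    by_cases h : k' = k
    · subst h; simp
    · rw [Pi.single_eq_of_ne h]
  · rw [Function.update_of_ne hj]
    exact hq j

lemma expect_ne (hq : IsMeanField q) (j : Fin m) (c : Fin K) :
    expect q (fun z => if z j = c then 0 else 1) = 1 - q j c := by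
  rw [expect_eq_sum_expectAt q j]
  have h : ∀ k, expectAt q j k (fun z => if z j = c then (0 : ℝ) else 1)
      = if k = c then 0 else 1 := by
    intro k
    rw [expectAt_congr (g := fun _ => if k = c then 0 else 1) (by rintro z rfl; rfl)]
    exact expect_const (hq.update_single j k) _
  simp only [h]
  have h2 := (hq j).2
  rw [← Finset.add_sum_erase _ _ (Finset.mem_univ c)] at h2 ⊢
  simp only [if_true, mul_zero, zero_add]
  rw [eq_sub_iff_add_eq']
  refine (congrArg (q j c + ·) (Finset.sum_congr rfl fun k hk => ?_)).trans h2
  rw [if_neg (Finset.ne_of_mem_erase hk), mul_one]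

/-- The product distribution concentrated at `zs`. -/
def pointField (zs : Fin m → Fin K) : Fin m → Fin K → ℝ := fun i => Pi.single (zs i) 1

lemma isMeanField_pointField (zs : Fin m → Fin K) : IsMeanField (pointField zs) := by
  intro i
  refine ⟨fun k => ?_, by simp [pointField]⟩
  unfold pointField
  by_cases h : k = zs i
  · subst h; simp
  · rw [Pi.single_eq_of_ne h]

lemma prodProb_pointField (zs z : Fin m → Fin K) :
    prodProb (pointField zs) z = if z = zs then 1 else 0 := by
  split_ifs with h
  · subst h
    simp [prodProb, pointField]
  · obtain ⟨i, hi⟩ := Function.ne_iff.1 h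
    exact Finset.prod_eq_zero (Finset.mem_univ i) (by simp [pointField, hi])

lemma expect_pointField (zs : Fin m → Fin K) (f : (Fin m → Fin K) → ℝ) :
    expect (pointField zs) f = f zs := by
  simp [expect, prodProb_pointField]

lemma tvToPoint_pointField (zs : Fin m → Fin K) : tvToPoint (pointField zs) zs = 0 := by
  simp [tvToPoint, prodProb_pointField]

/-- The average of a function of the classes of a pair deviates little from its value at the
memberships on which the product distribution concentrates. -/
lemma expect_pair_sub_le (hq : IsMeanField q) {zs : Fin m → Fin K} {ε B : ℝ}
    (hε : ∀ j, 1 - q j (zs j) ≤ ε) (e : Fin m × Fin m) {f : (Fin m → Fin K) → ℝ}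
    (hB : ∀ z, |f z| ≤ B) (hf : ∀ z, z e.1 = zs e.1 → z e.2 = zs e.2 → f z = f zs) :
    |expect q f - f zs| ≤ 4 * B * ε := by
  have hB0 : 0 ≤ B := (abs_nonneg _).trans (hB zs)
  -- The difference never exceeds `2 * B`, and it vanishes unless an endpoint of the pair has the
  -- wrong class. Averaging the two indicators costs `ε` each, whence the factor 4, with no
  -- dependence on the other nodes.
  have hpt : ∀ z, |f z - f zs| ≤
      2 * B * ((if z e.1 = zs e.1 then 0 else 1) + (if z e.2 = zs e.2 then 0 else 1)) := by
    intro z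
    have hle : |f z - f zs| ≤ 2 * B := by
      have h1 := abs_le.1 (hB z)
      have h2 := abs_le.1 (hB zs)
      rw [abs_le]; constructor <;> linarith
    by_cases h1 : z e.1 = zs e.1 <;> by_cases h2 : z e.2 = zs e.2
    · rw [hf z h1 h2, if_pos h1, if_pos h2]; simp
    all_goals simp only [h1, h2, if_true, if_false]; linarith
  have hE : expect q (fun z => 2 * B *
      ((if z e.1 = zs e.1 then 0 else 1) + (if z e.2 = zs e.2 then 0 else 1))) ≤ 4 * B * ε := by
    rw [expect_const_mul, expect_add, expect_ne hq, expect_ne hq]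
    nlinarith [hε e.1, hε e.2]
  have : expect q f - f zs = expect q (fun z => f z - f zs) := by
    rw [expect_sub, expect_const hq]
  rw [this, abs_le]
  constructor
  · refine neg_le.1 (le_trans ?_ hE)
    rw [← neg_one_mul, ← expect_const_mul]
    exact expect_mono hq fun z => by have := (abs_le.1 (hpt z)).1; linarith
  · exact (expect_mono hq fun z => (abs_le.1 (hpt z)).2).trans hE

end MeanField

end OnlineNet

namespace OnlineNet

/-! ## Poisson processes -/

section Poisson

variable {Ω : Type*} [MeasurableSpace Ω] {P : Measure Ω}

lemma measurable_restrict_measure {S : Set ℝ} (hS : MeasurableSet S) :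
    Measurable fun μ : Measure ℝ => μ.restrict S := by
  refine Measure.measurable_of_measurable_coe _ fun s hs => ?_
  simp only [Measure.restrict_apply hs]
  exact Measure.measurable_coe (hs.inter hS)

lemma IsPoissonProcess.iIndepFun_fintype {N : Ω → Measure ℝ} {ρ : ℝ → ℝ}
    (h : IsPoissonProcess P N ρ) {ι : Type*} [Fintype ι] {B : ι → Set ℝ}
    (hB : ∀ i, MeasurableSet (B i)) (hpos : ∀ i, B i ⊆ Set.Ioi 0)
    (hd : Pairwise fun i j => Disjoint (B i) (B j)) :
    iIndepFun (fun i ω => N ω (B i)) P := by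
  let e := Fintype.equivFin ι
  have := h.indep _ (fun i => B (e.symm i)) (fun i => hB _) (fun i => hpos _)
    (fun i j hij => hd (e.symm.injective.ne hij))
  have h2 := this.precomp e.injective
  simpa [Function.comp_def] using h2

/-- The atoms of a finite family of sets, inside `S`. -/
def atom {ι : Type*} (s : ι → Set ℝ) (S : Set ℝ) (ε : ι → Bool) : Set ℝ :=
  S ∩ ⋂ i, if ε i then s i else (s i)ᶜ

lemma measurableSet_atom {ι : Type*} [Finite ι] {s : ι → Set ℝ} (hs : ∀ i, MeasurableSet (s i))
    {S : Set ℝ} (hS : MeasurableSet S) (ε : ι → Bool) : MeasurableSet (atom s S ε) := by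
  refine hS.inter (MeasurableSet.iInter fun i => ?_)
  split_ifs
  exacts [hs i, (hs i).compl]

lemma disjoint_atom {ι : Type*} (s : ι → Set ℝ) (S : Set ℝ) {ε ε' : ι → Bool} (h : ε ≠ ε') :
    Disjoint (atom s S ε) (atom s S ε') := by
  obtain ⟨i, hi⟩ := Function.ne_iff.1 h
  rw [Set.disjoint_left]
  rintro x ⟨-, hx⟩ ⟨-, hx'⟩
  have h1 := Set.mem_iInter.1 hx i
  have h2 := Set.mem_iInter.1 hx' i
  cases hε : ε i <;> cases hε' : ε' i <;> simp_all

/-- Every point of `s i ∩ S` lies in exactly one atom, the one recording which of the sets contain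
it. -/
lemma measure_inter_eq_sum_atom {ι : Type*} [Fintype ι] [DecidableEq ι] {s : ι → Set ℝ}
    (hs : ∀ i, MeasurableSet (s i)) {S : Set ℝ} (hS : MeasurableSet S) (μ : Measure ℝ) (i : ι) :
    μ (s i ∩ S) = ∑ ε : ι → Bool, if ε i then μ (atom s S ε) else 0 := by
  classical
  rw [← Finset.sum_filter, ← measure_biUnion_finset]
  · congr 1
    ext x
    simp only [Set.mem_inter_iff, Finset.mem_filter, Finset.mem_univ, true_and, Set.mem_iUnion, exists_prop,
      atom, Set.mem_iInter]
    constructor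
    · rintro ⟨h1, h2⟩
      refine ⟨fun j => decide (x ∈ s j), by simpa using h1, h2, fun j => ?_⟩
      by_cases hj : x ∈ s j <;> simp [hj]
    · rintro ⟨ε, h1, h2, h3⟩
      have := h3 i
      rw [h1] at this
      exact ⟨this, h2⟩
  · intro ε _ ε' _ hne
    exact disjoint_atom s S hne
  · intro ε _
    exact measurableSet_atom hs hS ε

/-- The axiom gives independence for disjoint sets only, while the sets in each family may overlap.
Refined into atoms inside `S` and inside `W`, both families become parts of one disjoint family, and
the original counts are sums of atomic counts. -/
lemma IsPoissonProcess.indepFun_counts {N : Ω → Measure ℝ} {ρ : ℝ → ℝ}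
    (h : IsPoissonProcess P N ρ) {S W : Set ℝ} (hS : MeasurableSet S) (hW : MeasurableSet W)
    (hS0 : S ⊆ Set.Ioi 0) (hW0 : W ⊆ Set.Ioi 0) (hSW : Disjoint S W)
    {ι κ : Type*} [Fintype ι] [Fintype κ] {s : ι → Set ℝ} {r : κ → Set ℝ}
    (hs : ∀ i, MeasurableSet (s i)) (hr : ∀ i, MeasurableSet (r i)) :
    IndepFun (fun ω i => N ω (s i ∩ S)) (fun ω j => N ω (r j ∩ W)) P := by
  classical
  let B : (ι → Bool) ⊕ (κ → Bool) → Set ℝ := Sum.elim (atom s S) (atom r W)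
  have hi : iIndepFun (fun i ω => N ω (B i)) P := by
    refine h.iIndepFun_fintype ?_ ?_ ?_
    · rintro (ε | ε)
      exacts [measurableSet_atom hs hS ε, measurableSet_atom hr hW ε]
    · rintro (ε | ε)
      exacts [Set.inter_subset_left.trans hS0, Set.inter_subset_left.trans hW0]
    · rintro (ε | ε) (ε' | ε') hne
      · exact disjoint_atom s S fun h => hne (by rw [h])
      · exact hSW.mono Set.inter_subset_left Set.inter_subset_left
      · exact hSW.symm.mono Set.inter_subset_left Set.inter_subset_left
      · exact disjoint_atom r W fun h => hne (by rw [h])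
  have hBm : ∀ i, Measurable (fun ω => N ω (B i)) := by
    rintro (ε | ε)
    · exact (Measure.measurable_coe (measurableSet_atom hs hS ε)).comp h.measurable
    · exact (Measure.measurable_coe (measurableSet_atom hr hW ε)).comp h.measurable
  have hf := hi.indepFun_finset (Finset.univ.map Function.Embedding.inl)
    (Finset.univ.map Function.Embedding.inr) (by
      rw [Finset.disjoint_left]
      simp) hBm
  have hl : ∀ ε, Sum.inl ε ∈ (Finset.univ.map Function.Embedding.inl :
      Finset ((ι → Bool) ⊕ (κ → Bool))) := by simp
  have hrr : ∀ ε, Sum.inr ε ∈ (Finset.univ.map Function.Embedding.inr :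
      Finset ((ι → Bool) ⊕ (κ → Bool))) := by simp
  let φ : (↥(Finset.univ.map Function.Embedding.inl : Finset ((ι → Bool) ⊕ (κ → Bool))) → ENNReal)
      → ι → ENNReal := fun v i => ∑ ε : ι → Bool, if ε i then v ⟨Sum.inl ε, hl ε⟩ else 0
  let ψ : (↥(Finset.univ.map Function.Embedding.inr : Finset ((ι → Bool) ⊕ (κ → Bool))) → ENNReal)
      → κ → ENNReal := fun v i => ∑ ε : κ → Bool, if ε i then v ⟨Sum.inr ε, hrr ε⟩ else 0
  have hφ : Measurable φ := by
    refine measurable_pi_lambda _ fun i => Finset.measurable_sum _ fun ε _ => ?_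
    split_ifs
    exacts [measurable_pi_apply _, measurable_const]
  have hψ : Measurable ψ := by
    refine measurable_pi_lambda _ fun i => Finset.measurable_sum _ fun ε _ => ?_
    split_ifs
    exacts [measurable_pi_apply _, measurable_const]
  convert hf.comp hφ hψ using 1
  · funext ω i
    exact measure_inter_eq_sum_atom hs hS _ i
  · funext ω i
    exact measure_inter_eq_sum_atom hr hW _ i

/-- The σ-algebra on measures is generated by the evaluations, and the evaluation of a restriction
at `s` is the count of `s ∩ S`. -/
lemma comap_restrict_eq_iSup {Ω : Type*} (N : Ω → Measure ℝ) (S : Set ℝ) :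
    MeasurableSpace.comap (fun ω => (N ω).restrict S) inferInstance
      = ⨆ s : {s : Set ℝ // MeasurableSet s},
          MeasurableSpace.comap (fun ω => N ω (s.1 ∩ S)) inferInstance := by
  have : (inferInstance : MeasurableSpace (Measure ℝ))
      = ⨆ s : {s : Set ℝ // MeasurableSet s},
          MeasurableSpace.comap (fun μ : Measure ℝ => μ s.1) inferInstance := by
    rw [iSup_subtype]
    rfl
  rw [this, MeasurableSpace.comap_iSup]
  refine iSup_congr fun s => ?_
  rw [MeasurableSpace.comap_comp]
  congr 1
  funext ω
  exact Measure.restrict_apply s.2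

/-- The restrictions of a Poisson process to disjoint sets are independent. -/
lemma IsPoissonProcess.indepFun_restrict [IsProbabilityMeasure P] {N : Ω → Measure ℝ} {ρ : ℝ → ℝ}
    (h : IsPoissonProcess P N ρ) {S W : Set ℝ} (hS : MeasurableSet S) (hW : MeasurableSet W)
    (hS0 : S ⊆ Set.Ioi 0) (hW0 : W ⊆ Set.Ioi 0) (hSW : Disjoint S W) :
    IndepFun (fun ω => (N ω).restrict S) (fun ω => (N ω).restrict W) P := by
  -- Finite intersections of count events form a π-system that generates the restricted process, so
  -- independence has to be checked for finitely many counts only, which is `indepFun_counts`.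
  have key : ∀ V : Set ℝ, MeasurableSpace.comap (fun ω => (N ω).restrict V) inferInstance
      = MeasurableSpace.generateFrom (piiUnionInter
        (fun s : {s : Set ℝ // MeasurableSet s} => {t | MeasurableSet[MeasurableSpace.comap
          (fun ω => N ω (s.1 ∩ V)) inferInstance] t}) Set.univ) := by
    intro V
    refine Eq.trans ?_ (generateFrom_piiUnionInter_measurableSet (fun s : {s : Set ℝ //
      MeasurableSet s} => MeasurableSpace.comap (fun ω => N ω (s.1 ∩ V)) inferInstance) _).symm
    rw [comap_restrict_eq_iSup]
    simp
  rw [IndepFun_iff_Indep]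
  have hpi : ∀ V : Set ℝ, IsPiSystem (piiUnionInter
        (fun s : {s : Set ℝ // MeasurableSet s} => {t | MeasurableSet[MeasurableSpace.comap
          (fun ω => N ω (s.1 ∩ V)) inferInstance] t}) Set.univ) := fun V =>
    isPiSystem_piiUnionInter _ (fun s => @MeasurableSpace.isPiSystem_measurableSet _ (_)) _
  refine IndepSets.indep ?_ ?_ (hpi S) (hpi W) (key S) (key W) ?_
  · exact ((measurable_restrict_measure hS).comp h.measurable).comap_le
  · exact ((measurable_restrict_measure hW).comp h.measurable).comap_le
  rw [IndepSets_iff]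
  rintro _ _ ⟨F, -, f, hf, rfl⟩ ⟨F', -, g, hg, rfl⟩
  have hc := h.indepFun_counts hS hW hS0 hW0 hSW (fun i : F => i.1.2) (fun i : F' => i.1.2)
  rw [IndepFun_iff] at hc
  refine hc _ _ ?_ ?_
  · refine Finset.measurableSet_biInter _ fun i hi => ?_
    obtain ⟨u, hu, hfu⟩ := hf i hi
    exact ⟨(fun v => v ⟨i, hi⟩) ⁻¹' u, measurable_pi_apply _ hu, hfu⟩
  · refine Finset.measurableSet_biInter _ fun i hi => ?_
    obtain ⟨u, hu, hfu⟩ := hg i hi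
    exact ⟨(fun v => v ⟨i, hi⟩) ⁻¹' u, measurable_pi_apply _ hu, hfu⟩

end Poisson

end OnlineNet

/-! ### Exponential moments and the Laplace functional of a Poisson process. -/

namespace OnlineNet

section Poisson

variable {Ω : Type*} [MeasurableSpace Ω] {P : Measure Ω}

lemma hasSum_poisson_exp (r : NNReal) (c : ℝ) :
    HasSum (fun n : ℕ => Real.exp (-r) * (r : ℝ) ^ n / (n.factorial : ℝ) * Real.exp (c * n))
      (Real.exp (r * (Real.exp c - 1))) := by
  have h := (NormedSpace.expSeries_div_hasSum_exp (𝔸 := ℝ) ((r : ℝ) * Real.exp c)).mul_left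
    (Real.exp (-r))
  rw [← Real.exp_eq_exp_ℝ, ← Real.exp_add] at h
  convert! h using 1
  · funext n
    rw [mul_pow, mul_comm c, Real.exp_nat_mul]
    ring
  · congr 1; ring

lemma integrable_exp_poisson (r : NNReal) (c : ℝ) :
    Integrable (fun n : ℕ => Real.exp (c * n)) (poissonMeasure r) := by
  rw [integrable_poissonMeasure_iff]
  simpa [Real.norm_eq_abs] using (hasSum_poisson_exp r c).summable

lemma integral_exp_poisson (r : NNReal) (c : ℝ) :
    ∫ n : ℕ, Real.exp (c * n) ∂(poissonMeasure r) = Real.exp (r * (Real.exp c - 1)) := by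
  rw [integral_poissonMeasure]
  simpa using (hasSum_poisson_exp r c).tsum_eq

lemma measurable_exp_mul_toReal (c : ℝ) :
    Measurable fun x : ENNReal => Real.exp (c * x.toReal) := by fun_prop

variable {N : Ω → Measure ℝ} {ρ : ℝ → ℝ} {B W : Set ℝ}

lemma IsPoissonProcess.integrable_exp_count (h : IsPoissonProcess P N ρ) (hB : MeasurableSet B)
    (hb : Bornology.IsBounded B) (hpos : B ⊆ Set.Ioi 0) (c : ℝ) :
    Integrable (fun ω => Real.exp (c * (N ω B).toReal)) P := by
  have hl := h.law B hB hb hpos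
  have h1 : Integrable (fun x : ENNReal => Real.exp (c * x.toReal)) (P.map fun ω => N ω B) := by
    rw [hl.map_eq, integrable_map_measure (measurable_exp_mul_toReal c).aestronglyMeasurable
      (by fun_prop)]
    simpa [Function.comp_def] using integrable_exp_poisson _ c
  exact h1.comp_aemeasurable hl.aemeasurable

lemma IsPoissonProcess.integral_exp_count (h : IsPoissonProcess P N ρ) (hB : MeasurableSet B)
    (hb : Bornology.IsBounded B) (hpos : B ⊆ Set.Ioi 0) (hρ : 0 ≤ ∫ t in B, ρ t) (c : ℝ) :
    ∫ ω, Real.exp (c * (N ω B).toReal) ∂P = Real.exp ((∫ t in B, ρ t) * (Real.exp c - 1)) := by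
  have hl := h.law B hB hb hpos
  have h1 := hl.integral_comp (measurable_exp_mul_toReal c).aestronglyMeasurable
  rw [Function.comp_def] at h1
  rw [h1, integral_map (by fun_prop) (measurable_exp_mul_toReal c).aestronglyMeasurable]
  simp only [ENNReal.toReal_natCast]
  rw [integral_exp_poisson, Real.coe_toNNReal _ hρ]

lemma IsPoissonProcess.ae_lt_top (h : IsPoissonProcess P N ρ) (hB : MeasurableSet B)
    (hb : Bornology.IsBounded B) (hpos : B ⊆ Set.Ioi 0) : ∀ᵐ ω ∂P, N ω B < ⊤ := by
  have hl := h.law B hB hb hpos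
  rw [hl.ae_iff (p := fun x : ENNReal => x < ⊤) (measurableSet_Iio.mem)]
  rw [ae_map_iff (by fun_prop) measurableSet_Iio]
  exact Eventually.of_forall fun n => ENNReal.natCast_lt_top n

/-- The integral of a simple function is a linear combination of counts of the disjoint level sets;
these are independent Poisson variables, so the moment generating functions multiply. Measurability
is carried along because the passage to general integrands needs it. -/
lemma IsPoissonProcess.integral_exp_simpleFunc [IsProbabilityMeasure P]
    (h : IsPoissonProcess P N ρ) (hW : MeasurableSet W)
    (hb : Bornology.IsBounded W) (hpos : W ⊆ Set.Ioi 0) {R : Measure ℝ} [IsFiniteMeasure R]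
    (hR : ∀ B ⊆ W, MeasurableSet B → ∫ t in B, ρ t = R.real B) (f : SimpleFunc ℝ ℝ) :
    AEStronglyMeasurable (fun ω => ∫ t in W, f t ∂(N ω)) P ∧
    ∫ ω, Real.exp (∫ t in W, f t ∂(N ω)) ∂P
      = Real.exp (∫ t in W, (Real.exp (f t) - 1) ∂(R)) := by
  have hm : ∀ c, MeasurableSet (f ⁻¹' {c} ∩ W) := fun c => (f.measurableSet_preimage _).inter hW
  have hsub : ∀ c, f ⁻¹' {c} ∩ W ⊆ W := fun c => Set.inter_subset_right
  let Y : f.range → Ω → ℝ := fun c ω => c.1 * (N ω (f ⁻¹' {c.1} ∩ W)).toReal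
  have hYm : ∀ c, Measurable (Y c) := fun c =>
    ((Measure.measurable_coe (hm c.1)).comp h.measurable).ennreal_toReal.const_mul _
  -- The Bochner integral over `W` is a sum over level sets once `N ω W` is finite, which holds
  -- almost surely.
  have hfin := h.ae_lt_top hW hb hpos
  have hsum : ∀ (ν : Measure ℝ), ν W < ⊤ → ∀ g : ℝ → ℝ, (∫ t in W, g (f t) ∂ν)
      = ∑ c ∈ f.range, g c * (ν (f ⁻¹' {c} ∩ W)).toReal := by
    intro ν hν g
    have : IsFiniteMeasure (ν.restrict W) := ⟨by simpa using hν⟩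
    have h1 : ∀ t, g (f t) = ∑ c ∈ f.range, (f ⁻¹' {c}).indicator (fun _ => g c) t := by
      intro t
      rw [Finset.sum_eq_single (f t)]
      · simp
      · intro c _ hc
        exact Set.indicator_of_notMem (fun h => hc (by simpa using h.symm)) _
      · intro h
        exact absurd (f.mem_range_self t) h
    simp only [h1]
    rw [integral_finsetSum _ fun c _ => (integrable_const _).indicator (f.measurableSet_preimage _)]
    refine Finset.sum_congr rfl fun c _ => ?_
    rw [integral_indicator (f.measurableSet_preimage _), setIntegral_const, smul_eq_mul, mul_comm,
      Measure.real, Measure.restrict_apply (f.measurableSet_preimage _)]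
  have hYsum : ∀ᵐ ω ∂P, ∫ t in W, f t ∂(N ω) = (∑ c ∈ Finset.univ, Y c) ω := by
    filter_upwards [hfin] with ω hω
    rw [Finset.sum_apply]
    refine (hsum (N ω) hω id).trans ?_
    rw [← Finset.sum_coe_sort]
    rfl
  have hind : iIndepFun Y P := by
    have := h.iIndepFun_fintype (ι := f.range) (B := fun c => f ⁻¹' {c.1} ∩ W)
      (fun c => hm _) (fun c => (hsub _).trans hpos) (by
        intro c c' hcc
        refine Disjoint.mono Set.inter_subset_left Set.inter_subset_left ?_
        exact Disjoint.preimage _ (Set.disjoint_singleton.2 fun h => hcc (Subtype.ext h)))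
    exact this.comp (fun c x => c.1 * x.toReal) (fun c => by fun_prop)
  refine ⟨⟨fun ω => ∑ c, Y c ω,
    (Finset.measurable_sum Finset.univ fun c _ => hYm c).stronglyMeasurable, ?_⟩, ?_⟩
  · filter_upwards [hYsum] with ω hω
    rw [hω, Finset.sum_apply]
  · have hmgf := hind.mgf_sum hYm Finset.univ (t := 1)
    have h1 : ∫ ω, Real.exp (∫ t in W, f t ∂(N ω)) ∂P = mgf (∑ c, Y c) P 1 := by
      unfold mgf
      refine integral_congr_ae ?_
      filter_upwards [hYsum] with ω hω
      rw [hω, one_mul]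
    have h2 : ∀ c : f.range, mgf (Y c) P 1
        = Real.exp ((Real.exp c.1 - 1) * (R (f ⁻¹' {c.1} ∩ W)).toReal) := by
      intro c
      have hr := hR _ (hsub c.1) (hm c.1)
      have := h.integral_exp_count (hm c.1) (hb.subset (hsub _)) ((hsub _).trans hpos)
        (by rw [hr]; positivity) c.1
      rw [hr] at this
      unfold mgf
      simp only [one_mul, Y]
      rw [this, mul_comm]
      rfl
    rw [h1, hmgf, Finset.prod_congr rfl fun c _ => h2 c, ← Real.exp_sum,
      hsum R (measure_lt_top R W) (fun x => Real.exp x - 1),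
      Finset.sum_coe_sort f.range (fun c => (Real.exp c - 1) * (R (f ⁻¹' {c} ∩ W)).toReal)]

/-- The Laplace functional of a Poisson process. -/
lemma IsPoissonProcess.integral_exp [IsProbabilityMeasure P]
    (h : IsPoissonProcess P N ρ) (hW : MeasurableSet W)
    (hb : Bornology.IsBounded W) (hpos : W ⊆ Set.Ioi 0) {R : Measure ℝ} [IsFiniteMeasure R]
    (hR : ∀ B ⊆ W, MeasurableSet B → ∫ t in B, ρ t = R.real B) {f : ℝ → ℝ} (hf : Measurable f)
    {b : ℝ} (hfb : ∀ t, |f t| ≤ b) :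
    Integrable (fun ω => Real.exp (∫ t in W, f t ∂(N ω))) P ∧
    ∫ ω, Real.exp (∫ t in W, f t ∂(N ω)) ∂P
      = Real.exp (∫ t in W, (Real.exp (f t) - 1) ∂(R)) := by
  have hb0 : 0 ≤ b := (abs_nonneg _).trans (hfb 0)
  -- These simple approximations respect the bound `b`, so both sides pass to the limit by dominated
  -- convergence; on the left the dominating variable is `exp (b * N ω W)`, integrable because the
  -- count is Poisson.
  let F : ℕ → SimpleFunc ℝ ℝ := hf.stronglyMeasurable.approxBounded b
  have hFb : ∀ n t, |F n t| ≤ b := fun n t => hf.stronglyMeasurable.norm_approxBounded_le hb0 n t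
  have hFt : ∀ t, Tendsto (fun n => F n t) atTop (𝓝 (f t)) := fun t =>
    hf.stronglyMeasurable.tendsto_approxBounded_of_norm_le (hfb t)
  have hfin := h.ae_lt_top hW hb hpos
  have hint := h.integrable_exp_count hW hb hpos b
  have hbd : ∀ (g : ℝ → ℝ), (∀ t, |g t| ≤ b) → ∀ᵐ ω ∂P,
      ‖Real.exp (∫ t in W, g t ∂(N ω))‖ ≤ Real.exp (b * (N ω W).toReal) := by
    intro g hg
    filter_upwards [hfin] with ω hω
    rw [Real.norm_eq_abs, Real.abs_exp, Real.exp_le_exp]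
    have := norm_setIntegral_le_of_norm_le_const (f := g) hω (fun t _ => hg t)
    exact (le_abs_self _).trans this
  have htend : ∀ᵐ ω ∂P, Tendsto (fun n => Real.exp (∫ t in W, F n t ∂(N ω))) atTop
      (𝓝 (Real.exp (∫ t in W, f t ∂(N ω)))) := by
    filter_upwards [hfin] with ω hω
    have : IsFiniteMeasure ((N ω).restrict W) := ⟨by simpa using hω⟩
    refine (Real.continuous_exp.tendsto _).comp ?_
    exact tendsto_integral_of_dominated_convergence (fun _ => b)
      (fun n => (F n).measurable.aestronglyMeasurable) (integrable_const _)
      (fun n => Eventually.of_forall (hFb n)) (Eventually.of_forall hFt)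
  have hmeas : ∀ n, AEStronglyMeasurable (fun ω => Real.exp (∫ t in W, F n t ∂(N ω))) P :=
    fun n => Real.continuous_exp.comp_aestronglyMeasurable
      (h.integral_exp_simpleFunc hW hb hpos hR (F n)).1
  have hlim := tendsto_integral_of_dominated_convergence _ hmeas hint
    (fun n => hbd (F n) (hFb n)) htend
  refine ⟨hint.mono' (aestronglyMeasurable_of_tendsto_ae atTop hmeas htend) (hbd f hfb), ?_⟩
  refine tendsto_nhds_unique hlim ?_
  simp only [fun n => (h.integral_exp_simpleFunc hW hb hpos hR (F n)).2]
  refine (Real.continuous_exp.tendsto _).comp ?_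
  refine tendsto_integral_of_dominated_convergence (fun _ => Real.exp b + 1)
      (fun n => ?_) (integrable_const _)
      (fun n => Eventually.of_forall fun t => ?_) (Eventually.of_forall fun t => ?_)
  · exact ((Real.measurable_exp.comp (F n).measurable).sub_const 1).aestronglyMeasurable
  · rw [Real.norm_eq_abs]
    refine (abs_sub _ _).trans ?_
    rw [Real.abs_exp, abs_one]
    gcongr
    exact (le_abs_self _).trans (hFb n t)
  · exact ((Real.continuous_exp.tendsto _).comp (hFt t)).sub_const 1

end Poisson

end OnlineNet

namespace OnlineNet

/-! ## Independence of tuples and decoupling -/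

section Decoupling

variable {Ω : Type*} [MeasurableSpace Ω] {P : Measure Ω}

/-- Rectangles generate both product σ-algebras. On a pair of rectangles the probability factors
first over the index and then within each index. -/
lemma indepFun_pi_of_iIndepFun_prod {ι α β : Type*} [Fintype ι] [MeasurableSpace α]
    [MeasurableSpace β] [IsProbabilityMeasure P] {U : ι → Ω → α} {V : ι → Ω → β}
    (hU : ∀ i, Measurable (U i)) (hV : ∀ i, Measurable (V i))
    (h : iIndepFun (fun i ω => (U i ω, V i ω)) P) (hi : ∀ i, IndepFun (U i) (V i) P) :
    IndepFun (fun ω i => U i ω) (fun ω i => V i ω) P := by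
  have hUi : iIndepFun U P := h.comp (fun _ => Prod.fst) fun _ => measurable_fst
  have hVi : iIndepFun V P := h.comp (fun _ => Prod.snd) fun _ => measurable_snd
  rw [IndepFun_iff_Indep]
  refine IndepSets.indep (measurable_pi_lambda _ hU).comap_le (measurable_pi_lambda _ hV).comap_le
    ((isPiSystem_pi (α := fun _ : ι => α)).comap fun ω i => U i ω)
    ((isPiSystem_pi (α := fun _ : ι => β)).comap fun ω i => V i ω) ?_ ?_ ?_
  · rw [← generateFrom_pi, MeasurableSpace.comap_generateFrom]
    rfl
  · rw [← generateFrom_pi, MeasurableSpace.comap_generateFrom]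
    rfl
  rw [IndepSets_iff]
  rintro _ _ ⟨_, ⟨s, hs, rfl⟩, rfl⟩ ⟨_, ⟨t, ht, rfl⟩, rfl⟩
  have hs' : ∀ i, MeasurableSet (s i) := fun i => hs i trivial
  have ht' : ∀ i, MeasurableSet (t i) := fun i => ht i trivial
  have e1 : (fun ω i => U i ω) ⁻¹' (Set.univ.pi s) = ⋂ i, U i ⁻¹' s i := by ext; simp
  have e2 : (fun ω i => V i ω) ⁻¹' (Set.univ.pi t) = ⋂ i, V i ⁻¹' t i := by ext; simp
  rw [e1, e2, ← Set.iInter_inter_distrib]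
  rw [hUi.meas_iInter fun i => ⟨s i, hs' i, rfl⟩, hVi.meas_iInter fun i => ⟨t i, ht' i, rfl⟩,
    ← Finset.prod_mul_distrib]
  rw [h.meas_iInter (s := fun i => U i ⁻¹' s i ∩ V i ⁻¹' t i)
    fun i => ⟨s i ×ˢ t i, (hs' i).prod (ht' i), rfl⟩]
  refine Finset.prod_congr rfl fun i _ => ?_
  exact (hi i).meas_inter ⟨s i, hs' i, rfl⟩ ⟨t i, ht' i, rfl⟩

variable {𝕏 : Type*} [MeasurableSpace 𝕏] {μ : Measure 𝕏} [IsProbabilityMeasure μ] {u v : 𝕏 → 𝕏}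

/-- If `u` and `v` are independent, a functional of `u` and `v` is integrated by integrating first
over an independent copy. -/
lemma lintegral_decouple (hu : Measurable u) (hv : Measurable v) (huv : IndepFun u v μ)
    {J : 𝕏 → 𝕏 → ENNReal} (hJ : Measurable (Function.uncurry J))
    (h1 : ∀ x y, J (u x) y = J x y) (h2 : ∀ x y, J x (v y) = J x y) :
    ∫⁻ x, J x x ∂μ = ∫⁻ x, ∫⁻ y, J x y ∂μ ∂μ := by
  have hmap := (indepFun_iff_map_prod_eq_prod_map_map hu.aemeasurable hv.aemeasurable).1 huv
  have := Measure.isProbabilityMeasure_map (μ := μ) hu.aemeasurable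
  have := Measure.isProbabilityMeasure_map (μ := μ) hv.aemeasurable
  calc ∫⁻ x, J x x ∂μ = ∫⁻ x, Function.uncurry J (u x, v x) ∂μ := by
        simp [Function.uncurry, h1, h2]
    _ = ∫⁻ p, Function.uncurry J p ∂(μ.map fun x => (u x, v x)) :=
        (lintegral_map hJ (hu.prodMk hv)).symm
    _ = ∫⁻ x, ∫⁻ y, J x y ∂(μ.map v) ∂(μ.map u) := by
        rw [hmap, lintegral_prod _ hJ.aemeasurable]
        rfl
    _ = ∫⁻ x, ∫⁻ y, J x y ∂μ ∂μ := by
        rw [lintegral_map (f := fun x => ∫⁻ y, J x y ∂(μ.map v)) hJ.lintegral_prod_right' hu]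
        refine lintegral_congr fun x => ?_
        rw [lintegral_map (f := fun y => J (u x) y) (hJ.comp measurable_prodMk_left) hv]
        simp only [h1, h2]

lemma integral_decouple (hu : Measurable u) (hv : Measurable v) (huv : IndepFun u v μ)
    {J : 𝕏 → 𝕏 → ℝ} (hJ : Measurable (Function.uncurry J))
    (h1 : ∀ x y, J (u x) y = J x y) (h2 : ∀ x y, J x (v y) = J x y)
    (hint : Integrable (fun x => J x x) μ) :
    ∫ x, J x x ∂μ = ∫ x, ∫ y, J x y ∂μ ∂μ := by
  have hmap := (indepFun_iff_map_prod_eq_prod_map_map hu.aemeasurable hv.aemeasurable).1 huv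
  have := Measure.isProbabilityMeasure_map (μ := μ) hu.aemeasurable
  have := Measure.isProbabilityMeasure_map (μ := μ) hv.aemeasurable
  have he : ∀ x, Function.uncurry J (u x, v x) = J x x := by simp [Function.uncurry, h1, h2]
  -- Integrability is only assumed on the diagonal; independence transports it to the product law,
  -- where Fubini applies.
  have hint' : Integrable (Function.uncurry J) ((μ.map u).prod (μ.map v)) := by
    rw [← hmap, integrable_map_measure hJ.aestronglyMeasurable (hu.prodMk hv).aemeasurable]
    simpa [Function.comp_def, he] using hint
  calc ∫ x, J x x ∂μ = ∫ x, Function.uncurry J (u x, v x) ∂μ := by simp only [he]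
    _ = ∫ p, Function.uncurry J p ∂(μ.map fun x => (u x, v x)) :=
        (integral_map (hu.prodMk hv).aemeasurable hJ.aestronglyMeasurable).symm
    _ = ∫ x, ∫ y, J x y ∂(μ.map v) ∂(μ.map u) := by
        rw [hmap, integral_prod _ hint']
        rfl
    _ = ∫ x, ∫ y, J x y ∂μ ∂μ := by
        rw [integral_map hu.aemeasurable
          hJ.stronglyMeasurable.integral_prod_right.aestronglyMeasurable]
        refine integral_congr_ae (Eventually.of_forall fun x => ?_)
        change ∫ y, J (u x) y ∂(μ.map v) = _
        rw [integral_map (f := fun y => J (u x) y) hv.aemeasurable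
          (hJ.comp measurable_prodMk_left).aestronglyMeasurable]
        simp only [h1, h2]

omit [IsProbabilityMeasure μ] in
lemma measurable_diag {J : 𝕏 → 𝕏 → ℝ} (hJ : Measurable (Function.uncurry J)) :
    Measurable fun x => J x x := hJ.comp (measurable_id.prodMk measurable_id)

/-- The second moment of a sum of martingale differences, each of which is a functional of the past
and of an independent innovation. -/
lemma lintegral_sq_sum_le {φ : ℕ → 𝕏 → 𝕏 → ℝ} {u v : ℕ → 𝕏 → 𝕏} {N : ℕ} {σ : ℝ} (hσ : 0 ≤ σ)
    (hu : ∀ s, Measurable (u s)) (hv : ∀ s, Measurable (v s))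
    (huv : ∀ s < N, IndepFun (u s) (v s) μ)
    (hφ : ∀ s, Measurable (Function.uncurry (φ s)))
    (h1 : ∀ s x y, φ s (u s x) y = φ s x y) (h2 : ∀ s x y, φ s x (v s y) = φ s x y)
    (hpast : ∀ s r, r < s → ∀ x, φ r (u s x) (u s x) = φ r x x)
    (hmean : ∀ s < N, ∀ x, ∫ y, φ s x y ∂μ = 0)
    (hvar : ∀ s < N, ∀ x, ∫⁻ y, ENNReal.ofReal (φ s x y ^ 2) ∂μ ≤ ENNReal.ofReal σ) :
    ∫⁻ x, ENNReal.ofReal ((∑ s ∈ Finset.range N, φ s x x) ^ 2) ∂μ ≤ ENNReal.ofReal (N * σ) := by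
  have hL : ∀ s < N, MemLp (fun x => φ s x x) 2 μ ∧ ∫ x, φ s x x ^ 2 ∂μ ≤ σ := by
    intro s hs
    have hm := measurable_diag (hφ s)
    have hb : ∫⁻ x, ENNReal.ofReal (φ s x x ^ 2) ∂μ ≤ ENNReal.ofReal σ := by
      rw [lintegral_decouple (hu s) (hv s) (huv s hs)
        (J := fun x y => ENNReal.ofReal (φ s x y ^ 2)) ((hφ s).pow_const 2).ennreal_ofReal
        (fun x y => by rw [h1]) (fun x y => by rw [h2])]
      calc _ ≤ ∫⁻ _, ENNReal.ofReal σ ∂μ := lintegral_mono fun x => hvar s hs x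
        _ = _ := by simp
    have hi : Integrable (fun x => φ s x x ^ 2) μ := by
      refine ⟨(hm.pow_const 2).aestronglyMeasurable, ?_⟩
      rw [hasFiniteIntegral_iff_ofReal (Eventually.of_forall fun x => sq_nonneg _)]
      exact hb.trans_lt ENNReal.ofReal_lt_top
    refine ⟨(memLp_two_iff_integrable_sq hm.aestronglyMeasurable).2 hi, ?_⟩
    rw [integral_eq_lintegral_of_nonneg_ae (Eventually.of_forall fun x => sq_nonneg _)
      (hm.pow_const 2).aestronglyMeasurable]
    exact ENNReal.toReal_le_of_le_ofReal hσ hb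
  have key : ∀ n ≤ N, MemLp (fun x => ∑ s ∈ Finset.range n, φ s x x) 2 μ ∧
      ∫ x, (∑ s ∈ Finset.range n, φ s x x) ^ 2 ∂μ ≤ n * σ := by
    intro n
    induction n with
    | zero => intro _; simp
    | succ n ih =>
      intro hn
      obtain ⟨ih1, ih2⟩ := ih (by omega)
      obtain ⟨hn1, hn2⟩ := hL n (by omega)
      simp only [Finset.sum_range_succ]
      refine ⟨ih1.add hn1, ?_⟩
      -- The partial sum depends on the past alone, so after decoupling it is a constant factor in
      -- front of an innovation of mean zero.
      have hcross : ∫ x, (∑ s ∈ Finset.range n, φ s x x) * φ n x x ∂μ = 0 := by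
        rw [integral_decouple (hu n) (hv n) (huv n (by omega))
          (J := fun x y => (∑ s ∈ Finset.range n, φ s x x) * φ n x y)]
        · simp only [integral_const_mul, hmean n (by omega), mul_zero, integral_zero]
        · refine Measurable.mul ?_ (hφ n)
          exact (Finset.measurable_sum _ fun s _ => measurable_diag (hφ s)).comp measurable_fst
        · intro x y
          rw [h1]
          congr 1
          exact Finset.sum_congr rfl fun s hs => hpast n s (Finset.mem_range.1 hs) x
        · intro x y
          rw [h2]
        · exact ih1.integrable_mul hn1
      have i1 := (memLp_two_iff_integrable_sq ih1.1).1 ih1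
      have i2 := (memLp_two_iff_integrable_sq hn1.1).1 hn1
      have i3 : Integrable (fun x => 2 * ((∑ s ∈ Finset.range n, φ s x x) * φ n x x)) μ :=
        (ih1.integrable_mul hn1).const_mul 2
      have i4 : Integrable (fun x => (∑ s ∈ Finset.range n, φ s x x) ^ 2
            + 2 * ((∑ s ∈ Finset.range n, φ s x x) * φ n x x)) μ := i1.add i3
      have : ∀ x, ((∑ s ∈ Finset.range n, φ s x x) + φ n x x) ^ 2
          = (∑ s ∈ Finset.range n, φ s x x) ^ 2
            + 2 * ((∑ s ∈ Finset.range n, φ s x x) * φ n x x) + φ n x x ^ 2 := fun x => by ring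
      simp only [this]
      rw [integral_add i4 i2, integral_add i1 i3, integral_const_mul, hcross]
      push_cast
      linarith
  obtain ⟨k1, k2⟩ := key N le_rfl
  rw [← ofReal_integral_eq_lintegral_ofReal ((memLp_two_iff_integrable_sq k1.1).1 k1)
    (Eventually.of_forall fun x => sq_nonneg _)]
  exact ENNReal.ofReal_le_ofReal k2

end Decoupling

end OnlineNet

namespace OnlineNet

noncomputable section

/-! ## Edge data: tuples of finite measures -/

/-- Finite measures on the line. -/
abbrev FinMeas := {μ : Measure ℝ // IsFiniteMeasure μ}

instance (μ : FinMeas) : IsFiniteMeasure μ.1 := μ.2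

/-- A finite measure for every ordered pair of nodes. -/
abbrev EdgeData (m : ℕ) := Fin m × Fin m → FinMeas

/-- Restriction of all the streams to a set of times. -/
def restrictData {m : ℕ} (S : Set ℝ) (x : EdgeData m) : EdgeData m :=
  fun e => ⟨(x e).1.restrict S, inferInstance⟩

lemma measurable_restrictData {m : ℕ} {S : Set ℝ} (hS : MeasurableSet S) :
    Measurable (restrictData S : EdgeData m → EdgeData m) := by
  refine measurable_pi_lambda _ fun e => Measurable.subtype_mk ?_
  exact (measurable_restrict_measure hS).comp (measurable_subtype_coe.comp (measurable_pi_apply e))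

/-- Cutting the space according to the integer part of the total mass makes the kernel uniformly
bounded on each piece. This is needed because the total masses of the data are finite but not
bounded. -/
lemma isSFiniteKernel_of_isFiniteMeasure {α β : Type*} [MeasurableSpace α] [MeasurableSpace β]
    (κ : Kernel α β) (h : ∀ a, IsFiniteMeasure (κ a)) : IsSFiniteKernel κ := by
  have hm : Measurable fun a => ⌊(κ a Set.univ).toReal⌋₊ :=
    (κ.measurable_coe MeasurableSet.univ).ennreal_toReal.nat_floor
  have hs : ∀ n : ℕ, MeasurableSet {a | ⌊(κ a Set.univ).toReal⌋₊ = n} := fun n =>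
    hm (measurableSet_singleton n)
  classical
  refine ⟨⟨fun n => Kernel.piecewise (hs n) κ 0, fun n => ⟨⟨ENNReal.ofReal (n + 1),
    ENNReal.ofReal_lt_top, fun a => ?_⟩⟩, ?_⟩⟩
  · rw [Kernel.piecewise_apply']
    split_ifs with ha
    · rw [← ENNReal.ofReal_toReal (measure_ne_top (κ a) Set.univ)]
      refine ENNReal.ofReal_le_ofReal ?_
      have ha' : ⌊(κ a Set.univ).toReal⌋₊ = n := ha
      rw [← ha']
      exact (Nat.lt_floor_add_one _).le
    · simp
  · ext a s hs'
    rw [Kernel.sum_apply' _ _ hs', tsum_eq_single ⌊(κ a Set.univ).toReal⌋₊]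
    · rw [Kernel.piecewise_apply', if_pos (by simp)]
    · intro n hn
      rw [Kernel.piecewise_apply', if_neg]
      · simp
      · exact fun h => hn h.symm

/-- Reading off one stream is an s-finite kernel, so integrals against it are measurable jointly in
the data and in the parameter. The joint form matters because the parameter of the run is itself a
function of the data. -/
lemma stronglyMeasurable_setIntegral_data {m : ℕ} {β F : Type*} [MeasurableSpace β]
    [NormedAddCommGroup F] [NormedSpace ℝ F] {f : β → ℝ → F}
    (hf : StronglyMeasurable (Function.uncurry f)) {W : Set ℝ} (hW : MeasurableSet W)
    (e : Fin m × Fin m) :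
    StronglyMeasurable fun p : β × EdgeData m => ∫ t in W, f p.1 t ∂(p.2 e).1 := by
  let κ : Kernel (β × EdgeData m) ℝ := ⟨fun p => (p.2 e).1.restrict W,
    (measurable_restrict_measure hW).comp
      (measurable_subtype_coe.comp ((measurable_pi_apply e).comp measurable_snd))⟩
  have : IsSFiniteKernel κ := isSFiniteKernel_of_isFiniteMeasure κ fun p => by
    change IsFiniteMeasure ((p.2 e).1.restrict W)
    infer_instance
  have h := StronglyMeasurable.integral_kernel_prod_right (κ := κ)
    (f := fun (p : β × EdgeData m) t => f p.1 t)
    (hf.comp_measurable ((measurable_fst.comp measurable_fst).prodMk measurable_snd))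
  exact h

lemma measurableSet_window (dT : ℝ) (n : ℕ) : MeasurableSet (window dT n) := measurableSet_Ioc

lemma window_subset {dT : ℝ} (hdT : 0 < dT) {n N : ℕ} (h1 : 1 ≤ n) (hN : n ≤ N) :
    window dT n ⊆ Set.Ioc 0 (N * dT) := by
  have h1' : (1 : ℝ) ≤ n := by exact_mod_cast h1
  have h2' : (n : ℝ) ≤ N := by exact_mod_cast hN
  refine Set.Ioc_subset_Ioc ?_ ?_
  · exact mul_nonneg (by linarith) hdT.le
  · exact mul_le_mul_of_nonneg_right h2' hdT.le

lemma disjoint_window {dT : ℝ} (n : ℕ) :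
    Disjoint (Set.Ioc 0 ((n : ℝ) * dT)) (window dT (n + 1)) := by
  rw [Set.disjoint_left]
  rintro t ⟨-, h1⟩ ⟨h2, -⟩
  push_cast at h2
  rw [add_sub_cancel_right] at h2
  exact absurd h1 (not_le.2 h2)

lemma volume_window {dT : ℝ} (hdT : 0 < dT) (n : ℕ) :
    volume.real (window dT n) = dT := by
  rw [window, Real.volume_real_Ioc_of_le (by nlinarith)]
  ring

/-! ## The law of the data -/

/-- The edge data under `μ` behave like Poisson processes with intensity measures `xm`, observed
over `N` windows. -/
structure PoissonData {m : ℕ} (A : Finset (Fin m × Fin m)) (dT : ℝ) (N : ℕ) (xm : EdgeData m)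
    (μ : Measure (EdgeData m)) : Prop where
  isProb : IsProbabilityMeasure μ
  laplace : ∀ n, 1 ≤ n → n ≤ N → ∀ f : Fin m × Fin m → ℝ → ℝ, (∀ e, Measurable (f e)) →
    ∀ b, (∀ e t, |f e t| ≤ b) →
      Integrable (fun x => Real.exp (∑ e ∈ A, ∫ t in window dT n, f e t ∂(x e).1)) μ ∧
      ∫ x, Real.exp (∑ e ∈ A, ∫ t in window dT n, f e t ∂(x e).1) ∂μ
        = Real.exp (∑ e ∈ A, ∫ t in window dT n, (Real.exp (f e t) - 1) ∂(xm e).1)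
  indep : ∀ n < N, IndepFun (restrictData (Set.Ioc 0 ((n : ℝ) * dT)))
    (restrictData (window dT (n + 1))) μ

/-- The restriction of a measure to `(0, H]`, if this is finite. -/
def trimMeas (H : ℝ) (ν : Measure ℝ) : FinMeas :=
  open Classical in
  ⟨if ν (Set.Ioc 0 H) < ⊤ then ν.restrict (Set.Ioc 0 H) else 0, by
    split_ifs with h
    · exact ⟨by simpa using h⟩
    · infer_instance⟩

lemma measurable_trimMeas (H : ℝ) : Measurable (trimMeas H) := by
  classical
  refine Measurable.subtype_mk (Measurable.ite ?_ (measurable_restrict_measure measurableSet_Ioc)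
    measurable_const)
  exact (Measure.measurable_coe measurableSet_Ioc) measurableSet_Iio

lemma trimMeas_val {H : ℝ} {ν : Measure ℝ} (h : ν (Set.Ioc 0 H) < ⊤) :
    (trimMeas H ν).1 = ν.restrict (Set.Ioc 0 H) := if_pos h

/-- The streams of the pairs in `A`, up to time `H`. -/
def trimData {m : ℕ} (A : Finset (Fin m × Fin m)) (H : ℝ) (x : Fin m × Fin m → Measure ℝ) :
    EdgeData m :=
  fun e => if e ∈ A then trimMeas H (x e) else ⟨0, inferInstance⟩

/-- The measures with densities `ρ` on `(0, H]`. -/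
def meanData {m : ℕ} (H : ℝ) (ρ : Fin m × Fin m → ℝ → ℝ) : EdgeData m := fun e =>
  open Classical in
  if h : IsFiniteMeasure ((volume.restrict (Set.Ioc 0 H)).withDensity fun t =>
    ENNReal.ofReal (ρ e t)) then ⟨_, h⟩ else ⟨0, inferInstance⟩

section meanData

variable {m : ℕ} {H : ℝ} {ρ : Fin m × Fin m → ℝ → ℝ} {e : Fin m × Fin m} {M : ℝ}

lemma meanData_val (hρ : ∀ t, 0 ≤ t → |ρ e t| ≤ M) :
    (meanData H ρ e).1
      = (volume.restrict (Set.Ioc 0 H)).withDensity fun t => ENNReal.ofReal (ρ e t) := by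
  have h : IsFiniteMeasure ((volume.restrict (Set.Ioc 0 H)).withDensity fun t =>
      ENNReal.ofReal (ρ e t)) := by
    refine isFiniteMeasure_withDensity (ne_of_lt ?_)
    calc ∫⁻ t in Set.Ioc 0 H, ENNReal.ofReal (ρ e t)
        ≤ ∫⁻ t in Set.Ioc 0 H, ENNReal.ofReal M := by
          refine setLIntegral_mono measurable_const fun t ht => ENNReal.ofReal_le_ofReal ?_
          exact (le_abs_self _).trans (hρ t ht.1.le)
      _ < ⊤ := by
          rw [setLIntegral_const]
          exact ENNReal.mul_lt_top ENNReal.ofReal_lt_top (by simp)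
  rw [meanData, dif_pos h]

lemma setIntegral_meanData (hm : Measurable (ρ e)) (hρ : ∀ t, 0 ≤ t → |ρ e t| ≤ M)
    (hpos : ∀ t, 0 ≤ t → 0 ≤ ρ e t) {W : Set ℝ}
    (hW : MeasurableSet W) (hWH : W ⊆ Set.Ioc 0 H) (f : ℝ → ℝ) :
    ∫ t in W, f t ∂(meanData H ρ e).1 = ∫ t in W, f t * ρ e t := by
  rw [meanData_val hρ, restrict_withDensity hW,
    integral_withDensity_eq_integral_toReal_smul hm.ennreal_ofReal (by simp),
    Measure.restrict_restrict_of_subset hWH]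
  refine setIntegral_congr_fun hW fun t ht => ?_
  simp only [smul_eq_mul]
  rw [ENNReal.toReal_ofReal (hpos t (hWH ht).1.le), mul_comm]

lemma meanData_real (hm : Measurable (ρ e)) (hρ : ∀ t, 0 ≤ t → |ρ e t| ≤ M)
    (hpos : ∀ t, 0 ≤ t → 0 ≤ ρ e t) {W : Set ℝ}
    (hW : MeasurableSet W) (hWH : W ⊆ Set.Ioc 0 H) :
    (meanData H ρ e).1.real W = ∫ t in W, ρ e t := by
  have := setIntegral_meanData hm hρ hpos hW hWH fun _ => 1
  simpa using this

lemma meanData_real_window_le (hm : Measurable (ρ e)) (hρ : ∀ t, 0 ≤ t → |ρ e t| ≤ M)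
    (hpos : ∀ t, 0 ≤ t → 0 ≤ ρ e t) {dT : ℝ} (hdT : 0 < dT) {n N : ℕ} (hn : 1 ≤ n) (hN : n ≤ N) :
    (meanData (N * dT) ρ e).1.real (window dT n) ≤ M * dT := by
  have hsub := window_subset hdT hn hN
  rw [meanData_real hm hρ hpos (measurableSet_window _ _) hsub]
  have := norm_setIntegral_le_of_norm_le_const (f := ρ e) (C := M) (μ := volume)
    (s := window dT n) (by simp [window]) (fun t ht => hρ t (hsub ht).1.le)
  rw [volume_window hdT] at this
  exact (le_abs_self _).trans this

end meanData

section law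

variable {p K m : ℕ} {Ω : Type*} [MeasurableSpace Ω] {P : Measure Ω} [IsProbabilityMeasure P]
  {lam : Intensity p K} {θs : EuclideanSpace ℝ (Fin p)} {A : Finset (Fin m × Fin m)}
  {zs : Fin m → Fin K} {X : Ω → Fin m × Fin m → Measure ℝ} {dT : ℝ}

omit [IsProbabilityMeasure P] in
lemma IsBlockPoisson.measurable_trimData (h : IsBlockPoisson P lam θs A zs X) (H : ℝ) :
    Measurable fun ω => trimData A H (X ω) := by
  refine measurable_pi_lambda _ fun e => ?_
  unfold trimData
  split_ifs with he
  · exact (measurable_trimMeas H).comp (h.poisson e he).measurable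
  · exact measurable_const

omit [IsProbabilityMeasure P] in
lemma IsBlockPoisson.ae_trimData (h : IsBlockPoisson P lam θs A zs X) (H : ℝ) :
    ∀ᵐ ω ∂P, ∀ e ∈ A, (trimData A H (X ω) e).1 = (X ω e).restrict (Set.Ioc 0 H) := by
  rw [Finset.eventually_all]
  intro e he
  filter_upwards [(h.poisson e he).ae_lt_top measurableSet_Ioc (Metric.isBounded_Ioc 0 H)
    Set.Ioc_subset_Ioi_self] with ω hω
  rw [trimData, if_pos he, trimMeas_val hω]

lemma restrict_window_trim (hdT : 0 < dT) {n N : ℕ} (hn : 1 ≤ n) (hN : n ≤ N) (ν : Measure ℝ) :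
    (ν.restrict (Set.Ioc 0 (N * dT))).restrict (window dT n) = ν.restrict (window dT n) :=
  Measure.restrict_restrict_of_subset (window_subset hdT hn hN)

/-- Within a pair the restrictions to disjoint time sets are independent, and different pairs are
independent; together this separates the whole network in time. -/
lemma IsBlockPoisson.indepFun_data (h : IsBlockPoisson P lam θs A zs X) {H : ℝ} {S W : Set ℝ}
    (hS : MeasurableSet S) (hW : MeasurableSet W) (hS0 : S ⊆ Set.Ioc 0 H) (hW0 : W ⊆ Set.Ioc 0 H)
    (hSW : Disjoint S W) :
    IndepFun (fun ω => restrictData S (trimData A H (X ω)))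
      (fun ω => restrictData W (trimData A H (X ω))) P := by
  have hres : ∀ V : Set ℝ, MeasurableSet V →
      Measurable fun ν : FinMeas => (⟨ν.1.restrict V, inferInstance⟩ : FinMeas) := fun V hV =>
    ((measurable_restrict_measure hV).comp measurable_subtype_coe).subtype_mk
  let Z : Set ℝ → A → Ω → FinMeas := fun V e ω => ⟨(trimMeas H (X ω e.1)).1.restrict V, inferInstance⟩
  have hZ : ∀ V, MeasurableSet V → ∀ e, Measurable (Z V e) := fun V hV e =>
    (hres V hV).comp ((measurable_trimMeas H).comp (h.poisson e.1 e.2).measurable)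
  have hZi : IndepFun (fun ω (e : A) => Z S e ω) (fun ω (e : A) => Z W e ω) P := by
    refine indepFun_pi_of_iIndepFun_prod (hZ S hS) (hZ W hW) ?_ ?_
    · exact h.indep.comp (fun _ ν => ((⟨(trimMeas H ν).1.restrict S, inferInstance⟩ : FinMeas),
        (⟨(trimMeas H ν).1.restrict W, inferInstance⟩ : FinMeas)))
        fun _ => ((hres S hS).comp (measurable_trimMeas H)).prodMk
          ((hres W hW).comp (measurable_trimMeas H))
    · intro e
      have h1 := (h.poisson e.1 e.2).indepFun_restrict hS hW
        (hS0.trans Set.Ioc_subset_Ioi_self) (hW0.trans Set.Ioc_subset_Ioi_self) hSW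
      have hae := (h.poisson e.1 e.2).ae_lt_top measurableSet_Ioc (Metric.isBounded_Ioc 0 H)
        Set.Ioc_subset_Ioi_self
      have h2 : IndepFun (fun ω => (Z S e ω).1) (fun ω => (Z W e ω).1) P := by
        refine h1.congr ?_ ?_
        · filter_upwards [hae] with ω hω
          simp only [Z]
          rw [trimMeas_val hω, Measure.restrict_restrict_of_subset hS0]
        · filter_upwards [hae] with ω hω
          simp only [Z]
          rw [trimMeas_val hω, Measure.restrict_restrict_of_subset hW0]
      -- The σ-algebra on `FinMeas` is pulled back from that on measures, so independence of the
      -- underlying measures is enough.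
      rw [IndepFun_iff_Indep] at h2 ⊢
      convert h2 using 1
      · exact MeasurableSpace.comap_comp
      · exact MeasurableSpace.comap_comp
  -- Pairs outside `A` carry the zero measure, hence all the trimmed data are a measurable function
  -- of the streams in `A`.
  let ext : (A → FinMeas) → EdgeData m := fun y e =>
    if he : e ∈ A then y ⟨e, he⟩ else ⟨0, inferInstance⟩
  have hext : Measurable ext := by
    refine measurable_pi_lambda _ fun e => ?_
    simp only [ext]
    split_ifs with he
    · exact measurable_pi_apply _
    · exact measurable_const
  have hZe : ∀ V ω, restrictData V (trimData A H (X ω)) = ext fun e => Z V e ω := by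
    intro V ω
    funext e
    simp only [restrictData, trimData, ext, Z]
    split_ifs with he
    · rfl
    · simp
  simp only [hZe]
  exact hZi.comp hext hext

/-- The Poisson block model provides Poisson edge data. -/
lemma IsBlockPoisson.poissonData (h : IsBlockPoisson P lam θs A zs X) (hdT : 0 < dT)
    {M : ℝ} (hm : ∀ k l, Measurable (lam θs k l)) (hpos : ∀ k l t, 0 ≤ t → 0 ≤ lam θs k l t)
    (hM : ∀ k l t, 0 ≤ t → |lam θs k l t| ≤ M) (N : ℕ) :
    PoissonData A dT N (meanData (N * dT) fun e => lam θs (zs e.1) (zs e.2))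
      (P.map fun ω => trimData A (N * dT) (X ω)) := by
  have hT := h.measurable_trimData (N * dT)
  refine ⟨Measure.isProbabilityMeasure_map hT.aemeasurable, ?_, ?_⟩
  · intro n hn hN f hf b hb
    set W := window dT n
    have hW : MeasurableSet W := measurableSet_window _ _
    have hsub : W ⊆ Set.Ioc 0 (N * dT) := window_subset hdT hn hN
    have hsm : ∀ e, StronglyMeasurable fun x : EdgeData m => ∫ t in W, f e t ∂(x e).1 := fun e =>
      (stronglyMeasurable_setIntegral_data (β := Unit) (f := fun _ => f e)
        ((hf e).comp measurable_snd).stronglyMeasurable hW e).comp_measurable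
        (measurable_const.prodMk measurable_id : Measurable fun x : EdgeData m => ((), x))
    have hsm' : AEStronglyMeasurable (fun x : EdgeData m =>
        Real.exp (∑ e ∈ A, ∫ t in W, f e t ∂(x e).1)) (P.map fun ω => trimData A (N * dT) (X ω)) :=
      (Real.continuous_exp.comp_stronglyMeasurable
        (Finset.stronglyMeasurable_fun_sum _ fun e _ => hsm e)).aestronglyMeasurable
    let Y : A → Ω → ℝ := fun e ω => ∫ t in W, f e t ∂(trimMeas (N * dT) (X ω e)).1
    have hYg : ∀ e : A, Measurable fun ν => ∫ t in W, f e t ∂(trimMeas (N * dT) ν).1 := by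
      intro e
      have h1 : Measurable fun ν : Measure ℝ => (fun _ => trimMeas (N * dT) ν : EdgeData m) :=
        measurable_pi_lambda _ fun _ => measurable_trimMeas _
      exact (hsm e).measurable.comp h1
    have hYm : ∀ e, Measurable (Y e) := fun e => (hYg e).comp (h.poisson e.1 e.2).measurable
    have hYi : iIndepFun Y P := h.indep.comp (fun e ν => ∫ t in W, f e t ∂(trimMeas (N * dT) ν).1) hYg
    have hone : ∀ e : A, Integrable (fun ω => Real.exp (1 * Y e ω)) P ∧ mgf (Y e) P 1
        = Real.exp (∫ t in W, (Real.exp (f e t) - 1) ∂(meanData (N * dT) (fun e : Fin m × Fin m =>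
          lam θs (zs e.1) (zs e.2)) e.1).1) := by
      intro e
      have hae := (h.poisson e.1 e.2).ae_lt_top measurableSet_Ioc
        (Metric.isBounded_Ioc 0 (N * dT)) Set.Ioc_subset_Ioi_self
      have h1 := (h.poisson e.1 e.2).integral_exp hW ((Metric.isBounded_Ioc _ _).subset hsub)
        (hsub.trans Set.Ioc_subset_Ioi_self)
        (R := (meanData (N * dT) (fun e : Fin m × Fin m => lam θs (zs e.1) (zs e.2)) e.1).1)
        (fun B hB hBm => (meanData_real
          (ρ := fun e : Fin m × Fin m => lam θs (zs e.1) (zs e.2)) (e := e.1) (hm _ _) (hM _ _) (hpos _ _) hBm (hB.trans hsub)).symm)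
        (hf e) (hb e)
      have hYe : ∀ᵐ ω ∂P, Real.exp (∫ t in W, f e t ∂(X ω e)) = Real.exp (1 * Y e ω) := by
        filter_upwards [hae] with ω hω
        simp only [Y]
        rw [trimMeas_val hω, one_mul, restrict_window_trim hdT hn hN]
      exact ⟨h1.1.congr hYe, (integral_congr_ae hYe).symm.trans h1.2⟩
    have hsum : ∀ ω, ∑ e ∈ A, ∫ t in W, f e t ∂(trimData A (N * dT) (X ω) e).1
        = (∑ e ∈ Finset.univ, Y e) ω := by
      intro ω
      rw [Finset.sum_apply, ← Finset.sum_coe_sort A]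
      refine Finset.sum_congr rfl fun e _ => ?_
      simp only [Y, trimData, if_pos e.2]
    have hint := hYi.integrable_exp_mul_sum hYm (s := Finset.univ) (t := 1) fun e _ => (hone e).1
    constructor
    · rw [integrable_map_measure hsm' hT.aemeasurable]
      simpa only [Function.comp_def, hsum, one_mul] using hint
    · rw [integral_map hT.aemeasurable hsm']
      simp only [hsum]
      have h2 := hYi.mgf_sum hYm Finset.univ (t := 1)
      unfold mgf at h2
      simp only [one_mul] at h2
      rw [h2, ← Finset.sum_coe_sort A, Real.exp_sum]
      refine Finset.prod_congr rfl fun e _ => ?_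
      have h3 := (hone e).2
      unfold mgf at h3
      simpa only [one_mul] using h3
  · intro n hn
    have hS : Set.Ioc 0 ((n : ℝ) * dT) ⊆ Set.Ioc 0 ((N : ℝ) * dT) :=
      Set.Ioc_subset_Ioc_right (mul_le_mul_of_nonneg_right (by exact_mod_cast hn.le) hdT.le)
    have h1 := h.indepFun_data measurableSet_Ioc (measurableSet_window dT (n + 1)) hS
      (window_subset hdT (by omega) hn) (disjoint_window n)
    have m1 : Measurable (restrictData (m := m) (Set.Ioc 0 ((n : ℝ) * dT))) :=
      measurable_restrictData measurableSet_Ioc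
    have m2 : Measurable (restrictData (m := m) (window dT (n + 1))) :=
      measurable_restrictData (measurableSet_window _ _)
    rw [IndepFun_iff] at h1 ⊢
    rintro _ _ ⟨s, hs, rfl⟩ ⟨t, ht, rfl⟩
    rw [Measure.map_apply hT (m1 hs), Measure.map_apply hT (m2 ht),
      Measure.map_apply hT ((m1 hs).inter (m2 ht))]
    exact h1 _ _ ⟨s, hs, rfl⟩ ⟨t, ht, rfl⟩

end law

end

end OnlineNet

namespace OnlineNet

noncomputable section

/-! ## Moments of linear statistics of the data -/

/-- The sum over the pairs in `A` of the integrals of `f` against the streams in window `n`. -/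
def edgeSum {m : ℕ} (A : Finset (Fin m × Fin m)) (dT : ℝ) (n : ℕ) (f : Fin m × Fin m → ℝ → ℝ)
    (x : EdgeData m) : ℝ :=
  ∑ e ∈ A, ∫ t in window dT n, f e t ∂(x e).1

lemma integrable_of_abs_le {ν : Measure ℝ} [IsFiniteMeasure ν] {f : ℝ → ℝ} (hf : Measurable f)
    {b : ℝ} (hb : ∀ t, |f t| ≤ b) : Integrable f ν :=
  Integrable.of_bound hf.aestronglyMeasurable b (Eventually.of_forall hb)

lemma exp_le_one_add_add_sq {u : ℝ} (hu : |u| ≤ 1) : Real.exp u - 1 ≤ u + u ^ 2 := by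
  have := abs_le.1 (Real.abs_exp_sub_one_sub_id_le hu)
  linarith [this.2]

lemma sq_le_exp_add_exp_neg (u : ℝ) : u ^ 2 ≤ 2 * (Real.exp u + Real.exp (-u)) := by
  have h1 := Real.quadratic_le_exp_of_nonneg (abs_nonneg u)
  rw [sq_abs] at h1
  rcases abs_cases u with ⟨h, _⟩ | ⟨h, _⟩ <;> rw [h] at h1
  · linarith [Real.exp_pos (-u)]
  · linarith [Real.exp_pos u]

section moments

variable {m : ℕ} {A : Finset (Fin m × Fin m)} {dT : ℝ} {N : ℕ} {xm : EdgeData m}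
  {μ : Measure (EdgeData m)} {n : ℕ} {f : Fin m × Fin m → ℝ → ℝ} {b R : ℝ}

lemma edgeSum_const_mul (c : ℝ) (f : Fin m × Fin m → ℝ → ℝ) (x : EdgeData m) :
    edgeSum A dT n (fun e t => c * f e t) x = c * edgeSum A dT n f x := by
  simp only [edgeSum, integral_const_mul, Finset.mul_sum]

/-- Pairs off `A'` contribute nothing. For the evidence of a node, `A'` is the set of pairs touching
it, which replaces the order of `|A|` by the order of a degree. -/
lemma sum_integral_sq_le (hf : ∀ e, Measurable (f e)) (hb : ∀ e t, |f e t| ≤ b)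
    {A' : Finset (Fin m × Fin m)} (hA' : A' ⊆ A) (h0 : ∀ e ∈ A, e ∉ A' → ∀ t, f e t = 0)
    (hR : ∀ e ∈ A, (xm e).1.real (window dT n) ≤ R) :
    ∑ e ∈ A, ∫ t in window dT n, f e t ^ 2 ∂(xm e).1 ≤ b ^ 2 * R * A'.card := by
  rw [← Finset.sum_subset hA' fun e he he' => by simp [h0 e he he']]
  rw [mul_comm, ← nsmul_eq_mul]
  refine Finset.sum_le_card_nsmul _ _ _ fun e he => ?_
  calc ∫ t in window dT n, f e t ^ 2 ∂(xm e).1 ≤ ∫ _ in window dT n, b ^ 2 ∂(xm e).1 := by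
        refine integral_mono ?_ (integrable_const _) fun t => ?_
        · refine integrable_of_abs_le ((hf e).pow_const 2) (b := b ^ 2) fun t => ?_
          rw [abs_pow]
          exact pow_le_pow_left₀ (abs_nonneg _) (hb e t) 2
        · rw [← sq_abs]
          exact pow_le_pow_left₀ (abs_nonneg _) (hb e t) 2
    _ = b ^ 2 * (xm e).1.real (window dT n) := by
        rw [setIntegral_const, smul_eq_mul, mul_comm]
    _ ≤ b ^ 2 * R := mul_le_mul_of_nonneg_left (hR e (hA' he)) (sq_nonneg _)

/-- Exponential moments of centred linear statistics. -/
lemma PoissonData.integral_exp_le (h : PoissonData A dT N xm μ) (hn : 1 ≤ n) (hN : n ≤ N)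
    (hf : ∀ e, Measurable (f e)) (hb : ∀ e t, |f e t| ≤ 1) :
    Integrable (fun x => Real.exp (edgeSum A dT n f x - edgeSum A dT n f xm)) μ ∧
    ∫ x, Real.exp (edgeSum A dT n f x - edgeSum A dT n f xm) ∂μ
      ≤ Real.exp (∑ e ∈ A, ∫ t in window dT n, f e t ^ 2 ∂(xm e).1) := by
  obtain ⟨h1, h2⟩ := h.laplace n hn hN f hf 1 hb
  simp only [Real.exp_sub]
  refine ⟨h1.div_const _, ?_⟩
  rw [integral_div]
  unfold edgeSum
  -- By the Laplace functional the logarithm of the moment is the integral of `exp f - 1 - f`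
  -- against the mean data, and the integrand is at most `f ^ 2` since `|f| ≤ 1`.
  rw [h2, ← Real.exp_sub, Real.exp_le_exp, ← Finset.sum_sub_distrib]
  refine Finset.sum_le_sum fun e _ => ?_
  have i1 : Integrable (f e) ((xm e).1.restrict (window dT n)) := integrable_of_abs_le (hf e) (hb e)
  have i2 : Integrable (fun t => Real.exp (f e t) - 1) ((xm e).1.restrict (window dT n)) := by
    refine (integrable_of_abs_le (Real.measurable_exp.comp (hf e)) (b := Real.exp 1)
      fun t => ?_).sub (integrable_const _)
    rw [Function.comp, Real.abs_exp, Real.exp_le_exp]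
    exact (le_abs_self _).trans (hb e t)
  have i3 : Integrable (fun t => f e t ^ 2) ((xm e).1.restrict (window dT n)) := by
    refine integrable_of_abs_le ((hf e).pow_const 2) (b := 1) fun t => ?_
    rw [abs_pow]
    exact pow_le_one₀ (abs_nonneg _) (hb e t)
  rw [← integral_sub i2 i1]
  refine integral_mono (i2.sub i1) i3 fun t => ?_
  have := exp_le_one_add_add_sq (hb e t)
  simp only
  linarith

lemma PoissonData.integral_exp_mul_le (h : PoissonData A dT N xm μ) (hn : 1 ≤ n) (hN : n ≤ N)
    (hf : ∀ e, Measurable (f e)) (hb : ∀ e t, |f e t| ≤ b)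
    (hR : ∀ e ∈ A, (xm e).1.real (window dT n) ≤ R) {s : ℝ} (hs : |s| * b ≤ 1) :
    Integrable (fun x => Real.exp (s * (edgeSum A dT n f x - edgeSum A dT n f xm))) μ ∧
    ∫ x, Real.exp (s * (edgeSum A dT n f x - edgeSum A dT n f xm)) ∂μ
      ≤ Real.exp (s ^ 2 * (b ^ 2 * R * A.card)) := by
  have hb' : ∀ e t, |s * f e t| ≤ 1 := fun e t => by
    rw [abs_mul]
    exact (mul_le_mul_of_nonneg_left (hb e t) (abs_nonneg _)).trans hs
  have := h.integral_exp_le hn hN (f := fun e t => s * f e t) (fun e => (hf e).const_mul s) hb'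
  simp only [edgeSum_const_mul, ← mul_sub] at this
  refine ⟨this.1, this.2.trans (Real.exp_le_exp.2 ?_)⟩
  have h2 := sum_integral_sq_le (A := A) (A' := A) hf hb subset_rfl
    (fun e h1 h2 => absurd h1 h2) hR
  simp only [mul_pow, integral_const_mul, ← Finset.mul_sum]
  exact mul_le_mul_of_nonneg_left h2 (sq_nonneg _)

/-- Centred linear statistics have mean zero and variance of the order of the number of pairs. -/
lemma PoissonData.centred_moments (h : PoissonData A dT N xm μ) (hn : 1 ≤ n) (hN : n ≤ N)
    (hf : ∀ e, Measurable (f e)) (hb : ∀ e t, |f e t| ≤ b) (hb0 : 0 < b)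
    (hR : ∀ e ∈ A, (xm e).1.real (window dT n) ≤ R) (hR0 : 0 ≤ R) (hA : 0 < A.card) :
    MemLp (fun x => edgeSum A dT n f x - edgeSum A dT n f xm) 2 μ ∧
    ∫ x, (edgeSum A dT n f x - edgeSum A dT n f xm) ∂μ = 0 ∧
    ∫ x, (edgeSum A dT n f x - edgeSum A dT n f xm) ^ 2 ∂μ ≤ 4 * Real.exp R * b ^ 2 * A.card := by
  have := h.isProb
  set C : EdgeData m → ℝ := fun x => edgeSum A dT n f x - edgeSum A dT n f xm with hC
  set a : ℝ := (A.card : ℝ) with ha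
  have ha0 : 1 ≤ a := by rw [ha]; exact_mod_cast hA
  have hCm : Measurable C := by
    refine Measurable.sub_const (Finset.measurable_sum _ fun e _ => ?_) _
    exact ((stronglyMeasurable_setIntegral_data (β := Unit) (f := fun _ => f e)
        ((hf e).comp measurable_snd).stronglyMeasurable (measurableSet_window _ _) e).comp_measurable
        (measurable_const.prodMk measurable_id : Measurable fun x : EdgeData m => ((), x))).measurable
  have hmgf : ∀ s : ℝ, |s| * b ≤ 1 → Integrable (fun x => Real.exp (s * C x)) μ ∧
      ∫ x, Real.exp (s * C x) ∂μ ≤ Real.exp (s ^ 2 * (b ^ 2 * R * a)) := fun s hs =>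
    h.integral_exp_mul_le hn hN hf hb hR hs
  have hsa : 0 < √a := Real.sqrt_pos.2 (by linarith)
  have hsa1 : 1 ≤ √a := Real.one_le_sqrt.2 ha0
  -- At this scale the exponent of the moment bound equals `R`, free of the number of pairs, and the
  -- inequality `u ^ 2 ≤ 2 (exp u + exp (-u))` at `u = s * C x` yields a second moment of order `b ^
  -- 2 * a`.
  set s : ℝ := 1 / (b * √a) with hs
  have hs0 : 0 < s := by positivity
  have hsb : |s| * b ≤ 1 := by
    rw [abs_of_pos hs0, hs]
    have : 1 / (b * √a) * b = 1 / √a := by field_simp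
    rw [this, div_le_one hsa]
    exact hsa1
  have hs2 : s ^ 2 = 1 / (b ^ 2 * a) := by
    rw [hs, div_pow, mul_pow, Real.sq_sqrt (by linarith), one_pow]
  have hexp : s ^ 2 * (b ^ 2 * R * a) = R := by rw [hs2]; field_simp
  obtain ⟨p1, p2⟩ := hmgf s hsb
  obtain ⟨q1, q2⟩ := hmgf (-s) (by rwa [abs_neg])
  rw [neg_sq, hexp] at q2
  rw [hexp] at p2
  have hdom : ∀ x, C x ^ 2 ≤ b ^ 2 * a * (2 * (Real.exp (s * C x) + Real.exp (-s * C x))) := by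
    intro x
    have h1 := sq_le_exp_add_exp_neg (s * C x)
    rw [mul_pow, hs2, ← neg_mul] at h1
    have h2 : C x ^ 2 = b ^ 2 * a * (1 / (b ^ 2 * a) * C x ^ 2) := by field_simp
    rw [h2]
    exact mul_le_mul_of_nonneg_left h1 (mul_nonneg (sq_nonneg _) (by linarith))
  have hI : Integrable (fun x => b ^ 2 * a * (2 * (Real.exp (s * C x) + Real.exp (-s * C x)))) μ :=
    ((p1.add q1).const_mul 2).const_mul _
  have hsq : Integrable (fun x => C x ^ 2) μ := by
    refine hI.mono' (hCm.pow_const 2).aestronglyMeasurable (Eventually.of_forall fun x => ?_)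
    rw [Real.norm_of_nonneg (sq_nonneg _)]
    exact hdom x
  have hL : MemLp C 2 μ := (memLp_two_iff_integrable_sq hCm.aestronglyMeasurable).2 hsq
  have hCi : Integrable C μ := hL.integrable (by norm_num)
  refine ⟨hL, ?_, ?_⟩
  · set Q : ℝ := b ^ 2 * R * a with hQ
    have hQ0 : 0 ≤ Q := by positivity
    -- The linear lower bound of the exponential gives `s * mean = O(s ^ 2)` for small `s` of either
    -- sign; letting `s` tend to zero forces the mean to vanish.
    have hbd : ∀ s : ℝ, |s| * b ≤ 1 → s ^ 2 * Q ≤ 1 → s * ∫ x, C x ∂μ ≤ 2 * (s ^ 2 * Q) := by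
      intro s hs hsQ
      obtain ⟨r1, r2⟩ := hmgf s hs
      have h1 : ∫ x, (s * C x + 1) ∂μ ≤ ∫ x, Real.exp (s * C x) ∂μ :=
        integral_mono ((hCi.const_mul s).add (integrable_const _)) r1
          fun x => Real.add_one_le_exp _
      rw [integral_add (hCi.const_mul s) (integrable_const _), integral_const_mul] at h1
      simp only [integral_const, probReal_univ, smul_eq_mul, mul_one] at h1
      have hnn : 0 ≤ s ^ 2 * Q := by positivity
      have h2 := exp_le_one_add_add_sq (u := s ^ 2 * Q) (by rwa [abs_of_nonneg hnn])
      nlinarith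
    by_contra hne
    have hpos : 0 < |∫ x, C x ∂μ| := abs_pos.2 hne
    set D := |∫ x, C x ∂μ| with hD
    obtain ⟨s, hs0, hs1, hs2, hs3⟩ : ∃ s : ℝ, 0 < s ∧ s * b ≤ 1 ∧ s ^ 2 * Q ≤ 1 ∧ 2 * s * Q < D := by
      have t1 : Tendsto (fun s : ℝ => s * b) (𝓝[>] 0) (𝓝 (0 * b)) :=
        (tendsto_id.mul_const b).mono_left nhdsWithin_le_nhds
      have t2 : Tendsto (fun s : ℝ => s ^ 2 * Q) (𝓝[>] 0) (𝓝 (0 ^ 2 * Q)) :=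
        ((tendsto_id.pow 2).mul_const Q).mono_left nhdsWithin_le_nhds
      have t3 : Tendsto (fun s : ℝ => 2 * s * Q) (𝓝[>] 0) (𝓝 (2 * 0 * Q)) :=
        ((tendsto_id.const_mul 2).mul_const Q).mono_left nhdsWithin_le_nhds
      have := ((t1.eventually_le_const (u := 1) (by norm_num)).and
        ((t2.eventually_le_const (u := 1) (by norm_num)).and
        (t3.eventually_lt_const (u := D) (by simpa using hpos)))).and self_mem_nhdsWithin
      obtain ⟨s, ⟨a1, a2, a3⟩, a4⟩ := this.exists
      exact ⟨s, a4, a1, a2, a3⟩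
    have hle : s * D ≤ 2 * (s ^ 2 * Q) := by
      rcases abs_cases (∫ x, C x ∂μ) with ⟨h1, _⟩ | ⟨h1, _⟩
      · rw [hD, h1]
        exact hbd s (by rwa [abs_of_pos hs0]) hs2
      · rw [hD, h1]
        have := hbd (-s) (by rwa [abs_neg, abs_of_pos hs0]) (by rwa [neg_sq])
        rw [neg_sq] at this
        linarith
    nlinarith
  · calc ∫ x, C x ^ 2 ∂μ
        ≤ ∫ x, b ^ 2 * a * (2 * (Real.exp (s * C x) + Real.exp (-s * C x))) ∂μ :=
          integral_mono hsq hI hdom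
      _ = b ^ 2 * a * (2 * (∫ x, Real.exp (s * C x) ∂μ + ∫ x, Real.exp (-s * C x) ∂μ)) := by
          rw [integral_const_mul, integral_const_mul, integral_add p1 q1]
      _ ≤ b ^ 2 * a * (2 * (Real.exp R + Real.exp R)) := by gcongr
      _ = _ := by ring

end moments

end

end OnlineNet

namespace OnlineNet

noncomputable section

/-! ## Regularity of the intensities -/

section ext

variable {p : ℕ} {F : Type*} [Zero F]

/-- The extension by zero of a function of parameter and time off `Θ × [0, ∞)`. -/
def extZero (Θ : Set (EuclideanSpace ℝ (Fin p))) (h : EuclideanSpace ℝ (Fin p) → ℝ → F)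
    (θ : EuclideanSpace ℝ (Fin p)) (t : ℝ) : F :=
  open Classical in if θ ∈ Θ ∧ 0 ≤ t then h θ t else 0

lemma extZero_of_mem {Θ : Set (EuclideanSpace ℝ (Fin p))} (h : EuclideanSpace ℝ (Fin p) → ℝ → F)
    {θ : EuclideanSpace ℝ (Fin p)} {t : ℝ} (hθ : θ ∈ Θ) (ht : 0 ≤ t) :
    extZero Θ h θ t = h θ t := if_pos ⟨hθ, ht⟩

lemma norm_extZero_le {F : Type*} [NormedAddCommGroup F] {Θ : Set (EuclideanSpace ℝ (Fin p))}
    {h : EuclideanSpace ℝ (Fin p) → ℝ → F} {M : ℝ} (hM0 : 0 ≤ M)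
    (hM : ∀ θ ∈ Θ, ∀ t, 0 ≤ t → ‖h θ t‖ ≤ M) (θ : EuclideanSpace ℝ (Fin p)) (t : ℝ) :
    ‖extZero Θ h θ t‖ ≤ M := by
  unfold extZero
  split_ifs with H
  · exact hM θ H.1 t H.2
  · simpa using hM0

/-- On `Θ` this is a function continuous in the parameter and measurable in time, hence jointly
measurable; a measurable embedding of `Θ × ℝ` extends it to the whole space. -/
lemma stronglyMeasurable_extZero {F : Type*} [NormedAddCommGroup F]
    {Θ : Set (EuclideanSpace ℝ (Fin p))} (hΘ : MeasurableSet Θ)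
    {h : EuclideanSpace ℝ (Fin p) → ℝ → F} (hc : ∀ t, 0 ≤ t → ContinuousOn (fun θ => h θ t) Θ)
    (hm : ∀ θ ∈ Θ, StronglyMeasurable (extZero Θ h θ)) :
    StronglyMeasurable (Function.uncurry (extZero Θ h)) := by
  have h1 : StronglyMeasurable (Function.uncurry fun (θ : Θ) t => extZero Θ h θ.1 t) := by
    refine stronglyMeasurable_uncurry_of_continuous_of_stronglyMeasurable (fun t => ?_)
      fun θ => hm θ.1 θ.2
    by_cases ht : 0 ≤ t
    · have : (fun θ : Θ => extZero Θ h θ.1 t) = Θ.domRestrict fun θ => h θ t := by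
        funext θ
        exact extZero_of_mem h θ.2 ht
      rw [this]
      exact (hc t ht).domRestrict
    · have : (fun θ : Θ => extZero Θ h θ.1 t) = fun _ => 0 := by
        funext θ
        exact if_neg fun H => ht H.2
      rw [this]
      exact continuous_const
  have hemb : MeasurableEmbedding (fun y : Θ × ℝ => ((y.1 : EuclideanSpace ℝ (Fin p)), y.2)) :=
    (MeasurableEmbedding.subtype_coe hΘ).prodMap MeasurableEmbedding.id
  obtain ⟨g, hg, hgeq⟩ := hemb.exists_stronglyMeasurable_extend h1 fun _ => ⟨0⟩
  have : Function.uncurry (extZero Θ h) = (Θ ×ˢ Set.univ).indicator g := by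
    funext ⟨θ, t⟩
    by_cases hθ : θ ∈ Θ
    · rw [Set.indicator_of_mem (by exact ⟨hθ, trivial⟩)]
      exact (congrFun hgeq (⟨θ, hθ⟩, t)).symm
    · rw [Set.indicator_of_notMem (fun H => hθ H.1)]
      exact if_neg fun H => hθ H.1
  rw [this]
  exact hg.indicator (hΘ.prod MeasurableSet.univ)

lemma norm_gradient_eq (g : EuclideanSpace ℝ (Fin p) → ℝ) (θ : EuclideanSpace ℝ (Fin p)) :
    ‖gradient g θ‖ = ‖fderiv ℝ g θ‖ := by
  simp [gradient]

lemma contDiffOn_hasGradientAt {Θ : Set (EuclideanSpace ℝ (Fin p))} (hΘ : IsOpen Θ)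
    {g : EuclideanSpace ℝ (Fin p) → ℝ} (hg : ContDiffOn ℝ 1 g Θ) {θ : EuclideanSpace ℝ (Fin p)}
    (hθ : θ ∈ Θ) : HasGradientAt g (gradient g θ) θ :=
  ((hg.differentiableOn (by norm_num)).differentiableAt (hΘ.mem_nhds hθ)).hasGradientAt

lemma continuousOn_gradient {Θ : Set (EuclideanSpace ℝ (Fin p))} (hΘ : IsOpen Θ)
    {g : EuclideanSpace ℝ (Fin p) → ℝ} (hg : ContDiffOn ℝ 1 g Θ) :
    ContinuousOn (gradient g) Θ :=
  (InnerProductSpace.toDual ℝ _).symm.continuous.comp_continuousOn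
    (hg.continuousOn_fderiv_of_isOpen hΘ le_rfl)

lemma stronglyMeasurable_extZero_gradient {Θ : Set (EuclideanSpace ℝ (Fin p))} (hΘ : IsOpen Θ)
    {h : EuclideanSpace ℝ (Fin p) → ℝ → ℝ} (hc : ∀ t, 0 ≤ t → ContDiffOn ℝ 1 (fun θ => h θ t) Θ)
    (hm : ∀ θ ∈ Θ, Measurable (extZero Θ h θ)) :
    StronglyMeasurable (Function.uncurry (extZero Θ fun θ t => gradient (fun θ => h θ t) θ)) := by
  refine stronglyMeasurable_extZero hΘ.measurableSet
    (fun t ht => continuousOn_gradient hΘ (hc t ht)) fun θ hθ => Measurable.stronglyMeasurable ?_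
  have hm' : ∀ θ, Measurable (extZero Θ h θ) := by
    intro θ
    by_cases hθ : θ ∈ Θ
    · exact hm θ hθ
    · have : extZero Θ h θ = fun _ => 0 := by
        funext t
        exact if_neg fun H => hθ H.1
      rw [this]
      exact measurable_const
  rw [← (MeasurableEquiv.toLp 2 (Fin p → ℝ)).symm.measurableEmbedding.measurable_comp_iff]
  refine measurable_pi_lambda _ fun i => ?_
  let b : EuclideanSpace ℝ (Fin p) := EuclideanSpace.single i 1
  -- A coordinate of the gradient is the limit of difference quotients along a basis vector, each of
  -- them measurable in time. The shifted point may lie outside `Θ` for small `n`, which is why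
  -- `hm'` covers all parameters; since `Θ` is open it lies inside eventually.
  refine measurable_of_tendsto_metrizable
    (f := fun (n : ℕ) t => ((n : ℝ) + 1) * (extZero Θ h (θ + (1 / ((n : ℝ) + 1)) • b) t
      - extZero Θ h θ t)) (fun n => ?_) ?_
  · exact ((hm' _).sub (hm' _)).const_mul _
  · rw [tendsto_pi_nhds]
    intro t
    by_cases ht : 0 ≤ t
    · have hg := contDiffOn_hasGradientAt hΘ (hc t ht) hθ
      have hd := hg.hasFDerivAt.hasLineDerivAt b
      have h1 : Tendsto (fun n : ℕ => 1 / ((n : ℝ) + 1)) atTop (𝓝[≠] 0) := by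
        rw [tendsto_nhdsWithin_iff]
        exact ⟨tendsto_one_div_add_atTop_nhds_zero_nat, Eventually.of_forall fun n => by
          simp only [Set.mem_compl_iff, Set.mem_singleton_iff]
          positivity⟩
      have h2 := hd.tendsto_slope_zero.comp h1
      have hval : (InnerProductSpace.toDual ℝ (EuclideanSpace ℝ (Fin p)))
          (gradient (fun θ => h θ t) θ) b = (gradient (fun θ => h θ t) θ) i := by
        rw [InnerProductSpace.toDual_apply_apply, EuclideanSpace.inner_single_right]
        simp
      rw [hval] at h2
      have h3 : ((⇑(MeasurableEquiv.toLp 2 (Fin p → ℝ)).symm ∘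
          extZero Θ (fun θ t => gradient (fun θ => h θ t) θ) θ) t) i
          = (gradient (fun θ => h θ t) θ) i := by
        rw [Function.comp, extZero_of_mem _ hθ ht]
        rfl
      rw [h3]
      refine h2.congr' ?_
      have hnear : ∀ᶠ n : ℕ in atTop, θ + (1 / ((n : ℝ) + 1)) • b ∈ Θ := by
        have : Tendsto (fun n : ℕ => θ + (1 / ((n : ℝ) + 1)) • b) atTop (𝓝 (θ + (0 : ℝ) • b)) :=
          (tendsto_one_div_add_atTop_nhds_zero_nat.smul_const b).const_add θ
        rw [zero_smul, add_zero] at this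
        exact this.eventually (hΘ.mem_nhds hθ)
      filter_upwards [hnear] with n hn
      rw [extZero_of_mem h hn ht, extZero_of_mem h hθ ht]
      simp
    · have h3 : ((⇑(MeasurableEquiv.toLp 2 (Fin p → ℝ)).symm ∘
          extZero Θ (fun θ t => gradient (fun θ => h θ t) θ) θ) t) i = 0 := by
        have : extZero Θ (fun θ t => gradient (fun θ => h θ t) θ) θ t = 0 :=
          if_neg fun H => ht H.2
        rw [Function.comp, this]
        rfl
      rw [h3]
      have : ∀ θ, extZero Θ h θ t = 0 := fun θ => if_neg fun H => ht H.2
      simp [this]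

end ext

/-! ### Integrals of the intensities as functions of the parameter. -/

section integrals

variable {p : ℕ} {Θ : Set (EuclideanSpace ℝ (Fin p))} {h : EuclideanSpace ℝ (Fin p) → ℝ → ℝ}
  {M : ℝ} {W : Set ℝ} {ν : Measure ℝ}

lemma setIntegral_extZero {F : Type*} [NormedAddCommGroup F] [NormedSpace ℝ F]
    (g : EuclideanSpace ℝ (Fin p) → ℝ → F) {θ : EuclideanSpace ℝ (Fin p)} (hθ : θ ∈ Θ)
    (hW : MeasurableSet W) (hW0 : W ⊆ Set.Ici 0) :
    ∫ t in W, extZero Θ g θ t ∂ν = ∫ t in W, g θ t ∂ν :=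
  setIntegral_congr_fun hW fun _ ht => extZero_of_mem g hθ (hW0 ht)

/-- Differentiation under the integral sign. -/
lemma hasGradientAt_setIntegral (hΘ : IsOpen Θ)
    (hc : ∀ t, 0 ≤ t → ContDiffOn ℝ 1 (fun θ => h θ t) Θ)
    (hm : ∀ θ ∈ Θ, Measurable (extZero Θ h θ)) (hb : ∀ θ ∈ Θ, ∀ t, 0 ≤ t → |h θ t| ≤ M)
    (hg : ∀ θ ∈ Θ, ∀ t, 0 ≤ t → ‖gradient (fun θ => h θ t) θ‖ ≤ M)
    [IsFiniteMeasure ν] (hW : MeasurableSet W) (hW0 : W ⊆ Set.Ici 0)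
    {θ : EuclideanSpace ℝ (Fin p)} (hθ : θ ∈ Θ) :
    HasGradientAt (fun θ => ∫ t in W, h θ t ∂ν)
      (∫ t in W, extZero Θ (fun θ t => gradient (fun θ => h θ t) θ) θ t ∂ν) θ := by
  have hgm := stronglyMeasurable_extZero_gradient hΘ hc hm
  have hmem : ∀ᵐ t ∂(ν.restrict W), t ∈ W := ae_restrict_mem hW
  have hmeas : ∀ θ ∈ Θ, AEStronglyMeasurable (h θ) (ν.restrict W) := by
    intro θ hθ
    refine ((hm θ hθ).aestronglyMeasurable (μ := ν.restrict W)).congr ?_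
    filter_upwards [hmem] with t ht
    exact extZero_of_mem h hθ (hW0 ht)
  have key := hasFDerivAt_integral_of_dominated_of_fderiv_le (𝕜 := ℝ) (μ := ν.restrict W)
    (F := h) (F' := fun θ t => InnerProductSpace.toDual ℝ _
      (extZero Θ (fun θ t => gradient (fun θ => h θ t) θ) θ t)) (x₀ := θ) (s := Θ)
    (bound := fun _ => M) (hΘ.mem_nhds hθ)
    (by filter_upwards [hΘ.mem_nhds hθ] with θ' hθ' using hmeas θ' hθ')
    (Integrable.of_bound (hmeas θ hθ) M (by
      filter_upwards [hmem] with t ht using hb θ hθ t (hW0 ht)))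
    ((InnerProductSpace.toDual ℝ _).continuous.comp_aestronglyMeasurable
      (hgm.comp_measurable measurable_prodMk_left).aestronglyMeasurable)
    (by
      filter_upwards [hmem] with t ht θ' hθ'
      rw [LinearIsometryEquiv.norm_map, extZero_of_mem _ hθ' (hW0 ht)]
      exact hg θ' hθ' t (hW0 ht))
    (integrable_const _)
    (by
      filter_upwards [hmem] with t ht θ' hθ'
      rw [extZero_of_mem _ hθ' (hW0 ht)]
      exact (contDiffOn_hasGradientAt hΘ (hc t (hW0 ht)) hθ').hasFDerivAt)
  rw [hasGradientAt_iff_hasFDerivAt]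
  refine key.congr_fderiv ?_
  exact ((InnerProductSpace.toDual ℝ _).toContinuousLinearEquiv.toContinuousLinearMap.integral_comp_comm
    (Integrable.of_bound (hgm.comp_measurable measurable_prodMk_left).aestronglyMeasurable M (by
      filter_upwards [hmem] with t ht
      change ‖extZero Θ (fun θ t => gradient (fun θ => h θ t) θ) θ t‖ ≤ M
      rw [extZero_of_mem _ hθ (hW0 ht)]
      exact hg θ hθ t (hW0 ht))))

lemma abs_sub_le_of_gradient_le (hΘ : IsOpen Θ) {g : EuclideanSpace ℝ (Fin p) → ℝ}
    (hc : ContDiffOn ℝ 1 g Θ) (hg : ∀ θ ∈ Θ, ‖gradient g θ‖ ≤ M)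
    {B : Set (EuclideanSpace ℝ (Fin p))} (hB : Convex ℝ B) (hBΘ : B ⊆ Θ)
    {θ θ' : EuclideanSpace ℝ (Fin p)} (hθ : θ ∈ B) (hθ' : θ' ∈ B) :
    |g θ - g θ'| ≤ M * ‖θ - θ'‖ := by
  rw [← Real.norm_eq_abs]
  refine hB.norm_image_sub_le_of_norm_fderiv_le (𝕜 := ℝ) (f := g) (fun x hx => ?_) (fun x hx => ?_) hθ' hθ
  · exact (hc.differentiableOn (by norm_num)).differentiableAt (hΘ.mem_nhds (hBΘ hx))
  · rw [← norm_gradient_eq]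
    exact hg x (hBΘ hx)

end integrals

end

end OnlineNet

namespace OnlineNet

noncomputable section

/-! ## The algorithm with extended intensities -/

/-- The inputs of the online algorithm, apart from the data. -/
structure Algorithm (p K m : ℕ) where
  /-- the intensities -/
  lam : Intensity p K
  /-- the parameter space -/
  Θ : Set (EuclideanSpace ℝ (Fin p))
  /-- the window length -/
  dT : ℝ
  /-- the pairs -/
  A : Finset (Fin m × Fin m)
  /-- the step size -/
  η : ℝ
  /-- the initial parameter -/
  θ0 : EuclideanSpace ℝ (Fin p)
  /-- the initial mean-field distribution -/
  q0 : Fin m → Fin K → ℝ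
  /-- the initial class weights -/
  w0 : Fin K → ℝ

namespace Algorithm

variable {p K m : ℕ} (𝔞 : Algorithm p K m)

/-- The logarithms of the intensities, extended by zero. -/
def logE (k l : Fin K) : EuclideanSpace ℝ (Fin p) → ℝ → ℝ :=
  extZero 𝔞.Θ fun θ t => Real.log (𝔞.lam θ k l t)

/-- The intensities, extended by zero. -/
def valE (k l : Fin K) : EuclideanSpace ℝ (Fin p) → ℝ → ℝ :=
  extZero 𝔞.Θ fun θ t => 𝔞.lam θ k l t

/-- The gradients of the logarithms of the intensities, extended by zero. -/
def glogE (k l : Fin K) : EuclideanSpace ℝ (Fin p) → ℝ → EuclideanSpace ℝ (Fin p) :=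
  extZero 𝔞.Θ fun θ t => gradient (fun θ => Real.log (𝔞.lam θ k l t)) θ

/-- The gradients of the intensities, extended by zero. -/
def gvalE (k l : Fin K) : EuclideanSpace ℝ (Fin p) → ℝ → EuclideanSpace ℝ (Fin p) :=
  extZero 𝔞.Θ fun θ t => gradient (fun θ => 𝔞.lam θ k l t) θ

/-- The log-likelihood of window `n`. -/
def LL (x : EdgeData m) (n : ℕ) (θ : EuclideanSpace ℝ (Fin p)) (z : Fin m → Fin K) : ℝ :=
  ∑ e ∈ 𝔞.A, ((∫ t in window 𝔞.dT n, 𝔞.logE (z e.1) (z e.2) θ t ∂(x e).1)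
    - ∫ t in window 𝔞.dT n, 𝔞.valE (z e.1) (z e.2) θ t)

/-- The contribution of a pair to the gradient of the log-likelihood. -/
def edgeGrad (x : EdgeData m) (n : ℕ) (θ : EuclideanSpace ℝ (Fin p)) (z : Fin m → Fin K)
    (e : Fin m × Fin m) : EuclideanSpace ℝ (Fin p) :=
  (∫ t in window 𝔞.dT n, 𝔞.glogE (z e.1) (z e.2) θ t ∂(x e).1)
    - ∫ t in window 𝔞.dT n, 𝔞.gvalE (z e.1) (z e.2) θ t

/-- The gradient of the averaged log-likelihood. -/
def grad (x : EdgeData m) (n : ℕ) (θ : EuclideanSpace ℝ (Fin p)) (q : Fin m → Fin K → ℝ) :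
    EuclideanSpace ℝ (Fin p) :=
  ∑ z, prodProb q z • ∑ e ∈ 𝔞.A, 𝔞.edgeGrad x n θ z e

/-- The cumulative evidence after window `n`. -/
def nextS (x : EdgeData m) (n : ℕ) (s : State p K m) : Fin m → Fin K → ℝ :=
  fun i k => s.S i k * Real.exp (expectAt s.q i k (𝔞.LL x n s.θ))

/-- The mean-field distribution after window `n`. -/
def nextQ (x : EdgeData m) (n : ℕ) (s : State p K m) : Fin m → Fin K → ℝ :=
  fun i k => s.w k * 𝔞.nextS x n s i k / ∑ k', s.w k' * 𝔞.nextS x n s i k'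

/-- The processing of window `n`. -/
def next (x : EdgeData m) (n : ℕ) (s : State p K m) : State p K m where
  S := 𝔞.nextS x n s
  q := 𝔞.nextQ x n s
  θ := s.θ + (𝔞.η * (1 / (𝔞.A.card : ℝ))) • 𝔞.grad x n s.θ (𝔞.nextQ x n s)
  w := fun k => (1 / (m : ℝ)) * ∑ i, 𝔞.nextQ x n s i k

/-- The state after `n` windows. -/
def run (x : EdgeData m) : ℕ → State p K m
  | 0 => { θ := 𝔞.θ0, q := 𝔞.q0, S := fun _ _ => 1 / (K : ℝ), w := 𝔞.w0 }
  | n + 1 => 𝔞.next x (n + 1) (run x n)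

/-- The total number of events in window `n` plus the total observation time. -/
def mass (x : EdgeData m) (n : ℕ) : ℝ :=
  ∑ e ∈ 𝔞.A, ((x e).1.real (window 𝔞.dT n) + 𝔞.dT)

/-! ### Dependence on the data -/

lemma restrict_now {x : EdgeData m} (n : ℕ) (e : Fin m × Fin m) :
    (restrictData (window 𝔞.dT n) x e).1.restrict (window 𝔞.dT n)
      = (x e).1.restrict (window 𝔞.dT n) :=
  Measure.restrict_restrict_of_subset subset_rfl

lemma LL_congr {x y : EdgeData m} {n : ℕ}
    (h : ∀ e, (x e).1.restrict (window 𝔞.dT n) = (y e).1.restrict (window 𝔞.dT n)) :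
    𝔞.LL x n = 𝔞.LL y n := by
  funext θ z
  simp only [LL, h]

lemma grad_congr {x y : EdgeData m} {n : ℕ}
    (h : ∀ e, (x e).1.restrict (window 𝔞.dT n) = (y e).1.restrict (window 𝔞.dT n)) :
    𝔞.grad x n = 𝔞.grad y n := by
  funext θ q
  simp only [grad, edgeGrad, h]

lemma next_congr {x y : EdgeData m} {n : ℕ}
    (h : ∀ e, (x e).1.restrict (window 𝔞.dT n) = (y e).1.restrict (window 𝔞.dT n))
    (s : State p K m) : 𝔞.next x n s = 𝔞.next y n s := by
  have hS : 𝔞.nextS x n s = 𝔞.nextS y n s := by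
    funext i k
    simp only [nextS, 𝔞.LL_congr h]
  have hQ : 𝔞.nextQ x n s = 𝔞.nextQ y n s := by
    funext i k
    simp only [nextQ, hS]
  rw [next, next, hS, hQ, 𝔞.grad_congr h]

lemma run_congr {x y : EdgeData m} {N : ℕ} (h : ∀ n, 1 ≤ n → n ≤ N → ∀ e,
      (x e).1.restrict (window 𝔞.dT n) = (y e).1.restrict (window 𝔞.dT n)) :
    ∀ n ≤ N, 𝔞.run x n = 𝔞.run y n := by
  intro n
  induction n with
  | zero => intro _; rfl
  | succ n ih =>
    intro hn
    rw [run, run, ih (by omega)]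
    exact 𝔞.next_congr (h (n + 1) (by omega) hn) _

lemma restrict_past (hdT : 0 < 𝔞.dT) {x : EdgeData m} {n N : ℕ} (hn : 1 ≤ n) (hN : n ≤ N)
    (e : Fin m × Fin m) :
    (restrictData (Set.Ioc 0 (N * 𝔞.dT)) x e).1.restrict (window 𝔞.dT n)
      = (x e).1.restrict (window 𝔞.dT n) :=
  Measure.restrict_restrict_of_subset (window_subset hdT hn hN)

lemma run_past (hdT : 0 < 𝔞.dT) (x : EdgeData m) {n N : ℕ} (hn : n ≤ N) :
    𝔞.run (restrictData (Set.Ioc 0 (N * 𝔞.dT)) x) n = 𝔞.run x n :=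
  𝔞.run_congr (fun _ h1 hN e => 𝔞.restrict_past hdT h1 hN e) n hn

/-! ### Measurability -/

section measurability

variable {β : Type*} [MeasurableSpace β]

lemma measurable_expect {q : β → Fin m → Fin K → ℝ} (hq : Measurable q)
    {f : β → (Fin m → Fin K) → ℝ} (hf : ∀ z, Measurable fun b => f b z) :
    Measurable fun b => expect (q b) (f b) := by
  refine Finset.measurable_sum _ fun z _ => Measurable.mul ?_ (hf z)
  refine Finset.measurable_prod _ fun i _ => ?_
  exact (measurable_pi_apply (z i)).comp ((measurable_pi_apply i).comp hq)

lemma measurable_expectAt {q : β → Fin m → Fin K → ℝ} (hq : Measurable q) (i : Fin m) (k : Fin K)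
    {f : β → (Fin m → Fin K) → ℝ} (hf : ∀ z, Measurable fun b => f b z) :
    Measurable fun b => expectAt (q b) i k (f b) := by
  refine measurable_expect (measurable_pi_lambda _ fun j => ?_) hf
  by_cases hj : j = i
  · subst hj
    simp only [Function.update_self]
    exact measurable_const
  · simp only [Function.update_of_ne hj]
    exact (measurable_pi_apply j).comp hq

/-- The regularity of the intensities that the algorithm relies on. -/
structure Regular (𝔞 : Algorithm p K m) (M : ℝ) : Prop where
  bdd : BoundedIntensity 𝔞.lam 𝔞.Θ M
  isOpen : IsOpen 𝔞.Θ
  dT_pos : 0 < 𝔞.dT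
  M_nonneg : 0 ≤ M

variable {𝔞} {M : ℝ}

namespace Regular

lemma contDiffOn_log (h : 𝔞.Regular M) (k l : Fin K) (t : ℝ) (ht : 0 ≤ t) :
    ContDiffOn ℝ 1 (fun θ => Real.log (𝔞.lam θ k l t)) 𝔞.Θ :=
  (h.bdd.contDiff k l t ht).log fun θ hθ => (h.bdd.pos θ hθ k l t ht).ne'

lemma measurable_extZero_val (h : 𝔞.Regular M) (k l : Fin K) :
    ∀ θ ∈ 𝔞.Θ, Measurable (𝔞.valE k l θ) := by
  intro θ hθ
  have : 𝔞.valE k l θ = (Set.Ici 0).indicator (𝔞.lam θ k l) := by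
    funext t
    by_cases ht : 0 ≤ t
    · rw [Set.indicator_of_mem (by exact ht)]
      exact extZero_of_mem _ hθ ht
    · rw [Set.indicator_of_notMem (by exact ht)]
      exact if_neg fun H => ht H.2
  rw [this]
  exact (h.bdd.measurable θ hθ k l).indicator measurableSet_Ici

lemma measurable_extZero_log (h : 𝔞.Regular M) (k l : Fin K) :
    ∀ θ ∈ 𝔞.Θ, Measurable (𝔞.logE k l θ) := by
  intro θ hθ
  have : 𝔞.logE k l θ = (Set.Ici 0).indicator fun t => Real.log (𝔞.lam θ k l t) := by
    funext t
    by_cases ht : 0 ≤ t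
    · rw [Set.indicator_of_mem (by exact ht)]
      exact extZero_of_mem _ hθ ht
    · rw [Set.indicator_of_notMem (by exact ht)]
      exact if_neg fun H => ht H.2
  rw [this]
  exact (Real.measurable_log.comp (h.bdd.measurable θ hθ k l)).indicator measurableSet_Ici

lemma stronglyMeasurable_logE (h : 𝔞.Regular M) (k l : Fin K) :
    StronglyMeasurable (Function.uncurry (𝔞.logE k l)) :=
  stronglyMeasurable_extZero h.isOpen.measurableSet
    (fun t ht => (h.contDiffOn_log k l t ht).continuousOn)
    fun θ hθ => (h.measurable_extZero_log k l θ hθ).stronglyMeasurable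

lemma stronglyMeasurable_valE (h : 𝔞.Regular M) (k l : Fin K) :
    StronglyMeasurable (Function.uncurry (𝔞.valE k l)) :=
  stronglyMeasurable_extZero h.isOpen.measurableSet
    (fun t ht => (h.bdd.contDiff k l t ht).continuousOn)
    fun θ hθ => (h.measurable_extZero_val k l θ hθ).stronglyMeasurable

lemma stronglyMeasurable_glogE (h : 𝔞.Regular M) (k l : Fin K) :
    StronglyMeasurable (Function.uncurry (𝔞.glogE k l)) :=
  stronglyMeasurable_extZero_gradient h.isOpen (h.contDiffOn_log k l)
    (h.measurable_extZero_log k l)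

lemma stronglyMeasurable_gvalE (h : 𝔞.Regular M) (k l : Fin K) :
    StronglyMeasurable (Function.uncurry (𝔞.gvalE k l)) :=
  stronglyMeasurable_extZero_gradient h.isOpen (h.bdd.contDiff k l)
    (h.measurable_extZero_val k l)

lemma norm_logE_le (h : 𝔞.Regular M) (k l : Fin K) (θ : EuclideanSpace ℝ (Fin p)) (t : ℝ) :
    ‖𝔞.logE k l θ t‖ ≤ M :=
  norm_extZero_le h.M_nonneg (fun θ hθ t ht => h.bdd.bound_log θ hθ k l t ht) θ t

lemma norm_valE_le (h : 𝔞.Regular M) (k l : Fin K) (θ : EuclideanSpace ℝ (Fin p)) (t : ℝ) :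
    ‖𝔞.valE k l θ t‖ ≤ M :=
  norm_extZero_le h.M_nonneg (fun θ hθ t ht => h.bdd.bound θ hθ k l t ht) θ t

lemma norm_glogE_le (h : 𝔞.Regular M) (k l : Fin K) (θ : EuclideanSpace ℝ (Fin p)) (t : ℝ) :
    ‖𝔞.glogE k l θ t‖ ≤ M :=
  norm_extZero_le h.M_nonneg (fun θ hθ t ht => h.bdd.bound_grad_log θ hθ k l t ht) θ t

lemma norm_gvalE_le (h : 𝔞.Regular M) (k l : Fin K) (θ : EuclideanSpace ℝ (Fin p)) (t : ℝ) :
    ‖𝔞.gvalE k l θ t‖ ≤ M :=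
  norm_extZero_le h.M_nonneg (fun θ hθ t ht => h.bdd.bound_grad θ hθ k l t ht) θ t

lemma measurable_LL (h : 𝔞.Regular M) {x : β → EdgeData m} (hx : Measurable x)
    {θ : β → EuclideanSpace ℝ (Fin p)} (hθ : Measurable θ) (n : ℕ) (z : Fin m → Fin K) :
    Measurable fun b => 𝔞.LL (x b) n (θ b) z := by
  refine Finset.measurable_sum _ fun e _ => Measurable.sub ?_ ?_
  · exact ((stronglyMeasurable_setIntegral_data (h.stronglyMeasurable_logE (z e.1) (z e.2))
      (measurableSet_window _ _) e).comp_measurable (hθ.prodMk hx)).measurable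
  · exact ((h.stronglyMeasurable_valE (z e.1) (z e.2)).integral_prod_right.comp_measurable
      hθ).measurable

lemma measurable_grad (h : 𝔞.Regular M) {x : β → EdgeData m} (hx : Measurable x)
    {θ : β → EuclideanSpace ℝ (Fin p)} (hθ : Measurable θ) {q : β → Fin m → Fin K → ℝ}
    (hq : Measurable q) (n : ℕ) : Measurable fun b => 𝔞.grad (x b) n (θ b) (q b) := by
  have hprod : ∀ z : Fin m → Fin K, Measurable fun b => prodProb (q b) z := fun z =>
    Finset.measurable_prod _ fun i _ =>
      (measurable_pi_apply (z i)).comp ((measurable_pi_apply i).comp hq)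
  refine Finset.measurable_sum _ fun z _ => Measurable.fun_smul (hprod z) ?_
  refine Finset.measurable_sum _ fun e _ => Measurable.sub ?_ ?_
  · exact ((stronglyMeasurable_setIntegral_data (h.stronglyMeasurable_glogE (z e.1) (z e.2))
      (measurableSet_window _ _) e).comp_measurable (hθ.prodMk hx)).measurable
  · exact ((h.stronglyMeasurable_gvalE (z e.1) (z e.2)).integral_prod_right.comp_measurable
      hθ).measurable

/-- The four components feed each other and must be treated in one induction. The extension by zero
is what makes this hold for all data, also after the parameter has left `Θ`. -/
lemma measurable_run (h : 𝔞.Regular M) (n : ℕ) :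
    (Measurable fun x => (𝔞.run x n).θ) ∧ (Measurable fun x => (𝔞.run x n).q) ∧
    (Measurable fun x => (𝔞.run x n).S) ∧ (Measurable fun x => (𝔞.run x n).w) := by
  induction n with
  | zero => exact ⟨measurable_const, measurable_const, measurable_const, measurable_const⟩
  | succ n ih =>
    obtain ⟨hθ, hq, hS, hw⟩ := ih
    have hS' : ∀ i k, Measurable fun x => 𝔞.nextS x (n + 1) (𝔞.run x n) i k := by
      intro i k
      refine Measurable.mul ((measurable_pi_apply k).comp ((measurable_pi_apply i).comp hS)) ?_
      exact Real.measurable_exp.comp (measurable_expectAt hq i k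
        fun z => h.measurable_LL measurable_id hθ (n + 1) z)
    have hwS : ∀ i k, Measurable fun x => (𝔞.run x n).w k * 𝔞.nextS x (n + 1) (𝔞.run x n) i k :=
      fun i k => ((measurable_pi_apply k).comp hw).mul (hS' i k)
    have hq' : ∀ i k, Measurable fun x => 𝔞.nextQ x (n + 1) (𝔞.run x n) i k := fun i k =>
      (hwS i k).div (Finset.measurable_sum _ fun k' _ => hwS i k')
    have hq'' : Measurable fun x => 𝔞.nextQ x (n + 1) (𝔞.run x n) :=
      measurable_pi_lambda _ fun i => measurable_pi_lambda _ fun k => hq' i k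
    have hg := (h.measurable_grad measurable_id hθ hq'' (n + 1)).fun_const_smul
      (𝔞.η * (1 / (𝔞.A.card : ℝ)))
    refine ⟨hθ.fun_add hg, hq'', ?_, ?_⟩
    · exact measurable_pi_lambda _ fun i => measurable_pi_lambda _ fun k => hS' i k
    · exact measurable_pi_lambda _ fun k =>
        (Finset.measurable_sum _ fun i _ => hq' i k).const_mul _

end Regular

end measurability

end Algorithm

end

end OnlineNet

namespace OnlineNet

noncomputable section

namespace Algorithm

variable {p K m : ℕ} {𝔞 : Algorithm p K m}

/-! ### Deterministic bounds -/

/-- The contribution of a pair to the log-likelihood. -/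
def edgeLL (𝔞 : Algorithm p K m) (x : EdgeData m) (n : ℕ) (θ : EuclideanSpace ℝ (Fin p))
    (z : Fin m → Fin K) (e : Fin m × Fin m) : ℝ :=
  (∫ t in window 𝔞.dT n, 𝔞.logE (z e.1) (z e.2) θ t ∂(x e).1)
    - ∫ t in window 𝔞.dT n, 𝔞.valE (z e.1) (z e.2) θ t

lemma LL_eq_sum (x : EdgeData m) (n : ℕ) (θ : EuclideanSpace ℝ (Fin p)) (z : Fin m → Fin K) :
    𝔞.LL x n θ z = ∑ e ∈ 𝔞.A, 𝔞.edgeLL x n θ z e := rfl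

/-- The number of events of a pair in window `n`, plus the observation time. -/
def edgeMass (𝔞 : Algorithm p K m) (x : EdgeData m) (n : ℕ) (e : Fin m × Fin m) : ℝ :=
  (x e).1.real (window 𝔞.dT n) + 𝔞.dT

lemma edgeLL_congr (x : EdgeData m) (n : ℕ) (θ : EuclideanSpace ℝ (Fin p)) {z z' : Fin m → Fin K}
    {e : Fin m × Fin m} (h1 : z e.1 = z' e.1) (h2 : z e.2 = z' e.2) :
    𝔞.edgeLL x n θ z e = 𝔞.edgeLL x n θ z' e := by
  simp only [edgeLL, h1, h2]

lemma edgeGrad_congr (x : EdgeData m) (n : ℕ) (θ : EuclideanSpace ℝ (Fin p))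
    {z z' : Fin m → Fin K} {e : Fin m × Fin m} (h1 : z e.1 = z' e.1) (h2 : z e.2 = z' e.2) :
    𝔞.edgeGrad x n θ z e = 𝔞.edgeGrad x n θ z' e := by
  simp only [edgeGrad, h1, h2]

lemma norm_setIntegral_le_real {F : Type*} [NormedAddCommGroup F] [NormedSpace ℝ F]
    {ν : Measure ℝ} [IsFiniteMeasure ν] {f : ℝ → F} {M : ℝ} (hf : ∀ t, ‖f t‖ ≤ M) (W : Set ℝ) :
    ‖∫ t in W, f t ∂ν‖ ≤ M * ν.real W :=
  norm_setIntegral_le_of_norm_le_const (measure_lt_top _ _) fun t _ => hf t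

lemma norm_setIntegral_window_le {F : Type*} [NormedAddCommGroup F] [NormedSpace ℝ F]
    {dT : ℝ} (hdT : 0 < dT) {f : ℝ → F} {M : ℝ} (n : ℕ) (hf : ∀ t ∈ window dT n, ‖f t‖ ≤ M) :
    ‖∫ t in window dT n, f t‖ ≤ M * dT := by
  have := norm_setIntegral_le_of_norm_le_const (f := f) (C := M) (μ := volume)
    (s := window dT n) (by simp [window]) hf
  rwa [volume_window hdT] at this

namespace Regular

variable {M : ℝ}

lemma measurable_logE (h : 𝔞.Regular M) (k l : Fin K) (θ : EuclideanSpace ℝ (Fin p)) :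
    Measurable (𝔞.logE k l θ) :=
  (h.stronglyMeasurable_logE k l).measurable.comp measurable_prodMk_left

lemma measurable_valE (h : 𝔞.Regular M) (k l : Fin K) (θ : EuclideanSpace ℝ (Fin p)) :
    Measurable (𝔞.valE k l θ) :=
  (h.stronglyMeasurable_valE k l).measurable.comp measurable_prodMk_left

lemma stronglyMeasurable_glogE_right (h : 𝔞.Regular M) (k l : Fin K)
    (θ : EuclideanSpace ℝ (Fin p)) : StronglyMeasurable (𝔞.glogE k l θ) :=
  (h.stronglyMeasurable_glogE k l).comp_measurable measurable_prodMk_left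

lemma abs_edgeLL_le (h : 𝔞.Regular M) (x : EdgeData m) (n : ℕ) (θ : EuclideanSpace ℝ (Fin p))
    (z : Fin m → Fin K) (e : Fin m × Fin m) : |𝔞.edgeLL x n θ z e| ≤ M * 𝔞.edgeMass x n e := by
  rw [edgeMass, mul_add]
  refine (abs_sub _ _).trans (add_le_add ?_ ?_)
  · exact norm_setIntegral_le_real (h.norm_logE_le _ _ θ) _
  · exact norm_setIntegral_window_le h.dT_pos n fun t _ => h.norm_valE_le _ _ θ t

lemma norm_edgeGrad_le (h : 𝔞.Regular M) (x : EdgeData m) (n : ℕ) (θ : EuclideanSpace ℝ (Fin p))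
    (z : Fin m → Fin K) (e : Fin m × Fin m) : ‖𝔞.edgeGrad x n θ z e‖ ≤ M * 𝔞.edgeMass x n e := by
  rw [edgeMass, mul_add]
  refine (norm_sub_le _ _).trans (add_le_add ?_ ?_)
  · exact norm_setIntegral_le_real (h.norm_glogE_le _ _ θ) _
  · exact norm_setIntegral_window_le h.dT_pos n fun t _ => h.norm_gvalE_le _ _ θ t

lemma edgeMass_nonneg (h : 𝔞.Regular M) (x : EdgeData m) (n : ℕ) (e : Fin m × Fin m) :
    0 ≤ 𝔞.edgeMass x n e := add_nonneg measureReal_nonneg h.dT_pos.le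

lemma mass_nonneg (h : 𝔞.Regular M) (x : EdgeData m) (n : ℕ) : 0 ≤ 𝔞.mass x n :=
  Finset.sum_nonneg fun e _ => h.edgeMass_nonneg x n e

lemma window_subset_Ici (h : 𝔞.Regular M) {n : ℕ} (hn : 1 ≤ n) : window 𝔞.dT n ⊆ Set.Ici 0 :=
  fun _ ht => (window_subset h.dT_pos hn le_rfl ht).1.le

lemma abs_logE_sub_le (h : 𝔞.Regular M) {B : Set (EuclideanSpace ℝ (Fin p))} (hB : Convex ℝ B)
    (hBΘ : B ⊆ 𝔞.Θ) {θ θ' : EuclideanSpace ℝ (Fin p)} (hθ : θ ∈ B) (hθ' : θ' ∈ B) (k l : Fin K)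
    {t : ℝ} (ht : 0 ≤ t) : |𝔞.logE k l θ t - 𝔞.logE k l θ' t| ≤ M * ‖θ - θ'‖ := by
  rw [logE, extZero_of_mem _ (hBΘ hθ) ht, extZero_of_mem _ (hBΘ hθ') ht]
  exact abs_sub_le_of_gradient_le h.isOpen (h.contDiffOn_log k l t ht)
    (fun θ hθ => h.bdd.bound_grad_log θ hθ k l t ht) hB hBΘ hθ hθ'

lemma abs_valE_sub_le (h : 𝔞.Regular M) {B : Set (EuclideanSpace ℝ (Fin p))} (hB : Convex ℝ B)
    (hBΘ : B ⊆ 𝔞.Θ) {θ θ' : EuclideanSpace ℝ (Fin p)} (hθ : θ ∈ B) (hθ' : θ' ∈ B) (k l : Fin K)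
    {t : ℝ} (ht : 0 ≤ t) : |𝔞.valE k l θ t - 𝔞.valE k l θ' t| ≤ M * ‖θ - θ'‖ := by
  rw [valE, extZero_of_mem _ (hBΘ hθ) ht, extZero_of_mem _ (hBΘ hθ') ht]
  exact abs_sub_le_of_gradient_le h.isOpen (h.bdd.contDiff k l t ht)
    (fun θ hθ => h.bdd.bound_grad θ hθ k l t ht) hB hBΘ hθ hθ'

lemma integrable_logE (h : 𝔞.Regular M) (k l : Fin K) (θ : EuclideanSpace ℝ (Fin p))
    (ν : Measure ℝ) [IsFiniteMeasure ν] : Integrable (𝔞.logE k l θ) ν :=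
  integrable_of_abs_le (h.measurable_logE k l θ) (h.norm_logE_le k l θ)

lemma integrableOn_valE (h : 𝔞.Regular M) (k l : Fin K) (θ : EuclideanSpace ℝ (Fin p)) (n : ℕ) :
    IntegrableOn (𝔞.valE k l θ) (window 𝔞.dT n) := by
  have : IsFiniteMeasure (volume.restrict (window 𝔞.dT n)) := ⟨by simp [window]⟩
  exact integrable_of_abs_le (h.measurable_valE k l θ) (h.norm_valE_le k l θ)

lemma abs_edgeLL_sub_le (h : 𝔞.Regular M) {B : Set (EuclideanSpace ℝ (Fin p))}
    (hB : Convex ℝ B) (hBΘ : B ⊆ 𝔞.Θ) {θ θ' : EuclideanSpace ℝ (Fin p)} (hθ : θ ∈ B) (hθ' : θ' ∈ B)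
    (x : EdgeData m) {n : ℕ} (hn : 1 ≤ n) (z : Fin m → Fin K) (e : Fin m × Fin m) :
    |𝔞.edgeLL x n θ z e - 𝔞.edgeLL x n θ' z e| ≤ M * ‖θ - θ'‖ * 𝔞.edgeMass x n e := by
  have h1 := integral_sub
    (h.integrable_logE (z e.1) (z e.2) θ ((x e).1.restrict (window 𝔞.dT n)))
    (h.integrable_logE (z e.1) (z e.2) θ' ((x e).1.restrict (window 𝔞.dT n)))
  have h2 := integral_sub (h.integrableOn_valE (z e.1) (z e.2) θ n)
    (h.integrableOn_valE (z e.1) (z e.2) θ' n)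
  have h3 : ∀ t ∈ window 𝔞.dT n, ‖𝔞.logE (z e.1) (z e.2) θ t - 𝔞.logE (z e.1) (z e.2) θ' t‖
      ≤ M * ‖θ - θ'‖ := fun t ht =>
    h.abs_logE_sub_le hB hBΘ hθ hθ' _ _ (h.window_subset_Ici hn ht)
  have h4 : ∀ t ∈ window 𝔞.dT n, ‖𝔞.valE (z e.1) (z e.2) θ t - 𝔞.valE (z e.1) (z e.2) θ' t‖
      ≤ M * ‖θ - θ'‖ := fun t ht =>
    h.abs_valE_sub_le hB hBΘ hθ hθ' _ _ (h.window_subset_Ici hn ht)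
  rw [edgeMass, mul_add, edgeLL, edgeLL, sub_sub_sub_comm, ← h1, ← h2]
  exact (abs_sub _ _).trans (add_le_add
    (norm_setIntegral_le_of_norm_le_const (measure_lt_top _ _) h3)
    (norm_setIntegral_window_le h.dT_pos n h4))

lemma abs_LL_sub_le (h : 𝔞.Regular M) {B : Set (EuclideanSpace ℝ (Fin p))}
    (hB : Convex ℝ B) (hBΘ : B ⊆ 𝔞.Θ) {θ θ' : EuclideanSpace ℝ (Fin p)} (hθ : θ ∈ B) (hθ' : θ' ∈ B)
    (x : EdgeData m) {n : ℕ} (hn : 1 ≤ n) (z : Fin m → Fin K) :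
    |𝔞.LL x n θ z - 𝔞.LL x n θ' z| ≤ M * ‖θ - θ'‖ * 𝔞.mass x n := by
  rw [LL_eq_sum, LL_eq_sum, ← Finset.sum_sub_distrib, mass, Finset.mul_sum]
  exact (Finset.abs_sum_le_sum_abs _ _).trans
    (Finset.sum_le_sum fun e _ => h.abs_edgeLL_sub_le hB hBΘ hθ hθ' x hn z e)

end Regular

lemma inner_grad (x : EdgeData m) (n : ℕ) (θ : EuclideanSpace ℝ (Fin p)) (q : Fin m → Fin K → ℝ)
    (u : EuclideanSpace ℝ (Fin p)) :
    inner ℝ (𝔞.grad x n θ q) u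
      = ∑ e ∈ 𝔞.A, expect q fun z => inner ℝ (𝔞.edgeGrad x n θ z e) u := by
  simp only [grad, sum_inner, inner_smul_left, expect, Finset.mul_sum]
  rw [Finset.sum_comm]
  simp

lemma inner_grad_pointField (x : EdgeData m) (n : ℕ) (θ : EuclideanSpace ℝ (Fin p))
    (zs : Fin m → Fin K) (u : EuclideanSpace ℝ (Fin p)) :
    inner ℝ (𝔞.grad x n θ (pointField zs)) u
      = ∑ e ∈ 𝔞.A, inner ℝ (𝔞.edgeGrad x n θ zs e) u := by
  simp only [inner_grad, expect_pointField]

namespace Regular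

variable {M : ℝ}

lemma norm_grad_le (h : 𝔞.Regular M) (x : EdgeData m) (n : ℕ) (θ : EuclideanSpace ℝ (Fin p))
    {q : Fin m → Fin K → ℝ} (hq : IsMeanField q) : ‖𝔞.grad x n θ q‖ ≤ M * 𝔞.mass x n := by
  calc ‖𝔞.grad x n θ q‖ ≤ ∑ z, prodProb q z * (M * 𝔞.mass x n) := by
        refine (norm_sum_le _ _).trans (Finset.sum_le_sum fun z _ => ?_)
        rw [norm_smul, Real.norm_of_nonneg (prodProb_nonneg hq z)]
        refine mul_le_mul_of_nonneg_left ?_ (prodProb_nonneg hq z)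
        rw [mass, Finset.mul_sum]
        exact (norm_sum_le _ _).trans (Finset.sum_le_sum fun e _ => h.norm_edgeGrad_le x n θ z e)
    _ = M * 𝔞.mass x n := by
        rw [← Finset.sum_mul, sum_prodProb hq, one_mul]

/-- The contribution of a pair depends on two memberships only, so `expect_pair_sub_le` applies pair
by pair; the loss is of order `ε` times the mass and not of the total variation distance, which
would involve all the nodes. -/
lemma abs_inner_grad_sub_le (h : 𝔞.Regular M) (x : EdgeData m) (n : ℕ)
    (θ : EuclideanSpace ℝ (Fin p)) {q : Fin m → Fin K → ℝ} (hq : IsMeanField q)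
    {zs : Fin m → Fin K} {ε : ℝ} (hε : ∀ j, 1 - q j (zs j) ≤ ε) (u : EuclideanSpace ℝ (Fin p)) :
    |inner ℝ (𝔞.grad x n θ q) u - inner ℝ (𝔞.grad x n θ (pointField zs)) u|
      ≤ 4 * M * ‖u‖ * ε * 𝔞.mass x n := by
  rw [inner_grad, inner_grad_pointField, ← Finset.sum_sub_distrib, mass, Finset.mul_sum]
  refine (Finset.abs_sum_le_sum_abs _ _).trans (Finset.sum_le_sum fun e _ => ?_)
  have := expect_pair_sub_le hq hε e (f := fun z => inner ℝ (𝔞.edgeGrad x n θ z e) u)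
    (B := M * 𝔞.edgeMass x n e * ‖u‖) (fun z => (abs_real_inner_le_norm _ _).trans
      (mul_le_mul_of_nonneg_right (h.norm_edgeGrad_le x n θ z e) (norm_nonneg _)))
    (fun z h1 h2 => by simp only [𝔞.edgeGrad_congr x n θ h1 h2])
  refine this.trans (le_of_eq ?_)
  rw [edgeMass]
  ring

end Regular

/-! ### The evidence -/

/-- The pairs that a node belongs to. -/
def touching (𝔞 : Algorithm p K m) (i : Fin m) : Finset (Fin m × Fin m) :=
  𝔞.A.filter fun e => e.1 = i ∨ e.2 = i

/-- A neighbour accounts for at most two ordered pairs, one per direction. -/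
lemma card_touching_le (i : Fin m) : (𝔞.touching i).card ≤ 2 * degree 𝔞.A i := by
  classical
  have hsub : 𝔞.touching i ⊆
      (Finset.univ.filter fun j => (i, j) ∈ 𝔞.A ∨ (j, i) ∈ 𝔞.A).image (fun j => (i, j)) ∪
      (Finset.univ.filter fun j => (i, j) ∈ 𝔞.A ∨ (j, i) ∈ 𝔞.A).image (fun j => (j, i)) := by
    rintro ⟨r, s⟩ he
    simp only [touching, Finset.mem_filter] at he
    obtain ⟨hA, rfl | rfl⟩ := he
    · refine Finset.mem_union_left _ (Finset.mem_image.2 ⟨s, ?_, rfl⟩)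
      simp [hA]
    · refine Finset.mem_union_right _ (Finset.mem_image.2 ⟨r, ?_, rfl⟩)
      simp [hA]
  refine (Finset.card_le_card hsub).trans ((Finset.card_union_le _ _).trans ?_)
  rw [two_mul]
  exact add_le_add Finset.card_image_le Finset.card_image_le

/-- The change, over window `n`, of the log-evidence for class `k` of node `i`, relative to class
`l`. -/
def incr (𝔞 : Algorithm p K m) (x : EdgeData m) (n : ℕ) (θ : EuclideanSpace ℝ (Fin p))
    (q : Fin m → Fin K → ℝ) (i : Fin m) (k l : Fin K) : ℝ :=
  expectAt q i k (𝔞.LL x n θ) - expectAt q i l (𝔞.LL x n θ)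

lemma incr_eq (x : EdgeData m) (n : ℕ) (θ : EuclideanSpace ℝ (Fin p))
    {q : Fin m → Fin K → ℝ} (hq : IsMeanField q) (i : Fin m) (k l : Fin K) :
    𝔞.incr x n θ q i k l = ∑ e ∈ 𝔞.A, expect q fun z =>
      𝔞.edgeLL x n θ (Function.update z i k) e - 𝔞.edgeLL x n θ (Function.update z i l) e := by
  rw [incr, expectAt_eq_expect_update i (hq i).2, expectAt_eq_expect_update i (hq i).2,
    ← expect_sub, ← expect_sum]
  simp only [LL_eq_sum, Finset.sum_sub_distrib]

/-- A pair that avoids `i` does not see the class of `i`, so its two terms cancel. -/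
lemma incr_eq_sum_touching (x : EdgeData m) (n : ℕ) (θ : EuclideanSpace ℝ (Fin p))
    {q : Fin m → Fin K → ℝ} (hq : IsMeanField q) (i : Fin m) (k l : Fin K) :
    𝔞.incr x n θ q i k l = ∑ e ∈ 𝔞.touching i, expect q fun z =>
      𝔞.edgeLL x n θ (Function.update z i k) e - 𝔞.edgeLL x n θ (Function.update z i l) e := by
  rw [incr_eq x n θ hq, touching, Finset.sum_filter_of_ne]
  intro e _ hne
  by_contra hi
  push Not at hi
  apply hne
  have : (fun z => 𝔞.edgeLL x n θ (Function.update z i k) e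
      - 𝔞.edgeLL x n θ (Function.update z i l) e) = fun _ => 0 := by
    funext z
    rw [𝔞.edgeLL_congr x n θ (z := Function.update z i k) (z' := Function.update z i l)
      (by simp [hi.1]) (by simp [hi.2]), sub_self]
  rw [this]
  simp [expect]

/-- The integrand of the centred evidence. -/
def incrFun (𝔞 : Algorithm p K m) (θ : EuclideanSpace ℝ (Fin p)) (q : Fin m → Fin K → ℝ)
    (i : Fin m) (k l : Fin K) (e : Fin m × Fin m) (t : ℝ) : ℝ :=
  expect q fun z =>
    𝔞.logE (Function.update z i k e.1) (Function.update z i k e.2) θ t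
      - 𝔞.logE (Function.update z i l e.1) (Function.update z i l e.2) θ t

lemma incrFun_eq_zero (θ : EuclideanSpace ℝ (Fin p)) (q : Fin m → Fin K → ℝ)
    {i : Fin m} (k l : Fin K) {e : Fin m × Fin m} (he : e ∈ 𝔞.A) (hi : e ∉ 𝔞.touching i) (t : ℝ) :
    𝔞.incrFun θ q i k l e t = 0 := by
  simp only [touching, Finset.mem_filter, he, true_and, not_or] at hi
  simp [incrFun, hi.1, hi.2, expect]

namespace Regular

variable {M : ℝ}

lemma measurable_incrFun (h : 𝔞.Regular M) (θ : EuclideanSpace ℝ (Fin p)) (q : Fin m → Fin K → ℝ)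
    (i : Fin m) (k l : Fin K) (e : Fin m × Fin m) : Measurable (𝔞.incrFun θ q i k l e) :=
  measurable_expect measurable_const fun _ =>
    (h.measurable_logE _ _ θ).sub (h.measurable_logE _ _ θ)

lemma abs_incrFun_le (h : 𝔞.Regular M) (θ : EuclideanSpace ℝ (Fin p)) {q : Fin m → Fin K → ℝ}
    (hq : IsMeanField q) (i : Fin m) (k l : Fin K) (e : Fin m × Fin m) (t : ℝ) :
    |𝔞.incrFun θ q i k l e t| ≤ 2 * M := by
  refine abs_expect_le hq fun z => (abs_sub _ _).trans ?_
  have h1 := h.norm_logE_le (Function.update z i k e.1) (Function.update z i k e.2) θ t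
  have h2 := h.norm_logE_le (Function.update z i l e.1) (Function.update z i l e.2) θ t
  rw [Real.norm_eq_abs] at h1 h2
  linarith

lemma setIntegral_incrFun (h : 𝔞.Regular M) (θ : EuclideanSpace ℝ (Fin p))
    (q : Fin m → Fin K → ℝ) (i : Fin m) (k l : Fin K) (e : Fin m × Fin m) (x : EdgeData m) (n : ℕ) :
    ∫ t in window 𝔞.dT n, 𝔞.incrFun θ q i k l e t ∂(x e).1 = expect q fun z =>
      (∫ t in window 𝔞.dT n,
        𝔞.logE (Function.update z i k e.1) (Function.update z i k e.2) θ t ∂(x e).1)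
      - ∫ t in window 𝔞.dT n,
        𝔞.logE (Function.update z i l e.1) (Function.update z i l e.2) θ t ∂(x e).1 := by
  refine (integral_finsetSum _ fun z _ => ((h.integrable_logE _ _ θ _).sub
    (h.integrable_logE _ _ θ _)).const_mul _).trans ?_
  refine Finset.sum_congr rfl fun z _ => ?_
  simp only [Pi.sub_apply]
  rw [integral_const_mul, integral_sub (h.integrable_logE _ _ θ _) (h.integrable_logE _ _ θ _)]

/-- The compensators do not depend on the data and cancel. With the mean data for `y`, this exhibits
the centred evidence as a centred linear statistic. -/
lemma incr_sub_incr (h : 𝔞.Regular M) (x y : EdgeData m) (n : ℕ) (θ : EuclideanSpace ℝ (Fin p))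
    {q : Fin m → Fin K → ℝ} (hq : IsMeanField q) (i : Fin m) (k l : Fin K) :
    𝔞.incr x n θ q i k l - 𝔞.incr y n θ q i k l
      = edgeSum 𝔞.A 𝔞.dT n (𝔞.incrFun θ q i k l) x - edgeSum 𝔞.A 𝔞.dT n (𝔞.incrFun θ q i k l) y := by
  simp only [incr_eq _ n θ hq, edgeSum, ← Finset.sum_sub_distrib, h.setIntegral_incrFun,
    ← expect_sub, edgeLL]
  refine Finset.sum_congr rfl fun e _ => congrArg _ (funext fun z => ?_)
  ring

/-- At the point mass the increment is the likelihood change of a single membership. Replacing `q`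
by the point mass costs at most `8 * M * Y * ε` for each touching pair, and there are at most twice
the degree of these. -/
lemma incr_le_of_concentrated (h : 𝔞.Regular M) (x : EdgeData m) (n : ℕ)
    (θ : EuclideanSpace ℝ (Fin p)) {q : Fin m → Fin K → ℝ} (hq : IsMeanField q)
    {zs : Fin m → Fin K} {ε : ℝ} (hε0 : 0 ≤ ε) (hε : ∀ j, 1 - q j (zs j) ≤ ε) (i : Fin m)
    (k : Fin K) {Y : ℝ} (hY : ∀ e ∈ 𝔞.A, 𝔞.edgeMass x n e ≤ Y) :
    𝔞.incr x n θ q i k (zs i) ≤ 𝔞.LL x n θ (Function.update zs i k) - 𝔞.LL x n θ zs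
      + 16 * M * Y * ε * degree 𝔞.A i := by
  have hpf : 𝔞.incr x n θ (pointField zs) i k (zs i)
      = 𝔞.LL x n θ (Function.update zs i k) - 𝔞.LL x n θ zs := by
    rw [incr, expectAt_eq_expect_update i ((isMeanField_pointField zs) i).2,
      expectAt_eq_expect_update i ((isMeanField_pointField zs) i).2, expect_pointField,
      expect_pointField, Function.update_eq_self]
  have hdiff : 𝔞.incr x n θ q i k (zs i) - 𝔞.incr x n θ (pointField zs) i k (zs i)
      ≤ 16 * M * Y * ε * degree 𝔞.A i := by
    rw [incr_eq_sum_touching x n θ hq, incr_eq_sum_touching x n θ (isMeanField_pointField zs),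
      ← Finset.sum_sub_distrib]
    have hY0 : ∀ e ∈ 𝔞.A, 0 ≤ Y := fun e he => (h.edgeMass_nonneg x n e).trans (hY e he)
    by_cases hne : (𝔞.touching i).Nonempty
    swap
    · rw [Finset.not_nonempty_iff_eq_empty.1 hne, Finset.sum_empty]
      -- The sign of `Y` is inherited from the mass of some pair, so a network without pairs, where
      -- the degree vanishes, is treated apart.
      by_cases hA : 𝔞.A.Nonempty
      · obtain ⟨e, he⟩ := hA
        have := hY0 e he
        have := h.M_nonneg
        positivity
      · have : degree 𝔞.A i = 0 := by
          rw [Finset.not_nonempty_iff_eq_empty.1 hA]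
          simp [degree]
        simp [this]
    obtain ⟨e₀, he₀⟩ := hne
    have hYn : 0 ≤ Y := hY0 e₀ (Finset.mem_filter.1 he₀).1
    have hM := h.M_nonneg
    calc _ ≤ ∑ e ∈ 𝔞.touching i, 4 * (2 * (M * Y)) * ε := by
          refine Finset.sum_le_sum fun e he => ?_
          rw [expect_pointField]
          have heA : e ∈ 𝔞.A := (Finset.mem_filter.1 he).1
          refine (le_abs_self _).trans (expect_pair_sub_le hq hε e
            (f := fun z => 𝔞.edgeLL x n θ (Function.update z i k) e
              - 𝔞.edgeLL x n θ (Function.update z i (zs i)) e) (fun z => ?_) fun z h1 h2 => ?_)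
          · refine (abs_sub _ _).trans ?_
            have h1 := h.abs_edgeLL_le x n θ (Function.update z i k) e
            have h2 := h.abs_edgeLL_le x n θ (Function.update z i (zs i)) e
            have h3 := mul_le_mul_of_nonneg_left (hY e heA) hM
            linarith
          · have hup : ∀ l j, z j = zs j → Function.update z i l j = Function.update zs i l j := by
              intro l j hj
              by_cases hji : j = i
              · subst hji; simp
              · simp [hji, hj]
            rw [𝔞.edgeLL_congr x n θ (hup k _ h1) (hup k _ h2),
              𝔞.edgeLL_congr x n θ (hup (zs i) _ h1) (hup (zs i) _ h2)]
      _ = ((𝔞.touching i).card : ℝ) * (8 * M * Y * ε) := by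
          rw [Finset.sum_const, nsmul_eq_mul]; ring
      _ ≤ (2 * degree 𝔞.A i) * (8 * M * Y * ε) := by
          refine mul_le_mul_of_nonneg_right ?_ (by positivity)
          exact_mod_cast 𝔞.card_touching_le i
      _ = _ := by ring
  linarith

/-- This serves the first window, where the initial gap is known at the true parameter but the run
uses its starting point. Convexity of `B` replaces that of the parameter space in the mean value
bound. -/
lemma incr_le_of_near (h : 𝔞.Regular M) {B : Set (EuclideanSpace ℝ (Fin p))}
    (hB : Convex ℝ B) (hBΘ : B ⊆ 𝔞.Θ) {θ θ' : EuclideanSpace ℝ (Fin p)} (hθ : θ ∈ B) (hθ' : θ' ∈ B)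
    (x : EdgeData m) {n : ℕ} (hn : 1 ≤ n) {q : Fin m → Fin K → ℝ} (hq : IsMeanField q) (i : Fin m)
    (k l : Fin K) {Y : ℝ} (hY : ∀ e ∈ 𝔞.A, 𝔞.edgeMass x n e ≤ Y) (hY0 : 0 ≤ Y) :
    𝔞.incr x n θ q i k l ≤ 𝔞.incr x n θ' q i k l + 4 * M * Y * ‖θ - θ'‖ * degree 𝔞.A i := by
  have hM := h.M_nonneg
  suffices 𝔞.incr x n θ q i k l - 𝔞.incr x n θ' q i k l ≤ 4 * M * Y * ‖θ - θ'‖ * degree 𝔞.A i by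
    linarith
  rw [incr_eq_sum_touching x n θ hq, incr_eq_sum_touching x n θ' hq, ← Finset.sum_sub_distrib]
  calc _ ≤ ∑ e ∈ 𝔞.touching i, 2 * (M * ‖θ - θ'‖ * Y) := by
        refine Finset.sum_le_sum fun e he => ?_
        have heA : e ∈ 𝔞.A := (Finset.mem_filter.1 he).1
        rw [← expect_sub]
        refine (le_abs_self _).trans (abs_expect_le hq fun z => ?_)
        have h1 := h.abs_edgeLL_sub_le hB hBΘ hθ hθ' x hn (Function.update z i k) e
        have h2 := h.abs_edgeLL_sub_le hB hBΘ hθ hθ' x hn (Function.update z i l) e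
        have h3 := mul_le_mul_of_nonneg_left (hY e heA)
          (mul_nonneg hM (norm_nonneg (θ - θ')))
        rw [sub_sub_sub_comm]
        refine (abs_sub _ _).trans ?_
        linarith
    _ = ((𝔞.touching i).card : ℝ) * (2 * (M * ‖θ - θ'‖ * Y)) := by
        rw [Finset.sum_const, nsmul_eq_mul]
    _ ≤ (2 * degree 𝔞.A i) * (2 * (M * ‖θ - θ'‖ * Y)) := by
        refine mul_le_mul_of_nonneg_right ?_ (by positivity)
        exact_mod_cast 𝔞.card_touching_le i
    _ = _ := by ring

/-! ### Centring -/

lemma mass_sub_mass (x y : EdgeData m) (n : ℕ) :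
    𝔞.mass x n - 𝔞.mass y n
      = edgeSum 𝔞.A 𝔞.dT n (fun _ _ => 1) x - edgeSum 𝔞.A 𝔞.dT n (fun _ _ => 1) y := by
  simp [mass, edgeSum, Finset.sum_add_distrib]

lemma LL_sub_LL (h : 𝔞.Regular M) (x y : EdgeData m) (n : ℕ) (θ θ' : EuclideanSpace ℝ (Fin p))
    (z : Fin m → Fin K) :
    (𝔞.LL x n θ z - 𝔞.LL x n θ' z) - (𝔞.LL y n θ z - 𝔞.LL y n θ' z)
      = edgeSum 𝔞.A 𝔞.dT n (fun e t => 𝔞.logE (z e.1) (z e.2) θ t - 𝔞.logE (z e.1) (z e.2) θ' t) x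
        - edgeSum 𝔞.A 𝔞.dT n
          (fun e t => 𝔞.logE (z e.1) (z e.2) θ t - 𝔞.logE (z e.1) (z e.2) θ' t) y := by
  have hi : ∀ (x : EdgeData m) e, ∫ t in window 𝔞.dT n,
      (𝔞.logE (z e.1) (z e.2) θ t - 𝔞.logE (z e.1) (z e.2) θ' t) ∂(x e).1
      = (∫ t in window 𝔞.dT n, 𝔞.logE (z e.1) (z e.2) θ t ∂(x e).1)
        - ∫ t in window 𝔞.dT n, 𝔞.logE (z e.1) (z e.2) θ' t ∂(x e).1 := fun x e =>
    integral_sub (h.integrable_logE _ _ θ _) (h.integrable_logE _ _ θ' _)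
  simp only [LL, edgeSum, hi, ← Finset.sum_sub_distrib]
  exact Finset.sum_congr rfl fun e _ => by ring

lemma inner_grad_sub_inner_grad (h : 𝔞.Regular M) (x y : EdgeData m) (n : ℕ)
    (θ u : EuclideanSpace ℝ (Fin p)) (zs : Fin m → Fin K) :
    inner ℝ (𝔞.grad x n θ (pointField zs)) u - inner ℝ (𝔞.grad y n θ (pointField zs)) u
      = edgeSum 𝔞.A 𝔞.dT n (fun e t => inner ℝ (𝔞.glogE (zs e.1) (zs e.2) θ t) u) x
        - edgeSum 𝔞.A 𝔞.dT n (fun e t => inner ℝ (𝔞.glogE (zs e.1) (zs e.2) θ t) u) y := by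
  have hi : ∀ (x : EdgeData m) e, ∫ t in window 𝔞.dT n,
      inner ℝ (𝔞.glogE (zs e.1) (zs e.2) θ t) u ∂(x e).1
      = inner ℝ (∫ t in window 𝔞.dT n, 𝔞.glogE (zs e.1) (zs e.2) θ t ∂(x e).1) u := by
    intro x e
    simp only [real_inner_comm u]
    exact integral_inner (Integrable.of_bound
      (h.stronglyMeasurable_glogE_right _ _ θ).aestronglyMeasurable M
      (Eventually.of_forall (h.norm_glogE_le _ _ θ))) u
  simp only [inner_grad_pointField, edgeSum, hi, edgeGrad, inner_sub_left,
    ← Finset.sum_sub_distrib]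
  exact Finset.sum_congr rfl fun e _ => by ring

end Regular

end Algorithm

end

end OnlineNet

namespace OnlineNet

noncomputable section

/-! ## Stopped sums of functionals of the past and of the present window -/

section frozen

variable {m : ℕ} {A : Finset (Fin m × Fin m)} {dT : ℝ} {N : ℕ} {xm : EdgeData m}
  {μ : Measure (EdgeData m)}

/-- The streams up to the end of window `s`. -/
def past (m : ℕ) (dT : ℝ) (s : ℕ) : EdgeData m → EdgeData m :=
  restrictData (Set.Ioc 0 ((s : ℝ) * dT))

/-- The streams in window `s + 1`. -/
def present (m : ℕ) (dT : ℝ) (s : ℕ) : EdgeData m → EdgeData m :=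
  restrictData (window dT (s + 1))

lemma measurable_past (m : ℕ) (dT : ℝ) (s : ℕ) : Measurable (past m dT s) :=
  measurable_restrictData measurableSet_Ioc

lemma measurable_present (m : ℕ) (dT : ℝ) (s : ℕ) : Measurable (present m dT s) :=
  measurable_restrictData (measurableSet_window _ _)

lemma restrictData_restrictData {S T : Set ℝ} (h : S ⊆ T) (x : EdgeData m) :
    restrictData S (restrictData T x) = restrictData S x :=
  funext fun _ => Subtype.ext (Measure.restrict_restrict_of_subset h)

lemma past_past (hdT : 0 < dT) {r s : ℕ} (hrs : r ≤ s) (x : EdgeData m) :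
    past m dT r (past m dT s x) = past m dT r x :=
  restrictData_restrictData (Set.Ioc_subset_Ioc_right
    (mul_le_mul_of_nonneg_right (by exact_mod_cast hrs) hdT.le)) x

lemma present_past (hdT : 0 < dT) {r s : ℕ} (hrs : r < s) (x : EdgeData m) :
    present m dT r (past m dT s x) = present m dT r x :=
  restrictData_restrictData (window_subset hdT (by omega) hrs) x

/-- A functional of the streams up to window `s` and of the streams in window `s + 1`. -/
structure IsAdapted {α : Type*} [MeasurableSpace α] (dT : ℝ) (s : ℕ)
    (φ : EdgeData m → EdgeData m → α) : Prop where
  measurable : Measurable (Function.uncurry φ)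
  past : ∀ x y, φ (past m dT s x) y = φ x y
  present : ∀ x y, φ x (present m dT s y) = φ x y

lemma IsAdapted.measurable_diag {α : Type*} [MeasurableSpace α] {s : ℕ}
    {φ : EdgeData m → EdgeData m → α} (h : IsAdapted dT s φ) : Measurable fun x => φ x x :=
  h.measurable.comp (measurable_id.prodMk measurable_id)

/-- Strictness of `r < s` matters: the functional reads window `r + 1`, which belongs to the past of
`s` exactly because `r + 1 ≤ s`. -/
lemma IsAdapted.diag_past {α : Type*} [MeasurableSpace α] {r s : ℕ}
    {φ : EdgeData m → EdgeData m → α} (h : IsAdapted dT r φ) (hdT : 0 < dT) (hrs : r < s)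
    (x : EdgeData m) : φ (OnlineNet.past m dT s x) (OnlineNet.past m dT s x) = φ x x := by
  rw [← h.past, past_past hdT hrs.le, h.past, ← h.present, present_past hdT hrs, h.present]

/-- A measurable set that is determined by the streams up to window `s`. -/
structure IsPastSet (dT : ℝ) (s : ℕ) (G : Set (EdgeData m)) : Prop where
  measurable : MeasurableSet G
  past : ∀ x, past m dT s x ∈ G ↔ x ∈ G

open Classical in
lemma IsAdapted.ite {α : Type*} [MeasurableSpace α] {s : ℕ} {φ : EdgeData m → EdgeData m → α}
    (h : IsAdapted dT s φ) {G : Set (EdgeData m)} (hG : IsPastSet dT s G) (a : α) :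
    IsAdapted dT s fun x y => if x ∈ G then φ x y else a where
  measurable := Measurable.ite (measurable_fst hG.measurable) h.measurable measurable_const
  past x y := by simp only [hG.past, h.past]
  present x y := by simp only [h.present]

open Classical in
/-- The second moment of a stopped sum of centred increments. -/
lemma PoissonData.lintegral_sq_frozen_le (h : PoissonData A dT N xm μ) (hdT : 0 < dT) {R : ℝ}
    (hR : ∀ n, 1 ≤ n → n ≤ N → ∀ e ∈ A, (xm e).1.real (window dT n) ≤ R) (hR0 : 0 ≤ R)
    (hA : 0 < A.card) {G : ℕ → Set (EdgeData m)} (hG : ∀ s, IsPastSet dT s (G s))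
    {φ : ℕ → EdgeData m → EdgeData m → ℝ} (hφ : ∀ s, IsAdapted dT s (φ s)) {b : ℝ} (hb : 0 < b)
    (hf : ∀ s < N, ∀ x ∈ G s, ∃ f : Fin m × Fin m → ℝ → ℝ, (∀ e, Measurable (f e)) ∧
      (∀ e t, |f e t| ≤ b) ∧ ∀ y, φ s x y = edgeSum A dT (s + 1) f y - edgeSum A dT (s + 1) f xm) :
    ∫⁻ x, ENNReal.ofReal ((∑ s ∈ Finset.range N, if x ∈ G s then φ s x x else 0) ^ 2) ∂μ
      ≤ ENNReal.ofReal (N * (4 * Real.exp R * b ^ 2 * A.card)) := by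
  have := h.isProb
  have had : ∀ s, IsAdapted dT s fun x y => if x ∈ G s then φ s x y else 0 :=
    fun s => (hφ s).ite (hG s) 0
  refine lintegral_sq_sum_le (φ := fun s x y => if x ∈ G s then φ s x y else 0)
    (u := past m dT) (v := present m dT) (by positivity) (measurable_past m dT)
    (measurable_present m dT) h.indep (fun s => (had s).measurable) (fun s => (had s).past)
    (fun s => (had s).present) (fun s r hrs x => (had r).diag_past hdT hrs x) ?_ ?_
  · intro s hs x
    by_cases hx : x ∈ G s
    · obtain ⟨f, hfm, hfb, hfe⟩ := hf s hs x hx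
      simp only [if_pos hx, hfe]
      exact (h.centred_moments (by omega) hs hfm hfb hb (hR _ (by omega) hs) hR0 hA).2.1
    · simp [if_neg hx]
  · intro s hs x
    by_cases hx : x ∈ G s
    · obtain ⟨f, hfm, hfb, hfe⟩ := hf s hs x hx
      simp only [if_pos hx, hfe]
      have hc := h.centred_moments (by omega) hs hfm hfb hb (hR _ (by omega) hs) hR0 hA
      rw [← ofReal_integral_eq_lintegral_ofReal hc.1.integrable_sq
        (Eventually.of_forall fun _ => sq_nonneg _)]
      exact ENNReal.ofReal_le_ofReal hc.2.2
    · simp [if_neg hx]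

open Classical in
/-- Exponential moments of a stopped sum with negative drift. -/
lemma PoissonData.lintegral_prod_exp_le (h : PoissonData A dT N xm μ) (hdT : 0 < dT)
    {G : ℕ → Set (EdgeData m)} (hG : ∀ s, IsPastSet dT s (G s))
    {φ : ℕ → EdgeData m → EdgeData m → ℝ} (hφ : ∀ s, IsAdapted dT s (φ s)) {c : ℝ}
    (hf : ∀ s < N, ∀ x ∈ G s, ∫⁻ y, ENNReal.ofReal (Real.exp (φ s x y)) ∂μ
      ≤ ENNReal.ofReal (Real.exp (-c))) {n : ℕ} (hn : n ≤ N) :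
    ∫⁻ x, ∏ s ∈ Finset.range n, (if x ∈ G s then ENNReal.ofReal (Real.exp (φ s x x)) else 0) ∂μ
      ≤ ENNReal.ofReal (Real.exp (-(c * n))) := by
  have := h.isProb
  have had : ∀ s, IsAdapted dT s fun x y =>
      if x ∈ G s then ENNReal.ofReal (Real.exp (φ s x y)) else 0 := fun s =>
    IsAdapted.ite (φ := fun x y => ENNReal.ofReal (Real.exp (φ s x y)))
      ⟨(Real.measurable_exp.comp (hφ s).measurable).ennreal_ofReal,
        fun x y => by rw [(hφ s).past], fun x y => by rw [(hφ s).present]⟩ (hG s) 0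
  have hdiag : ∀ s, Measurable fun x =>
      if x ∈ G s then ENNReal.ofReal (Real.exp (φ s x x)) else 0 := fun s =>
    (had s).measurable.comp (measurable_id.prodMk measurable_id)
  induction n with
  | zero => simp
  | succ n ih =>
    simp only [Finset.prod_range_succ]
    -- The earlier factors and the last indicator depend on the past, so the last exponential can be
    -- integrated first, over an independent copy of the present window.
    rw [lintegral_decouple (measurable_past m dT n) (measurable_present m dT n)
      (h.indep n (by omega))
      (J := fun x y => (∏ s ∈ Finset.range n,
        if x ∈ G s then ENNReal.ofReal (Real.exp (φ s x x)) else 0) *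
          if x ∈ G n then ENNReal.ofReal (Real.exp (φ n x y)) else 0)]
    · calc _ ≤ ∫⁻ x, (∏ s ∈ Finset.range n,
            if x ∈ G s then ENNReal.ofReal (Real.exp (φ s x x)) else 0)
              * ENNReal.ofReal (Real.exp (-c)) ∂μ := by
            refine lintegral_mono fun x => ?_
            rw [lintegral_const_mul]
            · refine mul_le_mul_right ?_ _
              by_cases hx : x ∈ G n
              · simpa only [if_pos hx] using hf n (by omega) x hx
              · simp [if_neg hx]
            · exact (had n).measurable.comp measurable_prodMk_left
        _ ≤ ENNReal.ofReal (Real.exp (-(c * n))) * ENNReal.ofReal (Real.exp (-c)) := by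
            rw [lintegral_mul_const _ (Finset.measurable_prod _ fun s _ => hdiag s)]
            exact mul_le_mul_left (ih (by omega)) _
        _ = _ := by
            rw [← ENNReal.ofReal_mul (Real.exp_pos _).le, ← Real.exp_add]
            congr 2
            push_cast
            ring
    · exact ((Finset.measurable_prod _ fun s _ => hdiag s).comp measurable_fst).mul
        (had n).measurable
    · intro x y
      rw [(had n).past x y]
      congr 1
      exact Finset.prod_congr rfl fun s hs => (had s).diag_past hdT (Finset.mem_range.1 hs) x
    · intro x y
      rw [(had n).present x y]

/-- A stopped sum with negative drift is unlikely to be large. -/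
lemma PoissonData.measure_frozen_sum_gt_le (h : PoissonData A dT N xm μ) (hdT : 0 < dT)
    {G : ℕ → Set (EdgeData m)} (hG : ∀ s, IsPastSet dT s (G s))
    {φ : ℕ → EdgeData m → EdgeData m → ℝ} (hφ : ∀ s, IsAdapted dT s (φ s)) {c : ℝ}
    (hf : ∀ s < N, ∀ x ∈ G s, ∫⁻ y, ENNReal.ofReal (Real.exp (φ s x y)) ∂μ
      ≤ ENNReal.ofReal (Real.exp (-(2 * c)))) {n : ℕ} (hn : n ≤ N) :
    μ {x | (∀ s < n, x ∈ G s) ∧ -(c * n) < ∑ s ∈ Finset.range n, φ s x x}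
      ≤ ENNReal.ofReal (Real.exp (-(c * n))) := by
  classical
  have hpos := Real.exp_pos (-(c * n))
  -- Markov's inequality for the stopped product: its mean is at most `exp (-2cn)`, while on the
  -- event it is at least `exp (-cn)`. Half of the drift is given up for the tail bound.
  calc _ ≤ μ {x | ENNReal.ofReal (Real.exp (-(c * n))) ≤
        ∏ s ∈ Finset.range n, (if x ∈ G s then ENNReal.ofReal (Real.exp (φ s x x)) else 0)} := by
        refine measure_mono fun x hx => ?_
        obtain ⟨h1, h2⟩ := hx
        rw [Set.mem_ofPred_eq, Finset.prod_congr rfl fun s hs => if_pos (h1 s (Finset.mem_range.1 hs)),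
          ← ENNReal.ofReal_prod_of_nonneg fun s _ => (Real.exp_pos _).le, ← Real.exp_sum]
        exact ENNReal.ofReal_le_ofReal (Real.exp_le_exp.2 h2.le)
    _ ≤ (∫⁻ x, ∏ s ∈ Finset.range n,
          (if x ∈ G s then ENNReal.ofReal (Real.exp (φ s x x)) else 0) ∂μ)
            / ENNReal.ofReal (Real.exp (-(c * n))) := by
        refine meas_ge_le_lintegral_div ?_ (by simpa using hpos) (by simp)
        exact (Finset.measurable_prod _ fun s _ => Measurable.ite (hG s).measurable
          ((Real.measurable_exp.comp ((hφ s).measurable.comp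
            (measurable_id.prodMk measurable_id))).ennreal_ofReal) measurable_const).aemeasurable
    _ ≤ ENNReal.ofReal (Real.exp (-(2 * c * n))) / ENNReal.ofReal (Real.exp (-(c * n))) := by
        gcongr
        exact h.lintegral_prod_exp_le hdT hG hφ hf hn
    _ = _ := by
        rw [← ENNReal.ofReal_div_of_pos hpos, ← Real.exp_sub]
        congr 2
        ring

lemma measure_sq_ge_le {g : EdgeData m → ℝ} (hg : Measurable g) {v : ℝ}
    (hv : ∫⁻ x, ENNReal.ofReal (g x ^ 2) ∂μ ≤ ENNReal.ofReal v) {r : ℝ} (hr : 0 < r) :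
    μ {x | r ≤ |g x|} ≤ ENNReal.ofReal (v / r ^ 2) := by
  calc μ {x | r ≤ |g x|} ≤ μ {x | ENNReal.ofReal (r ^ 2) ≤ ENNReal.ofReal (g x ^ 2)} := by
        refine measure_mono fun x hx => ENNReal.ofReal_le_ofReal ?_
        rw [← sq_abs (g x)]
        exact pow_le_pow_left₀ hr.le hx 2
    _ ≤ (∫⁻ x, ENNReal.ofReal (g x ^ 2) ∂μ) / ENNReal.ofReal (r ^ 2) :=
        meas_ge_le_lintegral_div (hg.pow_const 2).ennreal_ofReal.aemeasurable
          (by simpa using by positivity) (by simp)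
    _ ≤ ENNReal.ofReal v / ENNReal.ofReal (r ^ 2) := by gcongr
    _ = _ := (ENNReal.ofReal_div_of_pos (by positivity)).symm

lemma measure_ge_le_of_integral_le {g : EdgeData m → ℝ} (hg0 : ∀ x, 0 ≤ g x)
    (hg : Integrable g μ) {v : ℝ} (hv : ∫ x, g x ∂μ ≤ v) {r : ℝ} (hr : 0 < r) :
    μ {x | r ≤ g x} ≤ ENNReal.ofReal (v / r) := by
  calc μ {x | r ≤ g x} ≤ μ {x | ENNReal.ofReal r ≤ ENNReal.ofReal (g x)} :=
        measure_mono fun x hx => ENNReal.ofReal_le_ofReal hx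
    _ ≤ (∫⁻ x, ENNReal.ofReal (g x) ∂μ) / ENNReal.ofReal r :=
        meas_ge_le_lintegral_div hg.aemeasurable.ennreal_ofReal (by simpa using hr) (by simp)
    _ ≤ ENNReal.ofReal v / ENNReal.ofReal r := by
        gcongr
        rw [← ofReal_integral_eq_lintegral_ofReal hg (Eventually.of_forall hg0)]
        exact ENNReal.ofReal_le_ofReal hv
    _ = _ := (ENNReal.ofReal_div_of_pos hr).symm

end frozen

end

end OnlineNet

namespace OnlineNet

noncomputable section

namespace Algorithm

variable {p K m : ℕ} {𝔞 : Algorithm p K m}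

/-! ## Functionals of the run -/

/-- The log-evidence, after window `n`, for class `k` of node `i` relative to class `l`. -/
def lev (𝔞 : Algorithm p K m) (x : EdgeData m) (n : ℕ) (i : Fin m) (k l : Fin K) : ℝ :=
  ∑ s ∈ Finset.range n, 𝔞.incr x (s + 1) (𝔞.run x s).θ (𝔞.run x s).q i k l

/-- The centred change of the squared error in window `s + 1`, for known memberships. -/
def gradNoise (𝔞 : Algorithm p K m) (xm : EdgeData m) (θs : EuclideanSpace ℝ (Fin p))
    (zs : Fin m → Fin K) (s : ℕ) (x y : EdgeData m) : ℝ :=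
  inner ℝ (𝔞.grad y (s + 1) (𝔞.run x s).θ (pointField zs)) ((𝔞.run x s).θ - θs)
    - inner ℝ (𝔞.grad xm (s + 1) (𝔞.run x s).θ (pointField zs)) ((𝔞.run x s).θ - θs)

/-- The centred loss of likelihood in window `s + 1`. -/
def llNoise (𝔞 : Algorithm p K m) (xm : EdgeData m) (θs : EuclideanSpace ℝ (Fin p))
    (zs : Fin m → Fin K) (s : ℕ) (x y : EdgeData m) : ℝ :=
  (𝔞.LL y (s + 1) θs zs - 𝔞.LL y (s + 1) (𝔞.run x s).θ zs)
    - (𝔞.LL xm (s + 1) θs zs - 𝔞.LL xm (s + 1) (𝔞.run x s).θ zs)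

/-- The noise accumulated in the squared error. -/
def mart (𝔞 : Algorithm p K m) (xm : EdgeData m) (θs : EuclideanSpace ℝ (Fin p))
    (zs : Fin m → Fin K) (x : EdgeData m) (n : ℕ) : ℝ :=
  ∑ s ∈ Finset.range n, 2 * (𝔞.η * (1 / (𝔞.A.card : ℝ))) * 𝔞.gradNoise xm θs zs s x x

lemma present_restrict (s : ℕ) (y : EdgeData m) (e : Fin m × Fin m) :
    (present m 𝔞.dT s y e).1.restrict (window 𝔞.dT (s + 1))
      = (y e).1.restrict (window 𝔞.dT (s + 1)) :=
  𝔞.restrict_now (x := y) (s + 1) e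

namespace Regular

variable {M : ℝ}

lemma run_past (h : 𝔞.Regular M) (x : EdgeData m) (s : ℕ) :
    𝔞.run (past m 𝔞.dT s x) s = 𝔞.run x s := 𝔞.run_past h.dT_pos x le_rfl

lemma isAdapted_incr (h : 𝔞.Regular M) (s : ℕ) (i : Fin m) (k l : Fin K) :
    IsAdapted 𝔞.dT s fun x y => 𝔞.incr y (s + 1) (𝔞.run x s).θ (𝔞.run x s).q i k l where
  measurable := by
    have hr := h.measurable_run s
    have h1 : ∀ k, Measurable fun b : EdgeData m × EdgeData m =>
        expectAt (𝔞.run b.1 s).q i k (𝔞.LL b.2 (s + 1) (𝔞.run b.1 s).θ) := fun k =>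
      measurable_expectAt (hr.2.1.comp measurable_fst) i k fun z =>
        h.measurable_LL measurable_snd (hr.1.comp measurable_fst) _ z
    exact (h1 k).sub (h1 l)
  past x y := by simp only [h.run_past]
  present x y := by simp only [incr, 𝔞.LL_congr (𝔞.present_restrict s y)]

lemma isAdapted_gradNoise (h : 𝔞.Regular M) (xm : EdgeData m) (θs : EuclideanSpace ℝ (Fin p))
    (zs : Fin m → Fin K) (s : ℕ) : IsAdapted 𝔞.dT s (𝔞.gradNoise xm θs zs s) where
  measurable := by
    have hr := (h.measurable_run s).1.comp
      (measurable_fst : Measurable (Prod.fst : EdgeData m × EdgeData m → EdgeData m))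
    have h1 := h.measurable_grad (measurable_snd : Measurable
      (Prod.snd : EdgeData m × EdgeData m → EdgeData m)) hr
      (measurable_const (a := pointField zs)) (s + 1)
    have h2 := h.measurable_grad (measurable_const (a := xm)) hr
      (measurable_const (a := pointField zs)) (s + 1)
    have h3 := hr.sub_const θs
    exact (h1.inner h3).sub (h2.inner h3)
  past x y := by simp only [gradNoise, h.run_past]
  present x y := by simp only [gradNoise, 𝔞.grad_congr (𝔞.present_restrict s y)]

lemma isAdapted_llNoise (h : 𝔞.Regular M) (xm : EdgeData m) (θs : EuclideanSpace ℝ (Fin p))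
    (zs : Fin m → Fin K) (s : ℕ) : IsAdapted 𝔞.dT s (𝔞.llNoise xm θs zs s) where
  measurable := by
    have hr := (h.measurable_run s).1.comp
      (measurable_fst : Measurable (Prod.fst : EdgeData m × EdgeData m → EdgeData m))
    have hy := (measurable_snd : Measurable (Prod.snd : EdgeData m × EdgeData m → EdgeData m))
    exact ((h.measurable_LL hy measurable_const _ zs).sub (h.measurable_LL hy hr _ zs)).sub
      ((h.measurable_LL measurable_const measurable_const _ zs).sub
        (h.measurable_LL measurable_const hr _ zs))
  past x y := by simp only [llNoise, h.run_past]
  present x y := by simp only [llNoise, 𝔞.LL_congr (𝔞.present_restrict s y)]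

end Regular

/-! ## Positivity along the run -/

lemma run_pos (x : EdgeData m) (hm : 0 < m) (hq : IsMeanField 𝔞.q0) (hw : ∀ k, 0 < 𝔞.w0 k)
    (hw1 : ∑ k, 𝔞.w0 k = 1) (n : ℕ) :
    IsMeanField (𝔞.run x n).q ∧ (∀ i k, 0 < (𝔞.run x n).S i k) ∧ (∀ k, 0 < (𝔞.run x n).w k) ∧
      ∀ k, (𝔞.run x n).w k ≤ 1 := by
  induction n with
  | zero =>
    refine ⟨hq, fun i k => ?_, hw, fun k => ?_⟩
    · have : 0 < K := k.pos
      change 0 < 1 / (K : ℝ)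
      positivity
    · change 𝔞.w0 k ≤ 1
      rw [← hw1]
      exact Finset.single_le_sum (fun k _ => (hw k).le) (Finset.mem_univ k)
  | succ n ih =>
    obtain ⟨-, hS, hw, -⟩ := ih
    have hS' : ∀ i k, 0 < 𝔞.nextS x (n + 1) (𝔞.run x n) i k := fun i k =>
      mul_pos (hS i k) (Real.exp_pos _)
    have hwS : ∀ i k, 0 < (𝔞.run x n).w k * 𝔞.nextS x (n + 1) (𝔞.run x n) i k := fun i k =>
      mul_pos (hw k) (hS' i k)
    have hK : (Finset.univ : Finset (Fin K)).Nonempty := by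
      by_contra hne
      rw [Finset.not_nonempty_iff_eq_empty] at hne
      simp [hne] at hw1
    have hsum : ∀ i, 0 < ∑ k, (𝔞.run x n).w k * 𝔞.nextS x (n + 1) (𝔞.run x n) i k := fun i =>
      Finset.sum_pos (fun k _ => hwS i k) hK
    have hqpos : ∀ i k, 0 < 𝔞.nextQ x (n + 1) (𝔞.run x n) i k := fun i k =>
      div_pos (hwS i k) (hsum i)
    have hqsum : ∀ i, ∑ k, 𝔞.nextQ x (n + 1) (𝔞.run x n) i k = 1 := fun i => by
      simp only [nextQ]
      rw [← Finset.sum_div, div_self (hsum i).ne']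
    have hm' : (0 : ℝ) < m := by exact_mod_cast hm
    have : Nonempty (Fin m) := ⟨⟨0, hm⟩⟩
    refine ⟨fun i => ⟨fun k => (hqpos i k).le, hqsum i⟩, hS', fun k => ?_, fun k => ?_⟩
    · change 0 < (1 / (m : ℝ)) * ∑ i, 𝔞.nextQ x (n + 1) (𝔞.run x n) i k
      exact mul_pos (by positivity) (Finset.sum_pos (fun i _ => hqpos i k) Finset.univ_nonempty)
    · change (1 / (m : ℝ)) * ∑ i, 𝔞.nextQ x (n + 1) (𝔞.run x n) i k ≤ 1
      have : ∑ i, 𝔞.nextQ x (n + 1) (𝔞.run x n) i k ≤ ∑ _i : Fin m, (1 : ℝ) :=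
        Finset.sum_le_sum fun i _ => by
          rw [← hqsum i]
          exact Finset.single_le_sum (fun k _ => (hqpos i k).le) (Finset.mem_univ k)
      rw [Finset.sum_const, Finset.card_univ, Fintype.card_fin, nsmul_eq_mul, mul_one] at this
      rw [one_div, inv_mul_le_iff₀ hm', mul_one]
      exact this

/-- The evidence starts uniform over the classes, so ratios start at one and each window multiplies
them by the exponential of its increment. -/
lemma S_eq_mul_exp_lev (x : EdgeData m) (n : ℕ) (i : Fin m) (k l : Fin K) :
    (𝔞.run x n).S i k = (𝔞.run x n).S i l * Real.exp (𝔞.lev x n i k l) := by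
  induction n with
  | zero => simp [run, lev]
  | succ n ih =>
    change (𝔞.run x n).S i k * Real.exp (expectAt (𝔞.run x n).q i k (𝔞.LL x (n + 1) (𝔞.run x n).θ))
      = (𝔞.run x n).S i l * Real.exp (expectAt (𝔞.run x n).q i l (𝔞.LL x (n + 1) (𝔞.run x n).θ))
        * Real.exp (𝔞.lev x (n + 1) i k l)
    have hsucc : 𝔞.lev x (n + 1) i k l = 𝔞.lev x n i k l
        + 𝔞.incr x (n + 1) (𝔞.run x n).θ (𝔞.run x n).q i k l := Finset.sum_range_succ _ _
    rw [ih, hsucc, mul_assoc, mul_assoc, ← Real.exp_add, ← Real.exp_add, incr]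
    congr 2
    ring

/-- The weight of wrong memberships is controlled by the log-evidence. -/
lemma one_sub_q_succ_le (x : EdgeData m) (hm : 0 < m) (hq : IsMeanField 𝔞.q0)
    (hw : ∀ k, 0 < 𝔞.w0 k) (hw1 : ∑ k, 𝔞.w0 k = 1) {n : ℕ} {i : Fin m} {l : Fin K} {R L : ℝ}
    (hR : ∀ k, (𝔞.run x n).w k ≤ R * (𝔞.run x n).w l)
    (hL : ∀ k, k ≠ l → 𝔞.lev x (n + 1) i k l ≤ -L) :
    1 - (𝔞.run x (n + 1)).q i l ≤ K * R * Real.exp (-L) := by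
  have h0 := 𝔞.run_pos x hm hq hw hw1 n
  have h1 := 𝔞.run_pos x hm hq hw hw1 (n + 1)
  -- The case `k = l` of `hR`, with a positive weight, forces `R` to be positive.
  have hR0 : 0 ≤ R := by
    have := (h0.2.2.1 l).trans_le (hR l)
    exact (pos_of_mul_pos_left this (h0.2.2.1 l).le).le
  have hbound : ∀ k ≠ l, (𝔞.run x (n + 1)).q i k ≤ R * Real.exp (-L) := by
    intro k hk
    set D := ∑ k', (𝔞.run x n).w k' * (𝔞.run x (n + 1)).S i k' with hD
    have hqk : ∀ k, (𝔞.run x (n + 1)).q i k = (𝔞.run x n).w k * (𝔞.run x (n + 1)).S i k / D :=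
      fun k => rfl
    have hlD : (𝔞.run x n).w l * (𝔞.run x (n + 1)).S i l ≤ D :=
      Finset.single_le_sum (f := fun k' => (𝔞.run x n).w k' * (𝔞.run x (n + 1)).S i k')
        (fun k _ => (mul_pos (h0.2.2.1 k) (h1.2.1 i k)).le) (Finset.mem_univ l)
    have hlpos := mul_pos (h0.2.2.1 l) (h1.2.1 i l)
    have hDpos : 0 < D := hlpos.trans_le hlD
    rw [hqk, div_le_iff₀ hDpos, 𝔞.S_eq_mul_exp_lev x (n + 1) i k l]
    calc (𝔞.run x n).w k * ((𝔞.run x (n + 1)).S i l * Real.exp (𝔞.lev x (n + 1) i k l))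
        ≤ (R * (𝔞.run x n).w l) * ((𝔞.run x (n + 1)).S i l * Real.exp (-L)) :=
          mul_le_mul (hR k) (mul_le_mul_of_nonneg_left (Real.exp_le_exp.2 (hL k hk))
            (h1.2.1 i l).le) (mul_pos (h1.2.1 i l) (Real.exp_pos _)).le
            (mul_nonneg hR0 (h0.2.2.1 l).le)
      _ = R * Real.exp (-L) * ((𝔞.run x n).w l * (𝔞.run x (n + 1)).S i l) := by ring
      _ ≤ R * Real.exp (-L) * D := mul_le_mul_of_nonneg_left hlD (by positivity)
  have hs := (h1.1 i).2
  rw [← Finset.add_sum_erase _ _ (Finset.mem_univ l)] at hs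
  calc 1 - (𝔞.run x (n + 1)).q i l = ∑ k ∈ Finset.univ.erase l, (𝔞.run x (n + 1)).q i k := by
        linarith
    _ ≤ ∑ k ∈ Finset.univ.erase l, R * Real.exp (-L) :=
        Finset.sum_le_sum fun k hk => hbound k (Finset.ne_of_mem_erase hk)
    _ ≤ ∑ _k : Fin K, R * Real.exp (-L) :=
        Finset.sum_le_sum_of_subset_of_nonneg (Finset.subset_univ _) fun _ _ _ => by positivity
    _ = K * R * Real.exp (-L) := by simp [mul_assoc]

/-- All the mass of the run concentrates on the true memberships as the evidence accumulates. -/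
lemma one_sub_q_le (x : EdgeData m) (hm : 0 < m) (hq : IsMeanField 𝔞.q0)
    (hw : ∀ k, 0 < 𝔞.w0 k) (hw1 : ∑ k, 𝔞.w0 k = 1) {W b : ℝ} (hb : 0 ≤ b)
    (hW : ∀ k l, 𝔞.w0 k ≤ W * 𝔞.w0 l) {zs : Fin m → Fin K}
    (hε : K * max W (2 * m) * Real.exp (-b) ≤ 1 / 2) {n : ℕ}
    (hL : ∀ s ≤ n, ∀ i k, k ≠ zs i → 𝔞.lev x s i k (zs i) ≤ -(b * s)) (hn : 1 ≤ n) (i : Fin m) :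
    1 - (𝔞.run x n).q i (zs i) ≤ K * max W (2 * m) * Real.exp (-(b * n)) := by
  induction n generalizing i with
  | zero => omega
  | succ n ih =>
    refine 𝔞.one_sub_q_succ_le x hm hq hw hw1 (fun k => ?_) fun k hk => hL _ le_rfl i k hk
    have h0 := 𝔞.run_pos x hm hq hw hw1 n
    -- The first update uses the initial weights, whose ratios are at most `W`. Later weights are
    -- averages of the previous distribution, and node `i` alone already gives its true class weight
    -- at least `1 / (2m)`; this is where `max W (2 * m)` comes from.
    rcases Nat.eq_zero_or_pos n with rfl | hn'
    · exact (hW k (zs i)).trans (mul_le_mul_of_nonneg_right (le_max_left _ _) (hw _).le)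
    · have h1 : 1 - (𝔞.run x n).q i (zs i) ≤ 1 / 2 := by
        refine ((ih (fun s hs => hL s (by omega)) hn' i).trans ?_).trans hε
        refine mul_le_mul_of_nonneg_left (Real.exp_le_exp.2 ?_) (by positivity)
        have : (1 : ℝ) ≤ n := by exact_mod_cast hn'
        nlinarith
      have hm' : (0 : ℝ) < m := by exact_mod_cast hm
      have hwl : (1 / (m : ℝ)) * (1 / 2) ≤ (𝔞.run x n).w (zs i) := by
        obtain ⟨r, rfl⟩ : ∃ r, n = r + 1 := ⟨n - 1, by omega⟩
        change _ ≤ (1 / (m : ℝ)) * ∑ j, (𝔞.run x (r + 1)).q j (zs i)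
        refine mul_le_mul_of_nonneg_left ?_ (by positivity)
        calc (1 / 2 : ℝ) ≤ (𝔞.run x (r + 1)).q i (zs i) := by linarith
          _ ≤ ∑ j, (𝔞.run x (r + 1)).q j (zs i) :=
            Finset.single_le_sum (f := fun j => (𝔞.run x (r + 1)).q j (zs i))
              (fun j _ => (h0.1 j).1 _) (Finset.mem_univ i)
      calc (𝔞.run x n).w k ≤ 1 := h0.2.2.2 k
        _ = (2 * m) * ((1 / (m : ℝ)) * (1 / 2)) := by field_simp
        _ ≤ max W (2 * m) * (𝔞.run x n).w (zs i) :=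
          mul_le_mul (le_max_right _ _) hwl (by positivity) (by positivity)

end Algorithm

end

end OnlineNet

namespace OnlineNet

noncomputable section

lemma sum_pow_succ_le {r : ℝ} (hr0 : 0 ≤ r) (hr : r ≤ 1 / 2) (N : ℕ) :
    ∑ n ∈ Finset.range N, r ^ (n + 1) ≤ 2 * r := by
  have h1 : ∑ n ∈ Finset.range N, r ^ (n + 1) ≤ 2 * r * (1 - r ^ N) := by
    induction N with
    | zero => simp
    | succ N ih =>
      rw [Finset.sum_range_succ]
      have : 0 ≤ r ^ N := by positivity
      rw [pow_succ]
      nlinarith [mul_nonneg hr0 this]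
  refine h1.trans ?_
  have : 0 ≤ r ^ N := by positivity
  nlinarith

namespace Algorithm

variable {p K m : ℕ} {𝔞 : Algorithm p K m}

/-! ## The algorithm on Poisson data, for a fixed network -/

/-- The constants of the analysis for a fixed network. -/
structure Params where
  /-- bound for the intensities and their derivatives -/
  M : ℝ
  /-- radius of the parameter ball -/
  δ : ℝ
  /-- evidence against wrong memberships, per unit of degree -/
  γ : ℝ
  /-- curvature of the likelihood -/
  curv : ℝ
  /-- smoothness of the likelihood -/
  kl : ℝ
  /-- the order of the degrees -/
  d : ℝ
  /-- constant in the upper bound for the degrees -/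
  degHi : ℝ
  /-- bound for the ratios of the initial weights -/
  W : ℝ

/-- The conditions on the mean likelihood under which the algorithm is analysed. -/
structure Model (𝔞 : Algorithm p K m) (N : ℕ) (zs : Fin m → Fin K) (θs : EuclideanSpace ℝ (Fin p))
    (xm : EdgeData m) (μ : Measure (EdgeData m)) (𝔭 : Params) : Prop where
  reg : 𝔞.Regular 𝔭.M
  data : PoissonData 𝔞.A 𝔞.dT N xm μ
  M_pos : 0 < 𝔭.M
  m_pos : 0 < m
  δ_pos : 0 < 𝔭.δ
  γ_pos : 0 < 𝔭.γ
  curv_pos : 0 < 𝔭.curv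
  kl_nonneg : 0 ≤ 𝔭.kl
  d_pos : 0 < 𝔭.d
  η_pos : 0 < 𝔞.η
  card_pos : 0 < 𝔞.A.card
  intensity : ∀ n, 1 ≤ n → n ≤ N → ∀ e ∈ 𝔞.A, (xm e).1.real (window 𝔞.dT n) ≤ 𝔭.M * 𝔞.dT
  ball_subset : Metric.ball θs 𝔭.δ ⊆ 𝔞.Θ
  degree_le : ∀ i, (degree 𝔞.A i : ℝ) ≤ 𝔭.degHi * 𝔭.d
  gap : ∀ n, 1 ≤ n → n ≤ N → ∀ θ ∈ Metric.ball θs 𝔭.δ, ∀ i k, k ≠ zs i →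
    𝔞.LL xm n θ (Function.update zs i k) - 𝔞.LL xm n θ zs ≤ -(2 * 𝔭.γ * 𝔭.d)
  init : ∀ i k, k ≠ zs i → 𝔞.incr xm 1 𝔞.θ0 𝔞.q0 i k (zs i) ≤ -(𝔭.γ * 𝔭.d)
  gradient : ∀ n, 1 ≤ n → n ≤ N → ∀ θ ∈ Metric.ball θs 𝔭.δ,
    inner ℝ (𝔞.grad xm n θ (pointField zs)) (θ - θs) ≤ -(𝔭.curv * 𝔞.A.card * ‖θ - θs‖ ^ 2)
  likelihood : ∀ n, 1 ≤ n → n ≤ N → ∀ θ ∈ Metric.ball θs 𝔭.δ,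
    𝔞.LL xm n θs zs - 𝔞.LL xm n θ zs ≤ 𝔞.A.card * 𝔭.kl * ‖θ - θs‖ ^ 2
  meanField : IsMeanField 𝔞.q0
  weight_pos : ∀ k, 0 < 𝔞.w0 k
  weight_sum : ∑ k, 𝔞.w0 k = 1
  weight_ratio : ∀ k l, 𝔞.w0 k ≤ 𝔭.W * 𝔞.w0 l

/-- The bound for the weight of wrong memberships after window `n`. -/
def Params.err (𝔭 : Params) (K m n : ℕ) : ℝ :=
  K * max 𝔭.W (2 * m) * Real.exp (-(𝔭.γ / 4 * 𝔭.d * n))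

/-- The run is under control in all windows up to `n`: the parameter is in the ball, the evidence
for the true memberships has accumulated, and the noise in the squared error is at most `ν`. -/
def Good (𝔞 : Algorithm p K m) (zs : Fin m → Fin K) (θs : EuclideanSpace ℝ (Fin p))
    (xm : EdgeData m) (𝔭 : Params) (ν : ℝ) (n : ℕ) : Set (EdgeData m) :=
  {x | ∀ s ≤ n, (𝔞.run x s).θ ∈ Metric.ball θs 𝔭.δ ∧
    (∀ i k, k ≠ zs i → 𝔞.lev x s i k (zs i) ≤ -(𝔭.γ / 4 * 𝔭.d * s)) ∧
    |𝔞.mart xm θs zs x s| < ν}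

lemma good_mono {zs : Fin m → Fin K} {θs : EuclideanSpace ℝ (Fin p)} {xm : EdgeData m}
    {𝔭 : Params} {ν : ℝ} {n n' : ℕ} (h : n' ≤ n) :
    𝔞.Good zs θs xm 𝔭 ν n ⊆ 𝔞.Good zs θs xm 𝔭 ν n' :=
  fun _ hx s hs => hx s (hs.trans h)

namespace Regular

variable {M : ℝ}

lemma lev_past (h : 𝔞.Regular M) (x : EdgeData m) {r s : ℕ} (hrs : r ≤ s) (i : Fin m)
    (k l : Fin K) : 𝔞.lev (past m 𝔞.dT s x) r i k l = 𝔞.lev x r i k l :=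
  Finset.sum_congr rfl fun j hj => (h.isAdapted_incr j i k l).diag_past h.dT_pos
    ((Finset.mem_range.1 hj).trans_le hrs) x

lemma mart_past (h : 𝔞.Regular M) (xm : EdgeData m) (θs : EuclideanSpace ℝ (Fin p))
    (zs : Fin m → Fin K) (x : EdgeData m) {r s : ℕ} (hrs : r ≤ s) :
    𝔞.mart xm θs zs (past m 𝔞.dT s x) r = 𝔞.mart xm θs zs x r :=
  Finset.sum_congr rfl fun j hj => by
    rw [(h.isAdapted_gradNoise xm θs zs j).diag_past h.dT_pos
      ((Finset.mem_range.1 hj).trans_le hrs) x]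

/-- The conditions at `s ≤ n` read the windows up to `s` only, so membership is decided before
window `n + 1` and can be used for stopping. -/
lemma isPastSet_good (h : 𝔞.Regular M) (zs : Fin m → Fin K) (θs : EuclideanSpace ℝ (Fin p))
    (xm : EdgeData m) (𝔭 : Params) (ν : ℝ) (n : ℕ) :
    IsPastSet 𝔞.dT n (𝔞.Good zs θs xm 𝔭 ν n) where
  measurable := by
    have heq : 𝔞.Good zs θs xm 𝔭 ν n = ⋂ s, ⋂ (_ : s ≤ n),
        ((fun x => (𝔞.run x s).θ) ⁻¹' Metric.ball θs 𝔭.δ ∩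
        ((⋂ i, ⋂ k, ⋂ (_ : k ≠ zs i), {x | 𝔞.lev x s i k (zs i) ≤ -(𝔭.γ / 4 * 𝔭.d * s)}) ∩
        {x | |𝔞.mart xm θs zs x s| < ν})) := by
      ext x
      simp [Good]
    rw [heq]
    refine MeasurableSet.iInter fun s => MeasurableSet.iInter fun _ =>
      ((h.measurable_run s).1 Metric.isOpen_ball.measurableSet).inter (MeasurableSet.inter ?_ ?_)
    · refine MeasurableSet.iInter fun i => MeasurableSet.iInter fun k =>
        MeasurableSet.iInter fun _ => measurableSet_le ?_ measurable_const
      exact Finset.measurable_sum _ fun j _ => (h.isAdapted_incr j i k (zs i)).measurable_diag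
    · have : Measurable fun x => 𝔞.mart xm θs zs x s := Finset.measurable_sum _ fun j _ =>
        (h.isAdapted_gradNoise xm θs zs j).measurable_diag.const_mul _
      exact measurableSet_lt this.abs measurable_const
  past x := by
    refine forall₂_congr fun s hs => ?_
    simp only [h.lev_past x hs, h.mart_past xm θs zs x hs,
      𝔞.run_congr (fun r h1 hr e => 𝔞.restrict_past h.dT_pos h1 (hr.trans hs) e) s le_rfl
        (x := past m 𝔞.dT n x) (y := x)]

end Regular

namespace Model

variable {N : ℕ} {zs : Fin m → Fin K} {θs : EuclideanSpace ℝ (Fin p)} {xm : EdgeData m}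
  {μ : Measure (EdgeData m)} {𝔭 : Params} {ν : ℝ}

lemma err_nonneg (n : ℕ) : 0 ≤ 𝔭.err K m n := by
  unfold Params.err
  positivity

lemma err_le_err_one (h : 𝔞.Model N zs θs xm μ 𝔭) {n : ℕ} (hn : 1 ≤ n) :
    𝔭.err K m n ≤ 𝔭.err K m 1 := by
  refine mul_le_mul_of_nonneg_left (Real.exp_le_exp.2 ?_) (by positivity)
  have h1 : (1 : ℝ) ≤ n := by exact_mod_cast hn
  have := mul_pos h.γ_pos h.d_pos
  push_cast
  nlinarith

lemma edgeMass_le (h : 𝔞.Model N zs θs xm μ 𝔭) {n : ℕ} (hn : 1 ≤ n) (hN : n ≤ N)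
    {e : Fin m × Fin m} (he : e ∈ 𝔞.A) : 𝔞.edgeMass xm n e ≤ (𝔭.M + 1) * 𝔞.dT := by
  have := h.intensity n hn hN e he
  rw [edgeMass]
  linarith

lemma one_sub_q_le (h : 𝔞.Model N zs θs xm μ 𝔭) (hε : 𝔭.err K m 1 ≤ 1 / 2) {x : EdgeData m} {n : ℕ}
    (hL : ∀ s ≤ n, ∀ i k, k ≠ zs i → 𝔞.lev x s i k (zs i) ≤ -(𝔭.γ / 4 * 𝔭.d * s)) (hn : 1 ≤ n)
    (i : Fin m) : 1 - (𝔞.run x n).q i (zs i) ≤ 𝔭.err K m n := by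
  have := mul_pos h.γ_pos h.d_pos
  refine 𝔞.one_sub_q_le x h.m_pos h.meanField h.weight_pos h.weight_sum (by linarith)
    h.weight_ratio ?_ hL hn i
  simpa [Params.err] using hε

/-- The drift of the evidence. -/
lemma incr_le (h : 𝔞.Model N zs θs xm μ 𝔭) (hε : 𝔭.err K m 1 ≤ 1 / 2)
    (hε' : 16 * 𝔭.M * ((𝔭.M + 1) * 𝔞.dT) * 𝔭.degHi * 𝔭.err K m 1 ≤ 𝔭.γ)
    {x : EdgeData m} {s : ℕ} (hx : x ∈ 𝔞.Good zs θs xm 𝔭 ν s) (hs : s < N) {i : Fin m} {k : Fin K}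
    (hk : k ≠ zs i) :
    𝔞.incr xm (s + 1) (𝔞.run x s).θ (𝔞.run x s).q i k (zs i) ≤ -(𝔭.γ * 𝔭.d) := by
  -- In the first window the distribution is not concentrated and the initial gap supplies the
  -- drift. Afterwards the gap is `2 γ d`, of which the remaining uncertainty about the memberships
  -- consumes at most half.
  rcases Nat.eq_zero_or_pos s with rfl | hs1
  · exact h.init i k hk
  have hM := h.M_pos
  have hdT := h.reg.dT_pos
  have hq := (𝔞.run_pos x h.m_pos h.meanField h.weight_pos h.weight_sum s).1
  have h1 := h.reg.incr_le_of_concentrated xm (s + 1) (𝔞.run x s).θ hq (err_nonneg s)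
    (h.one_sub_q_le hε (fun r hr => (hx r hr).2.1) hs1) i k
    (fun e he => h.edgeMass_le (by omega) hs he)
  have h2 := h.gap (s + 1) (by omega) hs _ (hx s le_rfl).1 i k hk
  have h3 : 16 * 𝔭.M * ((𝔭.M + 1) * 𝔞.dT) * 𝔭.err K m s * degree 𝔞.A i ≤ 𝔭.γ * 𝔭.d := by
    calc _ ≤ 16 * 𝔭.M * ((𝔭.M + 1) * 𝔞.dT) * 𝔭.err K m 1 * (𝔭.degHi * 𝔭.d) := by
          refine mul_le_mul (mul_le_mul_of_nonneg_left (h.err_le_err_one hs1) (by positivity))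
            (h.degree_le i) (by positivity) ?_
          have := err_nonneg (K := K) (m := m) (𝔭 := 𝔭) 1
          positivity
      _ = (16 * 𝔭.M * ((𝔭.M + 1) * 𝔞.dT) * 𝔭.degHi * 𝔭.err K m 1) * 𝔭.d := by ring
      _ ≤ 𝔭.γ * 𝔭.d := mul_le_mul_of_nonneg_right hε' h.d_pos.le
  linarith

/-- The exponential moments of the evidence. -/
lemma lintegral_exp_incr_le (h : 𝔞.Model N zs θs xm μ 𝔭) (hε : 𝔭.err K m 1 ≤ 1 / 2)
    (hε' : 16 * 𝔭.M * ((𝔭.M + 1) * 𝔞.dT) * 𝔭.degHi * 𝔭.err K m 1 ≤ 𝔭.γ) {α : ℝ} (hα : 0 < α)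
    (hα1 : 2 * 𝔭.M * α ≤ 1) (hα2 : α * (8 * 𝔭.M ^ 3 * 𝔞.dT * 𝔭.degHi) ≤ 𝔭.γ / 2)
    {x : EdgeData m} {s : ℕ} (hx : x ∈ 𝔞.Good zs θs xm 𝔭 ν s) (hs : s < N) {i : Fin m} {k : Fin K}
    (hk : k ≠ zs i) :
    ∫⁻ y, ENNReal.ofReal (Real.exp
        (α * 𝔞.incr y (s + 1) (𝔞.run x s).θ (𝔞.run x s).q i k (zs i))) ∂μ
      ≤ ENNReal.ofReal (Real.exp (-(2 * (α * (𝔭.γ / 4 * 𝔭.d))))) := by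
  have hM := h.M_pos
  have hdT := h.reg.dT_pos
  have hd := h.d_pos
  have hq := (𝔞.run_pos x h.m_pos h.meanField h.weight_pos h.weight_sum s).1
  set θ := (𝔞.run x s).θ
  set q := (𝔞.run x s).q
  let F := 𝔞.incrFun θ q i k (zs i)
  have hF : ∀ e, Measurable fun t => α * F e t := fun e =>
    (h.reg.measurable_incrFun θ q i k (zs i) e).const_mul α
  have hFb : ∀ e t, |α * F e t| ≤ 2 * 𝔭.M * α := fun e t => by
    rw [abs_mul, abs_of_pos hα, mul_comm]
    exact mul_le_mul_of_nonneg_right (h.reg.abs_incrFun_le θ hq i k (zs i) e t) hα.le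
  obtain ⟨hint, hle⟩ := h.data.integral_exp_le (f := fun e t => α * F e t) (by omega) hs hF
    fun e t => (hFb e t).trans hα1
  -- The variance is quadratic in `α` and of the order of a degree, since only the touching pairs
  -- count. A small `α` makes it at most half of the drift, which is linear in `α`.
  have hvar : ∑ e ∈ 𝔞.A, ∫ t in window 𝔞.dT (s + 1), (α * F e t) ^ 2 ∂(xm e).1
      ≤ α * (𝔭.γ / 2 * 𝔭.d) := by
    have h1 := sum_integral_sq_le hF hFb (A' := 𝔞.touching i) (Finset.filter_subset _ _)
      (fun e he hi t => by
        rw [show F e t = 0 from 𝔞.incrFun_eq_zero θ q k (zs i) he hi t, mul_zero])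
      (h.intensity (s + 1) (by omega) hs)
    refine h1.trans ?_
    have h2 : ((𝔞.touching i).card : ℝ) ≤ 2 * (𝔭.degHi * 𝔭.d) := by
      refine le_trans ?_ (mul_le_mul_of_nonneg_left (h.degree_le i) (by norm_num))
      exact_mod_cast 𝔞.card_touching_le i
    calc (2 * 𝔭.M * α) ^ 2 * (𝔭.M * 𝔞.dT) * ((𝔞.touching i).card : ℝ)
        ≤ (2 * 𝔭.M * α) ^ 2 * (𝔭.M * 𝔞.dT) * (2 * (𝔭.degHi * 𝔭.d)) :=
          mul_le_mul_of_nonneg_left h2 (by positivity)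
      _ = α * (α * (8 * 𝔭.M ^ 3 * 𝔞.dT * 𝔭.degHi) * 𝔭.d) := by ring
      _ ≤ α * (𝔭.γ / 2 * 𝔭.d) :=
          mul_le_mul_of_nonneg_left (mul_le_mul_of_nonneg_right hα2 hd.le) hα.le
  have hrw : ∀ y, Real.exp (α * 𝔞.incr y (s + 1) θ q i k (zs i))
      = Real.exp (edgeSum 𝔞.A 𝔞.dT (s + 1) (fun e t => α * F e t) y
        - edgeSum 𝔞.A 𝔞.dT (s + 1) (fun e t => α * F e t) xm)
        * Real.exp (α * 𝔞.incr xm (s + 1) θ q i k (zs i)) := by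
    intro y
    rw [← Real.exp_add, edgeSum_const_mul, edgeSum_const_mul, ← mul_sub,
      ← h.reg.incr_sub_incr y xm (s + 1) θ hq i k (zs i)]
    congr 1
    ring
  rw [lintegral_congr fun y => congrArg ENNReal.ofReal (hrw y),
    ← ofReal_integral_eq_lintegral_ofReal (hint.mul_const _)
    (Eventually.of_forall fun y => by positivity), integral_mul_const]
  refine ENNReal.ofReal_le_ofReal ?_
  calc _ ≤ Real.exp (α * (𝔭.γ / 2 * 𝔭.d)) * Real.exp (-(α * (𝔭.γ * 𝔭.d))) := by
        refine mul_le_mul (hle.trans (Real.exp_le_exp.2 hvar)) (Real.exp_le_exp.2 ?_)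
          (Real.exp_pos _).le (Real.exp_pos _).le
        have := mul_le_mul_of_nonneg_left (h.incr_le hε hε' hx hs hk) hα.le
        linarith
    _ = _ := by
        rw [← Real.exp_add]
        congr 1
        ring

/-- Accumulation of the evidence fails with small probability. -/
lemma measure_lev_gt_le (h : 𝔞.Model N zs θs xm μ 𝔭) (hε : 𝔭.err K m 1 ≤ 1 / 2)
    (hε' : 16 * 𝔭.M * ((𝔭.M + 1) * 𝔞.dT) * 𝔭.degHi * 𝔭.err K m 1 ≤ 𝔭.γ) {α : ℝ} (hα : 0 < α)
    (hα1 : 2 * 𝔭.M * α ≤ 1) (hα2 : α * (8 * 𝔭.M ^ 3 * 𝔞.dT * 𝔭.degHi) ≤ 𝔭.γ / 2)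
    (hα3 : Real.exp (-(α * (𝔭.γ / 4 * 𝔭.d))) ≤ 1 / 2) :
    μ {x | ∃ n ∈ Finset.range N, ∃ i k, k ≠ zs i ∧ x ∈ 𝔞.Good zs θs xm 𝔭 ν n ∧
        -(𝔭.γ / 4 * 𝔭.d * (n + 1 : ℕ)) < 𝔞.lev x (n + 1) i k (zs i)}
      ≤ ENNReal.ofReal (m * K * (2 * Real.exp (-(α * (𝔭.γ / 4 * 𝔭.d))))) := by
  set b := 𝔭.γ / 4 * 𝔭.d
  set r := Real.exp (-(α * b)) with hr
  have hone : ∀ n ∈ Finset.range N, ∀ i k, k ≠ zs i →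
      μ {x | x ∈ 𝔞.Good zs θs xm 𝔭 ν n ∧ -(b * (n + 1 : ℕ)) < 𝔞.lev x (n + 1) i k (zs i)}
        ≤ ENNReal.ofReal (r ^ (n + 1)) := by
    -- The first failure is examined: the run is under control up to `n` and the evidence falls
    -- short at `n + 1`. Its probability decays geometrically in `n`, so the number of windows does
    -- not enter the union bound.
    intro n hn i k hk
    have hn' : n + 1 ≤ N := Finset.mem_range.1 hn
    have h1 := h.data.measure_frozen_sum_gt_le h.reg.dT_pos
      (h.reg.isPastSet_good zs θs xm 𝔭 ν)
      (φ := fun s x y => α * 𝔞.incr y (s + 1) (𝔞.run x s).θ (𝔞.run x s).q i k (zs i))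
      (fun s => ⟨(h.reg.isAdapted_incr s i k (zs i)).measurable.const_mul α,
        fun x y => by rw [(h.reg.isAdapted_incr s i k (zs i)).past x y],
        fun x y => by rw [(h.reg.isAdapted_incr s i k (zs i)).present x y]⟩)
      (fun s hs x hx => h.lintegral_exp_incr_le hε hε' hα hα1 hα2 hx hs hk) hn'
    have h2 : Real.exp (-(α * b * (n + 1 : ℕ))) = r ^ (n + 1) := by
      rw [hr, ← Real.exp_nat_mul]
      congr 1
      ring
    rw [h2] at h1
    refine le_trans (measure_mono ?_) h1
    rintro x ⟨hx1, hx2⟩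
    refine ⟨fun s hs => good_mono (by omega) hx1, ?_⟩
    rw [← Finset.mul_sum]
    change -(α * b * (n + 1 : ℕ)) < α * 𝔞.lev x (n + 1) i k (zs i)
    have := mul_lt_mul_of_pos_left hx2 hα
    linarith
  have hgeom := sum_pow_succ_le (Real.exp_pos (-(α * b))).le hα3 N
  classical
  calc _ ≤ μ (⋃ n ∈ Finset.range N, ⋃ i ∈ (Finset.univ : Finset (Fin m)),
        ⋃ k ∈ Finset.univ.filter fun k => k ≠ zs i,
        {x | x ∈ 𝔞.Good zs θs xm 𝔭 ν n ∧ -(b * (n + 1 : ℕ)) < 𝔞.lev x (n + 1) i k (zs i)}) := by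
        refine measure_mono ?_
        rintro x ⟨n, hn, i, k, hk, hx⟩
        simp only [Set.mem_iUnion]
        exact ⟨n, hn, i, Finset.mem_univ _, k, by simpa using hk, hx⟩
    _ ≤ ∑ n ∈ Finset.range N, ∑ i : Fin m, ∑ k : Fin K, ENNReal.ofReal (r ^ (n + 1)) := by
        refine (measure_biUnion_finset_le _ _).trans (Finset.sum_le_sum fun n hn => ?_)
        refine (measure_biUnion_finset_le _ _).trans (Finset.sum_le_sum fun i _ => ?_)
        refine (measure_biUnion_finset_le _ _).trans ?_
        refine (Finset.sum_le_sum fun k hk => hone n hn i k (Finset.mem_filter.1 hk).2).trans ?_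
        exact Finset.sum_le_sum_of_subset (Finset.filter_subset _ _)
    _ = ENNReal.ofReal (∑ n ∈ Finset.range N, m * K * r ^ (n + 1)) := by
        have hr0 : 0 < r := Real.exp_pos _
        rw [ENNReal.ofReal_sum_of_nonneg fun n _ => by positivity]
        refine Finset.sum_congr rfl fun n _ => ?_
        rw [ENNReal.ofReal_mul (by positivity), ENNReal.ofReal_mul (by positivity)]
        simp [mul_assoc]
    _ ≤ _ := by
        rw [← Finset.mul_sum]
        exact ENNReal.ofReal_le_ofReal (mul_le_mul_of_nonneg_left hgeom (by positivity))

end Model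

end Algorithm

end

end OnlineNet

namespace OnlineNet

noncomputable section

/-! ## Contracting sequences -/

section sequences

variable {D u v : ℕ → ℝ} {a h r ν : ℝ}

/-- Where `D` is at least `r`, the contraction absorbs `h` and the corrected sequence `D - u - v`
does not increase. Where `D` is below `r`, the next corrected value is at most `r + ν + h` whatever
came before. -/
lemma sub_sub_le_max_of_contracting (ha : 0 ≤ a) (hD : ∀ s, 0 ≤ D s) (hr : h ≤ a * r) {n : ℕ}
    (hstep : ∀ s < n, D (s + 1) ≤ D s - a * D s + (u (s + 1) - u s) + (v (s + 1) - v s) + h)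
    (hu0 : u 0 = 0) (hv0 : v 0 = 0) (hu : ∀ s ≤ n, |u s| ≤ ν) (hv : ∀ s ≤ n, 0 ≤ v s) :
    ∀ s ≤ n, D s - u s - v s ≤ max (D 0) (r + ν + h) := by
  intro s
  induction s with
  | zero => simp [hu0, hv0]
  | succ s ih =>
    intro hs
    have h1 := hstep s (by omega)
    rcases le_total r (D s) with hc | hc
    · have := mul_le_mul_of_nonneg_left hc ha
      have := ih (by omega)
      linarith
    · have h2 := abs_le.1 (hu s (by omega))
      have h3 := hv s (by omega)
      have h4 := mul_nonneg ha (hD s)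
      exact le_max_of_le_right (by linarith)

/-- The recursion telescopes when the contraction terms are kept on the left. -/
lemma mul_sum_le_of_contracting (hD : ∀ s, 0 ≤ D s) {n : ℕ}
    (hstep : ∀ s < n, D (s + 1) ≤ D s - a * D s + (u (s + 1) - u s) + (v (s + 1) - v s) + h)
    (hu0 : u 0 = 0) (hv0 : v 0 = 0) :
    a * ∑ s ∈ Finset.range n, D s ≤ D 0 + u n + v n + n * h := by
  have key : ∀ j ≤ n, D j + a * ∑ s ∈ Finset.range j, D s ≤ D 0 + u j + v j + j * h := by
    intro j
    induction j with
    | zero => simp [hu0, hv0]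
    | succ j ih =>
      intro hj
      have h1 := hstep j (by omega)
      have h2 := ih (by omega)
      rw [Finset.sum_range_succ]
      push_cast
      linarith
  have := key n le_rfl
  have := hD n
  linarith

end sequences

/-! ### The squared error of the parameter and the loss of likelihood along a run. -/

namespace Algorithm

variable {p K m : ℕ} {𝔞 : Algorithm p K m}

/-- The normalised mass of window `s + 1`. -/
def rate (𝔞 : Algorithm p K m) (x : EdgeData m) (s : ℕ) : ℝ := 𝔞.mass x (s + 1) / 𝔞.A.card

/-- The disturbance of the squared error by wrong memberships and by large numbers of events. -/
def disturb (𝔞 : Algorithm p K m) (xm : EdgeData m) (𝔭 : Params) (x : EdgeData m) (n : ℕ) : ℝ :=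
  ∑ s ∈ Finset.range n, (8 * 𝔞.η * 𝔭.M * 𝔭.δ * (𝔭.err K m (s + 1) * 𝔞.rate x s)
    + 2 * 𝔞.η ^ 2 * 𝔭.M ^ 2 * (𝔞.rate x s - 𝔞.rate xm s) ^ 2)

namespace Model

variable {N : ℕ} {zs : Fin m → Fin K} {θs : EuclideanSpace ℝ (Fin p)} {xm : EdgeData m}
  {μ : Measure (EdgeData m)} {𝔭 : Params} {ν : ℝ}

lemma card_pos' (h : 𝔞.Model N zs θs xm μ 𝔭) : (0 : ℝ) < 𝔞.A.card := by
  exact_mod_cast h.card_pos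

lemma rate_nonneg (h : 𝔞.Model N zs θs xm μ 𝔭) (x : EdgeData m) (s : ℕ) : 0 ≤ 𝔞.rate x s :=
  div_nonneg (h.reg.mass_nonneg x _) h.card_pos'.le

lemma rate_mean_le (h : 𝔞.Model N zs θs xm μ 𝔭) {s : ℕ} (hs : s < N) :
    𝔞.rate xm s ≤ (𝔭.M + 1) * 𝔞.dT := by
  rw [rate, div_le_iff₀ h.card_pos', mul_comm, ← nsmul_eq_mul]
  exact Finset.sum_le_card_nsmul _ _ _ fun e he => h.edgeMass_le (by omega) hs he

/-- This splits the squared step length into a deterministic part, the additive constant of the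
recursion, and a fluctuation whose mean is of order `1 / |A|`, part of the disturbance. -/
lemma rate_sq_le (h : 𝔞.Model N zs θs xm μ 𝔭) (x : EdgeData m) {s : ℕ} (hs : s < N) :
    𝔞.rate x s ^ 2 ≤ 2 * (𝔞.rate x s - 𝔞.rate xm s) ^ 2 + 2 * ((𝔭.M + 1) * 𝔞.dT) ^ 2 := by
  have h1 := h.rate_mean_le hs
  have h2 := pow_le_pow_left₀ (h.rate_nonneg xm s) h1 2
  nlinarith [sq_nonneg (𝔞.rate x s - 2 * 𝔞.rate xm s)]

lemma isMeanField_run (h : 𝔞.Model N zs θs xm μ 𝔭) (x : EdgeData m) (n : ℕ) :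
    IsMeanField (𝔞.run x n).q :=
  (𝔞.run_pos x h.m_pos h.meanField h.weight_pos h.weight_sum n).1

lemma run_succ_θ (x : EdgeData m) (s : ℕ) :
    (𝔞.run x (s + 1)).θ = (𝔞.run x s).θ + (𝔞.η * (1 / (𝔞.A.card : ℝ))) •
      𝔞.grad x (s + 1) (𝔞.run x s).θ (𝔞.run x (s + 1)).q := rfl

lemma norm_step_le (h : 𝔞.Model N zs θs xm μ 𝔭) (x : EdgeData m) (s : ℕ) :
    ‖(𝔞.η * (1 / (𝔞.A.card : ℝ))) • 𝔞.grad x (s + 1) (𝔞.run x s).θ (𝔞.run x (s + 1)).q‖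
      ≤ 𝔞.η * 𝔭.M * 𝔞.rate x s := by
  have ha := h.card_pos'
  have hη := h.η_pos
  rw [norm_smul, Real.norm_of_nonneg (by positivity)]
  calc _ ≤ 𝔞.η * (1 / (𝔞.A.card : ℝ)) * (𝔭.M * 𝔞.mass x (s + 1)) :=
        mul_le_mul_of_nonneg_left (h.reg.norm_grad_le x _ _ (h.isMeanField_run x _))
          (by positivity)
    _ = _ := by rw [rate]; ring

/-- The recursion for the squared error. -/
lemma sq_error_succ_le (h : 𝔞.Model N zs θs xm μ 𝔭) (hε : 𝔭.err K m 1 ≤ 1 / 2) {x : EdgeData m}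
    {s : ℕ} (hs : s < N) (hx : x ∈ 𝔞.Good zs θs xm 𝔭 ν s)
    (hlev : ∀ i k, k ≠ zs i → 𝔞.lev x (s + 1) i k (zs i) ≤ -(𝔭.γ / 4 * 𝔭.d * (s + 1 : ℕ))) :
    ‖(𝔞.run x (s + 1)).θ - θs‖ ^ 2 ≤ ‖(𝔞.run x s).θ - θs‖ ^ 2
      - 2 * 𝔞.η * 𝔭.curv * ‖(𝔞.run x s).θ - θs‖ ^ 2
      + (𝔞.mart xm θs zs x (s + 1) - 𝔞.mart xm θs zs x s)
      + (𝔞.disturb xm 𝔭 x (s + 1) - 𝔞.disturb xm 𝔭 x s)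
      + 2 * 𝔞.η ^ 2 * 𝔭.M ^ 2 * ((𝔭.M + 1) * 𝔞.dT) ^ 2 := by
  have ha := h.card_pos'
  have hη := h.η_pos
  have hM := h.M_pos
  have hball := (hx s le_rfl).1
  set u := (𝔞.run x s).θ - θs with hu
  set q := (𝔞.run x (s + 1)).q with hq
  set g := 𝔞.grad x (s + 1) (𝔞.run x s).θ q with hg
  have hun : ‖u‖ ≤ 𝔭.δ := by
    rw [hu, ← dist_eq_norm]
    exact (Metric.mem_ball.1 hball).le
  -- The gradient step uses the distribution already updated with window `s + 1`, hence the separate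
  -- assumption on the evidence at `s + 1`, beyond membership in `Good` at `s`.
  have hconc : ∀ j, 1 - q j (zs j) ≤ 𝔭.err K m (s + 1) := fun j => by
    refine h.one_sub_q_le hε (fun r hr => ?_) (by omega) j
    rcases Nat.lt_or_ge r (s + 1) with hr' | hr'
    · exact (hx r (by omega)).2.1
    · obtain rfl : r = s + 1 := le_antisymm hr hr'
      exact hlev
  have hmart : 𝔞.mart xm θs zs x (s + 1) - 𝔞.mart xm θs zs x s
      = 2 * (𝔞.η * (1 / (𝔞.A.card : ℝ))) * 𝔞.gradNoise xm θs zs s x x := by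
    rw [mart, Finset.sum_range_succ, ← mart, add_sub_cancel_left]
  have hdist : 𝔞.disturb xm 𝔭 x (s + 1) - 𝔞.disturb xm 𝔭 x s
      = 8 * 𝔞.η * 𝔭.M * 𝔭.δ * (𝔭.err K m (s + 1) * 𝔞.rate x s)
        + 2 * 𝔞.η ^ 2 * 𝔭.M ^ 2 * (𝔞.rate x s - 𝔞.rate xm s) ^ 2 := by
    rw [disturb, Finset.sum_range_succ, ← disturb, add_sub_cancel_left]
  have hstep := h.norm_step_le x s
  rw [← hq, ← hg] at hstep
  have hsq : ‖(𝔞.η * (1 / (𝔞.A.card : ℝ))) • g‖ ^ 2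
      ≤ 𝔞.η ^ 2 * 𝔭.M ^ 2 * (2 * (𝔞.rate x s - 𝔞.rate xm s) ^ 2 + 2 * ((𝔭.M + 1) * 𝔞.dT) ^ 2) := by
    calc _ ≤ (𝔞.η * 𝔭.M * 𝔞.rate x s) ^ 2 := pow_le_pow_left₀ (norm_nonneg _) hstep 2
      _ = 𝔞.η ^ 2 * 𝔭.M ^ 2 * 𝔞.rate x s ^ 2 := by ring
      _ ≤ _ := mul_le_mul_of_nonneg_left (h.rate_sq_le x hs) (by positivity)
  have herr := err_nonneg (K := K) (m := m) (𝔭 := 𝔭) (s + 1)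
  -- The gradient is compared with its value at the point mass. There it splits into centred noise,
  -- with a parameter fixed by the past, and a mean that points towards `θs`.
  have hinner : inner ℝ g u ≤ 𝔞.gradNoise xm θs zs s x x - 𝔭.curv * 𝔞.A.card * ‖u‖ ^ 2
      + 4 * 𝔭.M * 𝔭.δ * 𝔭.err K m (s + 1) * 𝔞.mass x (s + 1) := by
    have h1 := (abs_le.1 (h.reg.abs_inner_grad_sub_le x (s + 1) (𝔞.run x s).θ
      (h.isMeanField_run x (s + 1)) hconc u)).2
    have h2 := h.gradient (s + 1) (by omega) hs _ hball
    have h3 : 4 * 𝔭.M * ‖u‖ * 𝔭.err K m (s + 1) * 𝔞.mass x (s + 1)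
        ≤ 4 * 𝔭.M * 𝔭.δ * 𝔭.err K m (s + 1) * 𝔞.mass x (s + 1) := by
      have := h.reg.mass_nonneg x (s + 1)
      gcongr
    rw [gradNoise, ← hu]
    rw [← hu] at h2
    linarith
  have hexp : (𝔞.run x (s + 1)).θ - θs = u + (𝔞.η * (1 / (𝔞.A.card : ℝ))) • g := by
    rw [run_succ_θ, hu]
    abel
  rw [hexp, norm_add_sq_real, inner_smul_right, real_inner_comm, hmart, hdist]
  have hin := mul_le_mul_of_nonneg_left hinner
    (by positivity : 0 ≤ 2 * (𝔞.η * (1 / (𝔞.A.card : ℝ))))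
  have hcalc : 2 * (𝔞.η * (1 / (𝔞.A.card : ℝ))) * (𝔞.gradNoise xm θs zs s x x
      - 𝔭.curv * 𝔞.A.card * ‖u‖ ^ 2 + 4 * 𝔭.M * 𝔭.δ * 𝔭.err K m (s + 1) * 𝔞.mass x (s + 1))
      = 2 * (𝔞.η * (1 / (𝔞.A.card : ℝ))) * 𝔞.gradNoise xm θs zs s x x
        - 2 * 𝔞.η * 𝔭.curv * ‖u‖ ^ 2
        + 8 * 𝔞.η * 𝔭.M * 𝔭.δ * (𝔭.err K m (s + 1) * 𝔞.rate x s) := by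
    rw [rate]
    field_simp
    ring
  linarith

lemma disturb_nonneg (h : 𝔞.Model N zs θs xm μ 𝔭) (x : EdgeData m) (n : ℕ) :
    0 ≤ 𝔞.disturb xm 𝔭 x n := by
  refine Finset.sum_nonneg fun s _ => ?_
  have h1 := err_nonneg (K := K) (m := m) (𝔭 := 𝔭) (s + 1)
  have h2 := h.rate_nonneg x s
  have h3 := h.η_pos
  have h4 := h.M_pos
  have h5 := h.δ_pos
  positivity

lemma disturb_mono (h : 𝔞.Model N zs θs xm μ 𝔭) (x : EdgeData m) {n n' : ℕ} (hn : n ≤ n') :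
    𝔞.disturb xm 𝔭 x n ≤ 𝔞.disturb xm 𝔭 x n' := by
  refine Finset.sum_le_sum_of_subset_of_nonneg (Finset.range_mono hn) fun s _ _ => ?_
  have h1 := err_nonneg (K := K) (m := m) (𝔭 := 𝔭) (s + 1)
  have h2 := h.rate_nonneg x s
  have h3 := h.η_pos
  have h4 := h.M_pos
  have h5 := h.δ_pos
  positivity

open Classical in
/-- The run stays under control when none of the unlikely events happens. -/
lemma mem_good (h : 𝔞.Model N zs θs xm μ 𝔭) (hε : 𝔭.err K m 1 ≤ 1 / 2)
    (hθ0 : ‖𝔞.θ0 - θs‖ ≤ 𝔭.δ / 2)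
    (hη1 : 2 * 𝔞.η ^ 2 * 𝔭.M ^ 2 * ((𝔭.M + 1) * 𝔞.dT) ^ 2 ≤ 𝔭.δ ^ 2 / 16)
    (hη2 : 𝔞.η * 𝔭.M ^ 2 * ((𝔭.M + 1) * 𝔞.dT) ^ 2 ≤ 𝔭.curv * (𝔭.δ ^ 2 / 16)) {x : EdgeData m}
    (hlev : ∀ n < N, x ∈ 𝔞.Good zs θs xm 𝔭 (𝔭.δ ^ 2 / 8) n → ∀ i k, k ≠ zs i →
      𝔞.lev x (n + 1) i k (zs i) ≤ -(𝔭.γ / 4 * 𝔭.d * (n + 1 : ℕ)))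
    (hmart : |∑ s ∈ Finset.range N, if x ∈ 𝔞.Good zs θs xm 𝔭 (𝔭.δ ^ 2 / 8) s then
      𝔞.gradNoise xm θs zs s x x else 0| < 𝔭.δ ^ 2 / 8 * 𝔞.A.card / (2 * 𝔞.η))
    (hdist : 𝔞.disturb xm 𝔭 x N ≤ 𝔭.δ ^ 2 / 8) :
    ∀ n ≤ N, x ∈ 𝔞.Good zs θs xm 𝔭 (𝔭.δ ^ 2 / 8) n := by
  have hδ := h.δ_pos
  have hη := h.η_pos
  have ha := h.card_pos'
  have hκ := h.curv_pos
  intro n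
  induction n with
  | zero =>
    intro _ s hs
    obtain rfl : s = 0 := by omega
    refine ⟨?_, fun i k _ => by simp [lev], ?_⟩
    · rw [Metric.mem_ball, dist_eq_norm]
      exact hθ0.trans_lt (by linarith)
    · simp only [mart, Finset.range_zero, Finset.sum_empty, abs_zero]
      positivity
  | succ n ih =>
    intro hn
    have hx := ih (by omega)
    have hl := hlev n (by omega) hx
    have hm : |𝔞.mart xm θs zs x (n + 1)| < 𝔭.δ ^ 2 / 8 := by
      by_contra hcon
      -- If the noise were too large at `n + 1`, then `Good` would fail from `n + 1` on, and the
      -- stopped sum over all windows would coincide with the sum over the first `n + 1`, which the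
      -- assumption bounds.
      have hsum : (∑ s ∈ Finset.range N, if x ∈ 𝔞.Good zs θs xm 𝔭 (𝔭.δ ^ 2 / 8) s then
          𝔞.gradNoise xm θs zs s x x else 0)
          = ∑ s ∈ Finset.range (n + 1), 𝔞.gradNoise xm θs zs s x x := by
        rw [← Finset.sum_subset (Finset.range_mono hn) fun s _ hs => ?_]
        · exact Finset.sum_congr rfl fun s hs =>
            if_pos (good_mono (Nat.le_of_lt_succ (Finset.mem_range.1 hs)) hx)
        · refine if_neg fun hg => hcon (hg (n + 1) ?_).2.2
          simpa using hs
      rw [hsum, lt_div_iff₀ (by positivity)] at hmart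
      apply hcon
      rw [mart, ← Finset.mul_sum, abs_mul, abs_of_pos (by positivity)]
      have : 2 * (𝔞.η * (1 / (𝔞.A.card : ℝ)))
          * |∑ s ∈ Finset.range (n + 1), 𝔞.gradNoise xm θs zs s x x|
          = (|∑ s ∈ Finset.range (n + 1), 𝔞.gradNoise xm θs zs s x x| * (2 * 𝔞.η))
            / 𝔞.A.card := by
        field_simp
      rw [this, div_lt_iff₀ ha]
      exact hmart
    have hball : (𝔞.run x (n + 1)).θ ∈ Metric.ball θs 𝔭.δ := by
      -- The budget: both entries of the maximum are at most `δ ^ 2 / 4`, and noise and disturbance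
      -- add `δ ^ 2 / 8` each, in total at most half of `δ ^ 2`.
      have key := sub_sub_le_max_of_contracting (D := fun s => ‖(𝔞.run x s).θ - θs‖ ^ 2)
        (u := 𝔞.mart xm θs zs x) (v := 𝔞.disturb xm 𝔭 x) (a := 2 * 𝔞.η * 𝔭.curv)
        (h := 2 * 𝔞.η ^ 2 * 𝔭.M ^ 2 * ((𝔭.M + 1) * 𝔞.dT) ^ 2) (r := 𝔭.δ ^ 2 / 16)
        (ν := 𝔭.δ ^ 2 / 8) (by positivity) (fun s => by positivity)
        (by
          have := mul_le_mul_of_nonneg_left hη2 (by positivity : 0 ≤ 2 * 𝔞.η)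
          linarith) (n := n + 1)
        (fun s hs => h.sq_error_succ_le hε (by omega) (good_mono (by omega) hx)
          (hlev s (by omega) (good_mono (by omega) hx)))
        (by simp [mart]) (by simp [disturb])
        (fun s hs => by
          rcases Nat.lt_or_ge s (n + 1) with hs' | hs'
          · exact (hx s (by omega)).2.2.le
          · obtain rfl : s = n + 1 := le_antisymm hs hs'
            exact hm.le)
        (fun s _ => h.disturb_nonneg x s) (n + 1) le_rfl
      have h0 : ‖(𝔞.run x 0).θ - θs‖ ^ 2 ≤ 𝔭.δ ^ 2 / 4 := by
        calc _ ≤ (𝔭.δ / 2) ^ 2 := pow_le_pow_left₀ (norm_nonneg _) hθ0 2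
          _ = _ := by ring
      have h1 : max (‖(𝔞.run x 0).θ - θs‖ ^ 2) (𝔭.δ ^ 2 / 16 + 𝔭.δ ^ 2 / 8
          + 2 * 𝔞.η ^ 2 * 𝔭.M ^ 2 * ((𝔭.M + 1) * 𝔞.dT) ^ 2) ≤ 𝔭.δ ^ 2 / 4 :=
        max_le h0 (by linarith)
      have h2 := (abs_lt.1 hm).2
      have h3 := (h.disturb_mono x hn).trans hdist
      have h4 : ‖(𝔞.run x (n + 1)).θ - θs‖ ^ 2 < 𝔭.δ ^ 2 := by
        have := key.trans h1
        have hp : 0 < 𝔭.δ ^ 2 := by positivity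
        linarith
      rw [Metric.mem_ball, dist_eq_norm]
      exact lt_of_pow_lt_pow_left₀ 2 hδ.le h4
    intro s hs
    rcases Nat.lt_or_ge s (n + 1) with hs' | hs'
    · exact hx s (by omega)
    · obtain rfl : s = n + 1 := le_antisymm hs hs'
      exact ⟨hball, hl, hm⟩

/-- The loss of likelihood along a run under control. -/
lemma sum_LL_sub_le (h : 𝔞.Model N zs θs xm μ 𝔭) (hε : 𝔭.err K m 1 ≤ 1 / 2)
    (hθ0 : ‖𝔞.θ0 - θs‖ ≤ 𝔭.δ / 2) {x : EdgeData m} {V : ℝ}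
    (hx : ∀ n ≤ N, x ∈ 𝔞.Good zs θs xm 𝔭 (𝔭.δ ^ 2 / 8) n)
    (hdist : 𝔞.disturb xm 𝔭 x N ≤ 𝔭.δ ^ 2 / 8)
    (hsq : ∑ s ∈ Finset.range N, (𝔞.rate x s - 𝔞.rate xm s) ^ 2 ≤ V)
    (hnoise : ∑ s ∈ Finset.range N, 𝔞.llNoise xm θs zs s x x ≤ √N * 𝔞.A.card) :
    (∑ s ∈ Finset.range N, (𝔞.LL x (s + 1) θs zs - 𝔞.LL x (s + 1) (𝔞.run x (s + 1)).θ zs))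
        / 𝔞.A.card
      ≤ √N + 𝔭.kl * ((𝔭.δ ^ 2 + N * (2 * 𝔞.η ^ 2 * 𝔭.M ^ 2 * ((𝔭.M + 1) * 𝔞.dT) ^ 2))
          / (2 * 𝔞.η * 𝔭.curv))
        + 𝔞.η * 𝔭.M ^ 2 * (2 * V + N * (2 * ((𝔭.M + 1) * 𝔞.dT) ^ 2)) := by
  have hδ := h.δ_pos
  have hη := h.η_pos
  have ha := h.card_pos'
  have hκ := h.curv_pos
  have hM := h.M_pos
  have hD : ∑ s ∈ Finset.range N, ‖(𝔞.run x s).θ - θs‖ ^ 2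
      ≤ (𝔭.δ ^ 2 + N * (2 * 𝔞.η ^ 2 * 𝔭.M ^ 2 * ((𝔭.M + 1) * 𝔞.dT) ^ 2))
          / (2 * 𝔞.η * 𝔭.curv) := by
    rw [le_div_iff₀ (by positivity), mul_comm]
    have key := mul_sum_le_of_contracting (D := fun s => ‖(𝔞.run x s).θ - θs‖ ^ 2)
        (u := 𝔞.mart xm θs zs x) (v := 𝔞.disturb xm 𝔭 x) (a := 2 * 𝔞.η * 𝔭.curv)
        (h := 2 * 𝔞.η ^ 2 * 𝔭.M ^ 2 * ((𝔭.M + 1) * 𝔞.dT) ^ 2) (fun s => by positivity) (n := N)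
        (fun s hs => h.sq_error_succ_le hε hs (hx s hs.le) (hx (s + 1) hs (s + 1) le_rfl).2.1)
        (by simp [mart]) (by simp [disturb])
    have h0 : ‖(𝔞.run x 0).θ - θs‖ ^ 2 ≤ 𝔭.δ ^ 2 / 4 := by
      calc _ ≤ (𝔭.δ / 2) ^ 2 := pow_le_pow_left₀ (norm_nonneg _) hθ0 2
        _ = _ := by ring
    have h1 := (abs_lt.1 (hx N le_rfl N le_rfl).2.2).2
    have hp : 0 < 𝔭.δ ^ 2 := by positivity
    linarith
  have hY : ∑ s ∈ Finset.range N, 𝔞.rate x s ^ 2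
      ≤ 2 * V + N * (2 * ((𝔭.M + 1) * 𝔞.dT) ^ 2) := by
    calc _ ≤ ∑ s ∈ Finset.range N,
          (2 * (𝔞.rate x s - 𝔞.rate xm s) ^ 2 + 2 * ((𝔭.M + 1) * 𝔞.dT) ^ 2) :=
          Finset.sum_le_sum fun s hs => h.rate_sq_le x (Finset.mem_range.1 hs)
      _ = 2 * (∑ s ∈ Finset.range N, (𝔞.rate x s - 𝔞.rate xm s) ^ 2)
          + N * (2 * ((𝔭.M + 1) * 𝔞.dT) ^ 2) := by
          rw [Finset.sum_add_distrib, ← Finset.mul_sum]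
          simp
      _ ≤ _ := by linarith
  -- The regret evaluates the parameter after the window has been used, which is not independent of
  -- that window. The parameter before it is substituted, at the price of the Lipschitz constant
  -- times one gradient step.
  have hterm : ∀ s ∈ Finset.range N,
      𝔞.LL x (s + 1) θs zs - 𝔞.LL x (s + 1) (𝔞.run x (s + 1)).θ zs
        ≤ 𝔞.llNoise xm θs zs s x x + 𝔞.A.card * 𝔭.kl * ‖(𝔞.run x s).θ - θs‖ ^ 2
          + 𝔞.A.card * (𝔞.η * 𝔭.M ^ 2) * 𝔞.rate x s ^ 2 := by
    intro s hs
    have hs' : s < N := Finset.mem_range.1 hs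
    have hb := (hx s hs'.le s le_rfl).1
    have hb' := (hx (s + 1) hs' (s + 1) le_rfl).1
    have h1 := h.likelihood (s + 1) (by omega) hs' _ hb
    have h2 := (abs_le.1 (h.reg.abs_LL_sub_le (convex_ball θs 𝔭.δ) h.ball_subset hb hb' x
      (n := s + 1) (by omega) zs)).2
    have h3 : ‖(𝔞.run x s).θ - (𝔞.run x (s + 1)).θ‖ ≤ 𝔞.η * 𝔭.M * 𝔞.rate x s := by
      rw [norm_sub_rev, run_succ_θ, add_sub_cancel_left]
      exact h.norm_step_le x s
    have h4 : 𝔭.M * ‖(𝔞.run x s).θ - (𝔞.run x (s + 1)).θ‖ * 𝔞.mass x (s + 1)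
        ≤ 𝔞.A.card * (𝔞.η * 𝔭.M ^ 2) * 𝔞.rate x s ^ 2 := by
      calc _ ≤ 𝔭.M * (𝔞.η * 𝔭.M * 𝔞.rate x s) * 𝔞.mass x (s + 1) :=
            mul_le_mul_of_nonneg_right (mul_le_mul_of_nonneg_left h3 hM.le)
              (h.reg.mass_nonneg x _)
        _ = _ := by
            rw [rate]
            field_simp
    rw [llNoise]
    linarith
  rw [div_le_iff₀ ha]
  calc _ ≤ ∑ s ∈ Finset.range N, (𝔞.llNoise xm θs zs s x x
          + 𝔞.A.card * 𝔭.kl * ‖(𝔞.run x s).θ - θs‖ ^ 2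
          + 𝔞.A.card * (𝔞.η * 𝔭.M ^ 2) * 𝔞.rate x s ^ 2) := Finset.sum_le_sum hterm
    _ = (∑ s ∈ Finset.range N, 𝔞.llNoise xm θs zs s x x)
        + 𝔞.A.card * (𝔭.kl * ∑ s ∈ Finset.range N, ‖(𝔞.run x s).θ - θs‖ ^ 2)
        + 𝔞.A.card * (𝔞.η * 𝔭.M ^ 2 * ∑ s ∈ Finset.range N, 𝔞.rate x s ^ 2) := by
        rw [Finset.sum_add_distrib, Finset.sum_add_distrib, ← Finset.mul_sum, ← Finset.mul_sum]
        ring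
    _ ≤ √N * 𝔞.A.card + 𝔞.A.card * (𝔭.kl * ((𝔭.δ ^ 2
          + N * (2 * 𝔞.η ^ 2 * 𝔭.M ^ 2 * ((𝔭.M + 1) * 𝔞.dT) ^ 2)) / (2 * 𝔞.η * 𝔭.curv)))
        + 𝔞.A.card * (𝔞.η * 𝔭.M ^ 2 * (2 * V + N * (2 * ((𝔭.M + 1) * 𝔞.dT) ^ 2))) := by
        refine add_le_add (add_le_add hnoise ?_) ?_
        · exact mul_le_mul_of_nonneg_left (mul_le_mul_of_nonneg_left hD h.kl_nonneg) ha.le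
        · exact mul_le_mul_of_nonneg_left (mul_le_mul_of_nonneg_left hY (by positivity)) ha.le
    _ = _ := by ring

end Model

end Algorithm

end

end OnlineNet

/-! ### Probabilities of the exceptional events. -/

namespace OnlineNet

noncomputable section

namespace Algorithm

variable {p K m : ℕ} {𝔞 : Algorithm p K m}

namespace Model

variable {N : ℕ} {zs : Fin m → Fin K} {θs : EuclideanSpace ℝ (Fin p)} {xm : EdgeData m}
  {μ : Measure (EdgeData m)} {𝔭 : Params} {ν : ℝ}

lemma intensity_nonneg (h : 𝔞.Model N zs θs xm μ 𝔭) : 0 ≤ 𝔭.M * 𝔞.dT :=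
  mul_nonneg h.M_pos.le h.reg.dT_pos.le

-- On `Good` the parameter lies within `δ` of `θs`, so the integrand is bounded by `M * δ`; stopping
-- is what makes this variance bound available.
open Classical in
lemma measure_gradNoise_ge_le (h : 𝔞.Model N zs θs xm μ 𝔭) {r : ℝ} (hr : 0 < r) :
    μ {x | r ≤ |∑ s ∈ Finset.range N, if x ∈ 𝔞.Good zs θs xm 𝔭 ν s then
        𝔞.gradNoise xm θs zs s x x else 0|}
      ≤ ENNReal.ofReal (N * (4 * Real.exp (𝔭.M * 𝔞.dT) * (𝔭.M * 𝔭.δ) ^ 2 * 𝔞.A.card) / r ^ 2) := by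
  have hG := h.reg.isPastSet_good zs θs xm 𝔭 ν
  have had := h.reg.isAdapted_gradNoise xm θs zs
  refine measure_sq_ge_le (Finset.measurable_sum _ fun s _ =>
    ((had s).ite (hG s) 0).measurable_diag) (h.data.lintegral_sq_frozen_le h.reg.dT_pos
      h.intensity h.intensity_nonneg h.card_pos hG had (mul_pos h.M_pos h.δ_pos) ?_) hr
  intro s _ x hx
  refine ⟨fun e t => inner ℝ (𝔞.glogE (zs e.1) (zs e.2) (𝔞.run x s).θ t) ((𝔞.run x s).θ - θs),
    fun e => ?_, fun e t => ?_, fun y => ?_⟩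
  · exact ((h.reg.stronglyMeasurable_glogE_right _ _ _).inner
      stronglyMeasurable_const).measurable
  · have h1 := (Metric.mem_ball.1 (hx s le_rfl).1).le
    rw [dist_eq_norm] at h1
    exact (abs_real_inner_le_norm _ _).trans (mul_le_mul (h.reg.norm_glogE_le _ _ _ t) h1
      (norm_nonneg _) h.M_pos.le)
  · exact h.reg.inner_grad_sub_inner_grad y xm (s + 1) _ _ zs

open Classical in
lemma measure_llNoise_ge_le (h : 𝔞.Model N zs θs xm μ 𝔭) {r : ℝ} (hr : 0 < r) :
    μ {x | r ≤ |∑ s ∈ Finset.range N, if x ∈ 𝔞.Good zs θs xm 𝔭 ν s then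
        𝔞.llNoise xm θs zs s x x else 0|}
      ≤ ENNReal.ofReal (N * (4 * Real.exp (𝔭.M * 𝔞.dT) * (2 * 𝔭.M) ^ 2 * 𝔞.A.card) / r ^ 2) := by
  have hG := h.reg.isPastSet_good zs θs xm 𝔭 ν
  have had := h.reg.isAdapted_llNoise xm θs zs
  refine measure_sq_ge_le (Finset.measurable_sum _ fun s _ =>
    ((had s).ite (hG s) 0).measurable_diag) (h.data.lintegral_sq_frozen_le h.reg.dT_pos
      h.intensity h.intensity_nonneg h.card_pos hG had (by linarith [h.M_pos] : 0 < 2 * 𝔭.M) ?_) hr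
  intro s _ x _
  refine ⟨fun e t => 𝔞.logE (zs e.1) (zs e.2) θs t - 𝔞.logE (zs e.1) (zs e.2) (𝔞.run x s).θ t,
    fun e => ?_, fun e t => ?_, fun y => ?_⟩
  · exact (h.reg.measurable_logE _ _ _).sub (h.reg.measurable_logE _ _ _)
  · have h1 := h.reg.norm_logE_le (zs e.1) (zs e.2) θs t
    have h2 := h.reg.norm_logE_le (zs e.1) (zs e.2) (𝔞.run x s).θ t
    rw [Real.norm_eq_abs] at h1 h2
    exact (abs_sub _ _).trans (by linarith)
  · exact h.reg.LL_sub_LL y xm (s + 1) _ _ zs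

lemma rate_sub_rate (x : EdgeData m) (s : ℕ) :
    𝔞.rate x s - 𝔞.rate xm s = (edgeSum 𝔞.A 𝔞.dT (s + 1) (fun _ _ => 1) x
      - edgeSum 𝔞.A 𝔞.dT (s + 1) (fun _ _ => 1) xm) / 𝔞.A.card := by
  rw [rate, rate, ← sub_div, Regular.mass_sub_mass]

lemma rate_moments (h : 𝔞.Model N zs θs xm μ 𝔭) {s : ℕ} (hs : s < N) :
    (Integrable (fun x => 𝔞.rate x s) μ ∧ ∫ x, 𝔞.rate x s ∂μ ≤ (𝔭.M + 1) * 𝔞.dT) ∧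
    Integrable (fun x => (𝔞.rate x s - 𝔞.rate xm s) ^ 2) μ ∧
    ∫ x, (𝔞.rate x s - 𝔞.rate xm s) ^ 2 ∂μ ≤ 4 * Real.exp (𝔭.M * 𝔞.dT) / 𝔞.A.card := by
  have := h.data.isProb
  have ha := h.card_pos'
  obtain ⟨h1, h2, h3⟩ := h.data.centred_moments (f := fun _ _ => 1) (b := 1) (n := s + 1)
    (by omega) hs (fun _ => measurable_const) (fun _ _ => by simp) one_pos
    (h.intensity _ (by omega) hs) h.intensity_nonneg h.card_pos
  have hrate : ∀ x, 𝔞.rate x s = (edgeSum 𝔞.A 𝔞.dT (s + 1) (fun _ _ => 1) x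
      - edgeSum 𝔞.A 𝔞.dT (s + 1) (fun _ _ => 1) xm) / 𝔞.A.card + 𝔞.rate xm s := fun x => by
    rw [← rate_sub_rate]
    ring
  have hi := h1.integrable one_le_two
  have hfun := funext hrate
  have hsq : (fun x => (𝔞.rate x s - 𝔞.rate xm s) ^ 2)
      = fun x => (edgeSum 𝔞.A 𝔞.dT (s + 1) (fun _ _ => 1) x
        - edgeSum 𝔞.A 𝔞.dT (s + 1) (fun _ _ => 1) xm) ^ 2 / (𝔞.A.card : ℝ) ^ 2 :=
    funext fun x => by rw [rate_sub_rate, div_pow]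
  refine ⟨⟨?_, ?_⟩, ?_, ?_⟩
  · rw [hfun]
    exact (hi.div_const _).add (integrable_const _)
  · rw [hfun, integral_add (hi.div_const _) (integrable_const _), integral_div, h2]
    simpa using h.rate_mean_le hs
  · rw [hsq]
    exact h1.integrable_sq.div_const _
  · rw [hsq]
    clear hrate hfun hsq
    rw [integral_div, div_le_iff₀ (by positivity)]
    refine h3.trans (le_of_eq ?_)
    field_simp

lemma err_succ (n : ℕ) : 𝔭.err K m (n + 1)
    = K * max 𝔭.W (2 * m) * Real.exp (-(𝔭.γ / 4 * 𝔭.d)) ^ (n + 1) := by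
  rw [Params.err, ← Real.exp_nat_mul]
  congr 2
  ring

/-- The bounds decay geometrically in the number of the window, so the first window dominates and
the sum does not depend on the horizon. -/
lemma sum_err_le (hr : Real.exp (-(𝔭.γ / 4 * 𝔭.d)) ≤ 1 / 2) (N : ℕ) :
    ∑ s ∈ Finset.range N, 𝔭.err K m (s + 1) ≤ 2 * 𝔭.err K m 1 := by
  have h1 : 𝔭.err K m 1 = K * max 𝔭.W (2 * m) * Real.exp (-(𝔭.γ / 4 * 𝔭.d)) := by
    simpa using err_succ (K := K) (m := m) (𝔭 := 𝔭) 0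
  rw [h1, Finset.sum_congr rfl fun s _ => err_succ s, ← Finset.mul_sum]
  have := mul_le_mul_of_nonneg_left (sum_pow_succ_le (Real.exp_pos _).le hr N)
    (by positivity : (0 : ℝ) ≤ K * max 𝔭.W (2 * m))
  linarith

lemma measure_sum_err_rate_ge_le (h : 𝔞.Model N zs θs xm μ 𝔭)
    (hr : Real.exp (-(𝔭.γ / 4 * 𝔭.d)) ≤ 1 / 2) {r : ℝ} (hr0 : 0 < r) :
    μ {x | r ≤ ∑ s ∈ Finset.range N, 𝔭.err K m (s + 1) * 𝔞.rate x s}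
      ≤ ENNReal.ofReal (2 * 𝔭.err K m 1 * ((𝔭.M + 1) * 𝔞.dT) / r) := by
  have hM := h.M_pos
  have hdT := h.reg.dT_pos
  have hi : ∀ s ∈ Finset.range N, Integrable (fun x => 𝔭.err K m (s + 1) * 𝔞.rate x s) μ :=
    fun s hs => (h.rate_moments (Finset.mem_range.1 hs)).1.1.const_mul _
  refine measure_ge_le_of_integral_le (fun x => Finset.sum_nonneg fun s _ =>
    mul_nonneg (err_nonneg _) (h.rate_nonneg x s)) (integrable_finsetSum _ hi) ?_ hr0
  rw [integral_finsetSum _ hi]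
  calc _ ≤ ∑ s ∈ Finset.range N, 𝔭.err K m (s + 1) * ((𝔭.M + 1) * 𝔞.dT) := by
        refine Finset.sum_le_sum fun s hs => ?_
        rw [integral_const_mul]
        exact mul_le_mul_of_nonneg_left (h.rate_moments (Finset.mem_range.1 hs)).1.2 (err_nonneg _)
    _ ≤ _ := by
        rw [← Finset.sum_mul]
        exact mul_le_mul_of_nonneg_right (sum_err_le hr N) (by positivity)

lemma measure_sum_rate_sq_ge_le (h : 𝔞.Model N zs θs xm μ 𝔭) {r : ℝ} (hr0 : 0 < r) :
    μ {x | r ≤ ∑ s ∈ Finset.range N, (𝔞.rate x s - 𝔞.rate xm s) ^ 2}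
      ≤ ENNReal.ofReal (N * (4 * Real.exp (𝔭.M * 𝔞.dT) / 𝔞.A.card) / r) := by
  refine measure_ge_le_of_integral_le (fun x => Finset.sum_nonneg fun s _ => sq_nonneg _)
    (integrable_finsetSum _ fun s hs => (h.rate_moments (Finset.mem_range.1 hs)).2.1) ?_ hr0
  rw [integral_finsetSum _ fun s hs => (h.rate_moments (Finset.mem_range.1 hs)).2.1]
  calc _ ≤ ∑ s ∈ Finset.range N, 4 * Real.exp (𝔭.M * 𝔞.dT) / 𝔞.A.card :=
        Finset.sum_le_sum fun s hs => (h.rate_moments (Finset.mem_range.1 hs)).2.2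
    _ = _ := by simp

/-- The bound for the loss of likelihood. -/
def lossBound (𝔭 : Params) (dT η N : ℝ) : ℝ :=
  √N + 𝔭.kl * ((𝔭.δ ^ 2 + N * (2 * η ^ 2 * 𝔭.M ^ 2 * ((𝔭.M + 1) * dT) ^ 2))
      / (2 * η * 𝔭.curv))
    + η * 𝔭.M ^ 2 * (2 * (𝔭.δ ^ 2 / (32 * η ^ 2 * 𝔭.M ^ 2)) + N * (2 * ((𝔭.M + 1) * dT) ^ 2))

/-- With high probability, the parameter stays in the ball and the loss of likelihood is small. -/
theorem measure_bad_le (h : 𝔞.Model N zs θs xm μ 𝔭) (hN : 1 ≤ N) (hε : 𝔭.err K m 1 ≤ 1 / 2)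
    (hε' : 16 * 𝔭.M * ((𝔭.M + 1) * 𝔞.dT) * 𝔭.degHi * 𝔭.err K m 1 ≤ 𝔭.γ) {α : ℝ} (hα : 0 < α)
    (hα1 : 2 * 𝔭.M * α ≤ 1) (hα2 : α * (8 * 𝔭.M ^ 3 * 𝔞.dT * 𝔭.degHi) ≤ 𝔭.γ / 2)
    (hα3 : Real.exp (-(α * (𝔭.γ / 4 * 𝔭.d))) ≤ 1 / 2)
    (hr : Real.exp (-(𝔭.γ / 4 * 𝔭.d)) ≤ 1 / 2)
    (hθ0 : ‖𝔞.θ0 - θs‖ ≤ 𝔭.δ / 2)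
    (hη1 : 2 * 𝔞.η ^ 2 * 𝔭.M ^ 2 * ((𝔭.M + 1) * 𝔞.dT) ^ 2 ≤ 𝔭.δ ^ 2 / 16)
    (hη2 : 𝔞.η * 𝔭.M ^ 2 * ((𝔭.M + 1) * 𝔞.dT) ^ 2 ≤ 𝔭.curv * (𝔭.δ ^ 2 / 16)) :
    μ {x | ¬ ((∀ n ≤ N, (𝔞.run x n).θ ∈ Metric.ball θs 𝔭.δ) ∧
        (∑ s ∈ Finset.range N, (𝔞.LL x (s + 1) θs zs - 𝔞.LL x (s + 1) (𝔞.run x (s + 1)).θ zs))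
          / 𝔞.A.card ≤ lossBound 𝔭 𝔞.dT 𝔞.η N)}
      ≤ ENNReal.ofReal (m * K * (2 * Real.exp (-(α * (𝔭.γ / 4 * 𝔭.d)))))
        + ENNReal.ofReal (1024 * Real.exp (𝔭.M * 𝔞.dT) * 𝔭.M ^ 2 / 𝔭.δ ^ 2 * (N * 𝔞.η ^ 2)
            / 𝔞.A.card)
        + ENNReal.ofReal (16 * Real.exp (𝔭.M * 𝔞.dT) * 𝔭.M ^ 2 / 𝔞.A.card)
        + ENNReal.ofReal (256 * ((𝔭.M + 1) * 𝔞.dT) * 𝔭.M / 𝔭.δ * 𝔞.η * 𝔭.err K m 1)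
        + ENNReal.ofReal (128 * Real.exp (𝔭.M * 𝔞.dT) * 𝔭.M ^ 2 / 𝔭.δ ^ 2 * (N * 𝔞.η ^ 2)
            / 𝔞.A.card) := by
  classical
  have hδ := h.δ_pos
  have hη := h.η_pos
  have ha := h.card_pos'
  have hM := h.M_pos
  have hN0 : (0 : ℝ) < N := by exact_mod_cast hN
  set ν := 𝔭.δ ^ 2 / 8 with hν
  have B1 := h.measure_lev_gt_le (ν := ν) hε hε' hα hα1 hα2 hα3
  -- The thresholds are dictated by the deterministic part: here the normalised noise stays below
  -- `ν`, in `B3` the likelihood noise below `√N` per pair, and in `B4` and `B5` each half of the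
  -- disturbance below `δ ^ 2 / 16`.
  have B2 := h.measure_gradNoise_ge_le (ν := ν) (r := ν * 𝔞.A.card / (2 * 𝔞.η)) (by positivity)
  have B3 := h.measure_llNoise_ge_le (ν := ν) (r := √N * 𝔞.A.card) (by positivity)
  have B4 := h.measure_sum_err_rate_ge_le hr (r := 𝔭.δ / (128 * 𝔞.η * 𝔭.M)) (by positivity)
  have B5 := h.measure_sum_rate_sq_ge_le (r := 𝔭.δ ^ 2 / (32 * 𝔞.η ^ 2 * 𝔭.M ^ 2)) (by positivity)
  rw [show N * (4 * Real.exp (𝔭.M * 𝔞.dT) * (𝔭.M * 𝔭.δ) ^ 2 * 𝔞.A.card)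
      / (ν * 𝔞.A.card / (2 * 𝔞.η)) ^ 2 = 1024 * Real.exp (𝔭.M * 𝔞.dT) * 𝔭.M ^ 2 / 𝔭.δ ^ 2
        * (N * 𝔞.η ^ 2) / 𝔞.A.card by rw [hν]; field_simp; ring] at B2
  rw [show N * (4 * Real.exp (𝔭.M * 𝔞.dT) * (2 * 𝔭.M) ^ 2 * 𝔞.A.card) / (√N * 𝔞.A.card) ^ 2
      = 16 * Real.exp (𝔭.M * 𝔞.dT) * 𝔭.M ^ 2 / 𝔞.A.card by
        rw [mul_pow √(N : ℝ), Real.sq_sqrt hN0.le]; field_simp; ring] at B3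
  rw [show 2 * 𝔭.err K m 1 * ((𝔭.M + 1) * 𝔞.dT) / (𝔭.δ / (128 * 𝔞.η * 𝔭.M))
      = 256 * ((𝔭.M + 1) * 𝔞.dT) * 𝔭.M / 𝔭.δ * 𝔞.η * 𝔭.err K m 1 by field_simp; ring] at B4
  rw [show N * (4 * Real.exp (𝔭.M * 𝔞.dT) / 𝔞.A.card) / (𝔭.δ ^ 2 / (32 * 𝔞.η ^ 2 * 𝔭.M ^ 2))
      = 128 * Real.exp (𝔭.M * 𝔞.dT) * 𝔭.M ^ 2 / 𝔭.δ ^ 2 * (N * 𝔞.η ^ 2) / 𝔞.A.card by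
        field_simp; ring] at B5
  refine le_trans (measure_mono ?_) ((measure_union_le _ _).trans (add_le_add
    ((measure_union_le _ _).trans (add_le_add ((measure_union_le _ _).trans (add_le_add
      ((measure_union_le _ _).trans (add_le_add B1 B2)) B3)) B4)) B5))
  intro x hx
  by_contra hcon
  simp only [Set.mem_union, Set.mem_ofPred_eq, not_or] at hcon
  obtain ⟨⟨⟨⟨h1, h2⟩, h3⟩, h4⟩, h5⟩ := hcon
  have h2' := not_le.1 h2
  have h3' := not_le.1 h3
  have h4' := not_le.1 h4
  have h5' := not_le.1 h5
  have hdist : 𝔞.disturb xm 𝔭 x N ≤ ν := by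
    rw [disturb, Finset.sum_add_distrib, ← Finset.mul_sum, ← Finset.mul_sum]
    have e4 := mul_le_mul_of_nonneg_left h4'.le (by positivity : 0 ≤ 8 * 𝔞.η * 𝔭.M * 𝔭.δ)
    have e5 := mul_le_mul_of_nonneg_left h5'.le (by positivity : 0 ≤ 2 * 𝔞.η ^ 2 * 𝔭.M ^ 2)
    have e6 : 8 * 𝔞.η * 𝔭.M * 𝔭.δ * (𝔭.δ / (128 * 𝔞.η * 𝔭.M)) = 𝔭.δ ^ 2 / 16 := by
      field_simp
      ring
    have e7 : 2 * 𝔞.η ^ 2 * 𝔭.M ^ 2 * (𝔭.δ ^ 2 / (32 * 𝔞.η ^ 2 * 𝔭.M ^ 2)) = 𝔭.δ ^ 2 / 16 := by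
      field_simp
      ring
    rw [hν]
    linarith
  have hgood := h.mem_good hε hθ0 hη1 hη2 (x := x)
    (fun n hn hxn i k hk => not_lt.1 fun hlt => h1
      ⟨n, Finset.mem_range.2 hn, i, k, hk, hxn, hlt⟩) h2' hdist
  refine hx ⟨fun n hn => (hgood n hn n le_rfl).1, h.sum_LL_sub_le hε hθ0 hgood hdist h5'.le ?_⟩
  rw [Finset.sum_congr rfl fun s hs => if_pos (hgood s (Finset.mem_range.1 hs).le)] at h3'
  exact (le_abs_self _).trans h3'.le

end Model

end Algorithm

end

end OnlineNet

namespace OnlineNet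

noncomputable section

namespace Algorithm

variable {p K m : ℕ} {𝔞 : Algorithm p K m} {M : ℝ}

/-! ## Comparison with the original algorithm -/

/-- The streams `x` and `y` of the pairs in `A` agree in window `n`. -/
def AgreeAt (𝔞 : Algorithm p K m) (x : EdgeData m) (y : Fin m × Fin m → Measure ℝ) (n : ℕ) :
    Prop :=
  ∀ e ∈ 𝔞.A, (x e).1.restrict (window 𝔞.dT n) = (y e).restrict (window 𝔞.dT n)

namespace Regular

lemma windowLL_eq (h : 𝔞.Regular M) {x : EdgeData m} {y : Fin m × Fin m → Measure ℝ} {n : ℕ}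
    (hn : 1 ≤ n) (hxy : 𝔞.AgreeAt x y n) {θ : EuclideanSpace ℝ (Fin p)} (hθ : θ ∈ 𝔞.Θ)
    (z : Fin m → Fin K) : windowLL 𝔞.lam 𝔞.dT 𝔞.A y n θ z = 𝔞.LL x n θ z := by
  have hW := measurableSet_window 𝔞.dT n
  have hW0 := h.window_subset_Ici hn
  refine Finset.sum_congr rfl fun e he => ?_
  have h1 := setIntegral_extZero (ν := (x e).1)
    (fun θ t => Real.log (𝔞.lam θ (z e.1) (z e.2) t)) hθ hW hW0
  have h2 := setIntegral_extZero (ν := volume) (fun θ t => 𝔞.lam θ (z e.1) (z e.2) t) hθ hW hW0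
  rw [← hxy e he, ← h1, ← h2]
  rfl

lemma hasGradientAt_edgeLL (h : 𝔞.Regular M) (x : EdgeData m) {n : ℕ} (hn : 1 ≤ n)
    {θ : EuclideanSpace ℝ (Fin p)} (hθ : θ ∈ 𝔞.Θ) (z : Fin m → Fin K) (e : Fin m × Fin m) :
    HasGradientAt (fun θ => 𝔞.edgeLL x n θ z e) (𝔞.edgeGrad x n θ z e) θ := by
  have hW := measurableSet_window 𝔞.dT n
  have hW0 := h.window_subset_Ici hn
  have : IsFiniteMeasure ((volume : Measure ℝ).restrict (window 𝔞.dT n)) := ⟨by simp [window]⟩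
  have h1 := hasGradientAt_setIntegral (ν := (x e).1) h.isOpen
    (h.contDiffOn_log (z e.1) (z e.2)) (h.measurable_extZero_log (z e.1) (z e.2))
    (fun θ hθ t ht => h.bdd.bound_log θ hθ _ _ t ht)
    (fun θ hθ t ht => h.bdd.bound_grad_log θ hθ _ _ t ht) hW hW0 hθ
  have h2 := hasGradientAt_setIntegral (ν := (volume : Measure ℝ).restrict (window 𝔞.dT n))
    h.isOpen (h.bdd.contDiff (z e.1) (z e.2)) (h.measurable_extZero_val (z e.1) (z e.2))
    (fun θ hθ t ht => h.bdd.bound θ hθ _ _ t ht)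
    (fun θ hθ t ht => h.bdd.bound_grad θ hθ _ _ t ht) hW hW0 hθ
  rw [Measure.restrict_restrict_of_subset subset_rfl] at h2
  have h3 : HasGradientAt (fun θ => (∫ t in window 𝔞.dT n, Real.log (𝔞.lam θ (z e.1) (z e.2) t) ∂(x e).1)
      - ∫ t in window 𝔞.dT n, 𝔞.lam θ (z e.1) (z e.2) t) (𝔞.edgeGrad x n θ z e) θ := by
    rw [hasGradientAt_iff_hasFDerivAt] at h1 h2 ⊢
    refine (h1.sub h2).congr_fderiv ?_
    rw [← map_sub]
    rfl
  refine HasFDerivAt.congr_of_eventuallyEq h3 ?_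
  filter_upwards [h.isOpen.mem_nhds hθ] with θ' hθ'
  rw [edgeLL, logE, valE, setIntegral_extZero _ hθ' hW hW0, setIntegral_extZero _ hθ' hW hW0]

lemma hasGradientAt_LL (h : 𝔞.Regular M) (x : EdgeData m) {n : ℕ} (hn : 1 ≤ n)
    {θ : EuclideanSpace ℝ (Fin p)} (hθ : θ ∈ 𝔞.Θ) (z : Fin m → Fin K) :
    HasGradientAt (fun θ => 𝔞.LL x n θ z) (∑ e ∈ 𝔞.A, 𝔞.edgeGrad x n θ z e) θ := by
  rw [hasGradientAt_iff_hasFDerivAt, map_sum]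
  exact HasFDerivAt.fun_sum fun e _ => (h.hasGradientAt_edgeLL x hn hθ z e).hasFDerivAt

lemma hasGradientAt_expect_LL (h : 𝔞.Regular M) (x : EdgeData m) {n : ℕ} (hn : 1 ≤ n)
    {θ : EuclideanSpace ℝ (Fin p)} (hθ : θ ∈ 𝔞.Θ) (q : Fin m → Fin K → ℝ) :
    HasGradientAt (fun θ => expect q (𝔞.LL x n θ)) (𝔞.grad x n θ q) θ := by
  rw [hasGradientAt_iff_hasFDerivAt, grad, map_sum]
  refine HasFDerivAt.fun_sum fun z _ => ?_
  rw [map_smul]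
  exact (h.hasGradientAt_LL x hn hθ z).hasFDerivAt.const_mul (prodProb q z)

/-- The two objectives agree at every parameter in `Θ`, hence near `θ` because `Θ` is open, and so
do their gradients. -/
lemma gradient_expect_windowLL (h : 𝔞.Regular M) {x : EdgeData m}
    {y : Fin m × Fin m → Measure ℝ} {n : ℕ} (hn : 1 ≤ n) (hxy : 𝔞.AgreeAt x y n)
    {θ : EuclideanSpace ℝ (Fin p)} (hθ : θ ∈ 𝔞.Θ) (q : Fin m → Fin K → ℝ) :
    _root_.gradient (fun θ => expect q (windowLL 𝔞.lam 𝔞.dT 𝔞.A y n θ)) θ = 𝔞.grad x n θ q := by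
  refine HasGradientAt.gradient ?_
  refine HasFDerivAt.congr_of_eventuallyEq (h.hasGradientAt_expect_LL x hn hθ q) ?_
  filter_upwards [h.isOpen.mem_nhds hθ] with θ' hθ'
  rw [funext (h.windowLL_eq hn hxy hθ')]

lemma step_eq (h : 𝔞.Regular M) {x : EdgeData m} {y : Fin m × Fin m → Measure ℝ} {n : ℕ}
    (hn : 1 ≤ n) (hxy : 𝔞.AgreeAt x y n) {s : State p K m} (hs : s.θ ∈ 𝔞.Θ) :
    step 𝔞.lam 𝔞.dT 𝔞.A y 𝔞.η n s = 𝔞.next x n s := by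
  have hS : OnlineNet.nextS 𝔞.lam 𝔞.dT 𝔞.A y n s = 𝔞.nextS x n s := by
    funext i k
    rw [OnlineNet.nextS, nextS, funext (h.windowLL_eq hn hxy hs)]
  have hQ : OnlineNet.nextQ 𝔞.lam 𝔞.dT 𝔞.A y n s = 𝔞.nextQ x n s := by
    funext i k
    rw [OnlineNet.nextQ, nextQ, hS]
  rw [step, next, hS, hQ, h.gradient_expect_windowLL hn hxy hs]

/-- The original algorithm agrees with its extension as long as the parameter stays in the
parameter space. -/
lemma run_eq (h : 𝔞.Regular M) {x : EdgeData m} {y : Fin m × Fin m → Measure ℝ} {N : ℕ}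
    (hxy : ∀ n, 1 ≤ n → n ≤ N → 𝔞.AgreeAt x y n) (hΘ : ∀ n ≤ N, (𝔞.run x n).θ ∈ 𝔞.Θ) :
    ∀ n ≤ N, OnlineNet.run 𝔞.lam 𝔞.dT 𝔞.A y 𝔞.η 𝔞.θ0 𝔞.q0 𝔞.w0 n = 𝔞.run x n := by
  intro n
  induction n with
  | zero => intro _; rfl
  | succ n ih =>
    intro hn
    rw [OnlineNet.run, run, ih (by omega)]
    exact h.step_eq (by omega) (hxy _ (by omega) hn) (hΘ n (by omega))

lemma regret_eq (h : 𝔞.Regular M) {x : EdgeData m} {y : Fin m × Fin m → Measure ℝ} {N : ℕ}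
    (hxy : ∀ n, 1 ≤ n → n ≤ N → 𝔞.AgreeAt x y n) (hΘ : ∀ n ≤ N, (𝔞.run x n).θ ∈ 𝔞.Θ)
    {θs : EuclideanSpace ℝ (Fin p)} (hθs : θs ∈ 𝔞.Θ) (zs : Fin m → Fin K) :
    regret 𝔞.lam 𝔞.dT 𝔞.A y 𝔞.η 𝔞.θ0 𝔞.q0 𝔞.w0 θs zs N
      = (∑ s ∈ Finset.range N, (𝔞.LL x (s + 1) θs zs - 𝔞.LL x (s + 1) (𝔞.run x (s + 1)).θ zs))
        / 𝔞.A.card := by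
  rw [regret, ← Finset.sum_sub_distrib, Finset.sum_div, ← Finset.Ico_succ_right_eq_Icc,
    Finset.sum_Ico_eq_sum_range]
  refine Finset.sum_congr rfl fun s hs => ?_
  have hs' : s < N := by simpa using hs
  rw [loss, loss, normLL, normLL, h.run_eq hxy hΘ (1 + s) (by omega),
    h.windowLL_eq (by omega) (hxy _ (by omega) (by omega)) (hΘ _ (by omega)),
    h.windowLL_eq (by omega) (hxy _ (by omega) (by omega)) hθs, add_comm 1 s]
  ring

lemma LL_sub_LL_data (x y : EdgeData m) (n : ℕ)
    (θ : EuclideanSpace ℝ (Fin p)) (z : Fin m → Fin K) :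
    𝔞.LL x n θ z - 𝔞.LL y n θ z = edgeSum 𝔞.A 𝔞.dT n (fun e t => 𝔞.logE (z e.1) (z e.2) θ t) x
      - edgeSum 𝔞.A 𝔞.dT n (fun e t => 𝔞.logE (z e.1) (z e.2) θ t) y := by
  simp only [LL, edgeSum, ← Finset.sum_sub_distrib]
  exact Finset.sum_congr rfl fun e _ => by ring

/-- For a fixed parameter the log-likelihood is affine in the data, so its expectation is its value
at the mean data. -/
lemma integral_LL (h : 𝔞.Regular M) (hM : 0 < M) {N : ℕ} {xm : EdgeData m}
    {μ : Measure (EdgeData m)} (hdata : PoissonData 𝔞.A 𝔞.dT N xm μ) (hA : 0 < 𝔞.A.card) {n : ℕ}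
    (hn : 1 ≤ n) (hN : n ≤ N)
    (hR : ∀ e ∈ 𝔞.A, (xm e).1.real (window 𝔞.dT n) ≤ M * 𝔞.dT)
    (θ : EuclideanSpace ℝ (Fin p)) (z : Fin m → Fin K) :
    ∫ x, 𝔞.LL x n θ z ∂μ = 𝔞.LL xm n θ z := by
  have := hdata.isProb
  obtain ⟨h1, h2, -⟩ := hdata.centred_moments (f := fun e t => 𝔞.logE (z e.1) (z e.2) θ t) hn hN
    (fun e => h.measurable_logE _ _ θ) (fun e t => h.norm_logE_le _ _ θ t) hM hR
    (mul_nonneg hM.le h.dT_pos.le) hA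
  have hfun : (fun x => 𝔞.LL x n θ z) = fun x =>
      (edgeSum 𝔞.A 𝔞.dT n (fun e t => 𝔞.logE (z e.1) (z e.2) θ t) x
        - edgeSum 𝔞.A 𝔞.dT n (fun e t => 𝔞.logE (z e.1) (z e.2) θ t) xm) + 𝔞.LL xm n θ z :=
    funext fun x => by
      rw [← LL_sub_LL_data x xm n θ z]
      ring
  rw [hfun, integral_add (h1.integrable one_le_two) (integrable_const _), h2]
  simp

/-- The expected loss of likelihood is of second order. -/
lemma LL_mean_sub_le (h : 𝔞.Regular M) {θs : EuclideanSpace ℝ (Fin p)} {zs : Fin m → Fin K}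
    {B : Set (EuclideanSpace ℝ (Fin p))} (hB : Convex ℝ B) (hBΘ : B ⊆ 𝔞.Θ) (hθs : θs ∈ B)
    {θ : EuclideanSpace ℝ (Fin p)} (hθ : θ ∈ B) {n N : ℕ} (hn : 1 ≤ n) (hN : n ≤ N) :
    𝔞.LL (meanData (N * 𝔞.dT) fun e => 𝔞.lam θs (zs e.1) (zs e.2)) n θs zs
      - 𝔞.LL (meanData (N * 𝔞.dT) fun e => 𝔞.lam θs (zs e.1) (zs e.2)) n θ zs
      ≤ 𝔞.A.card * (Real.exp M * M ^ 2 * 𝔞.dT) * ‖θ - θs‖ ^ 2 := by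
  have hW := measurableSet_window 𝔞.dT n
  have hsub := window_subset h.dT_pos hn hN
  have hW0 := h.window_subset_Ici hn
  have hfin : IsFiniteMeasure ((volume : Measure ℝ).restrict (window 𝔞.dT n)) :=
    ⟨by simp [window]⟩
  rw [LL_eq_sum, LL_eq_sum, ← Finset.sum_sub_distrib]
  suffices key : ∀ e ∈ 𝔞.A,
      𝔞.edgeLL (meanData (N * 𝔞.dT) fun e => 𝔞.lam θs (zs e.1) (zs e.2)) n θs zs e
        - 𝔞.edgeLL (meanData (N * 𝔞.dT) fun e => 𝔞.lam θs (zs e.1) (zs e.2)) n θ zs e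
      ≤ Real.exp M * M ^ 2 * 𝔞.dT * ‖θ - θs‖ ^ 2 by
    refine (Finset.sum_le_card_nsmul 𝔞.A _ _ key).trans_eq ?_
    rw [nsmul_eq_mul]
    ring
  intro e _
  set k := zs e.1
  set l := zs e.2
  have hmean := setIntegral_meanData (H := N * 𝔞.dT)
    (ρ := fun e : Fin m × Fin m => 𝔞.lam θs (zs e.1) (zs e.2)) (e := e)
    (h.bdd.measurable θs (hBΘ hθs) k l) (h.bdd.bound θs (hBΘ hθs) k l)
    (fun t ht => (h.bdd.pos θs (hBΘ hθs) k l t ht).le) hW hsub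
  have hval : ∀ θ' : EuclideanSpace ℝ (Fin p), ∫ t in window 𝔞.dT n, 𝔞.logE k l θ' t * 𝔞.lam θs k l t
      = ∫ t in window 𝔞.dT n, 𝔞.logE k l θ' t * 𝔞.valE k l θs t := fun θ' =>
    setIntegral_congr_fun hW fun t ht => by
      simp only [valE, extZero_of_mem _ (hBΘ hθs) (hW0 ht)]
  have hi1 : ∀ θ', Integrable (fun t => 𝔞.logE k l θ' t * 𝔞.valE k l θs t)
      (volume.restrict (window 𝔞.dT n)) := fun θ' =>
    integrable_of_abs_le (b := M * M) ((h.measurable_logE k l θ').mul (h.measurable_valE k l θs))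
      fun t => by
        rw [abs_mul]
        exact mul_le_mul (h.norm_logE_le k l θ' t) (h.norm_valE_le k l θs t) (abs_nonneg _)
          h.M_nonneg
  have hi2 := h.integrableOn_valE k l (n := n)
  have hi3 : ∀ θ', Integrable (fun t => 𝔞.logE k l θ' t * 𝔞.valE k l θs t - 𝔞.valE k l θ' t)
      (volume.restrict (window 𝔞.dT n)) := fun θ' => (hi1 θ').sub (hi2 θ')
  rw [edgeLL, edgeLL, hmean, hmean, hval, hval, ← integral_sub (hi1 θs) (hi2 θs),
    ← integral_sub (hi1 θ) (hi2 θ), ← integral_sub (hi3 θs) (hi3 θ)]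
  have hpt : ∀ t ∈ window 𝔞.dT n, 𝔞.logE k l θs t * 𝔞.valE k l θs t - 𝔞.valE k l θs t
      - (𝔞.logE k l θ t * 𝔞.valE k l θs t - 𝔞.valE k l θ t)
      ≤ Real.exp M * M ^ 2 * ‖θ - θs‖ ^ 2 := by
    intro t ht
    have ht0 := hW0 ht
    have hlip := h.abs_valE_sub_le hB hBΘ hθ hθs k l ht0
    have hpos := h.bdd.pos θ (hBΘ hθ) k l t ht0
    have hpos' := h.bdd.pos θs (hBΘ hθs) k l t ht0
    have hlog := (abs_le.1 (h.bdd.bound_log θ (hBΘ hθ) k l t ht0)).1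
    simp only [logE, valE, extZero_of_mem _ (hBΘ hθ) ht0, extZero_of_mem _ (hBΘ hθs) ht0] at hlip ⊢
    set a := 𝔞.lam θs k l t
    set b := 𝔞.lam θ k l t
    -- Relative entropy is dominated by the chi-square divergence, here pointwise in time: the
    -- integrand becomes at most `(b - a) ^ 2 / b`, and `1 / b` is bounded because the logarithm of
    -- `b` is.
    have h1 : Real.log a - Real.log b ≤ a / b - 1 := by
      rw [← Real.log_div hpos'.ne' hpos.ne']
      exact Real.log_le_sub_one_of_pos (div_pos hpos' hpos)
    have h2 : 1 / b ≤ Real.exp M := by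
      rw [one_div, ← Real.exp_log hpos, ← Real.exp_neg]
      exact Real.exp_le_exp.2 (by linarith)
    have h3 : (b - a) ^ 2 ≤ M ^ 2 * ‖θ - θs‖ ^ 2 := by
      rw [← sq_abs, ← mul_pow]
      exact pow_le_pow_left₀ (abs_nonneg _) hlip 2
    calc Real.log a * a - a - (Real.log b * a - b) = (Real.log a - Real.log b) * a - a + b := by
          ring
      _ ≤ (a / b - 1) * a - a + b := by
          have := mul_le_mul_of_nonneg_right h1 hpos'.le
          linarith
      _ = 1 / b * (b - a) ^ 2 := by
          field_simp
          ring
      _ ≤ Real.exp M * (M ^ 2 * ‖θ - θs‖ ^ 2) :=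
          mul_le_mul h2 h3 (sq_nonneg _) (Real.exp_pos _).le
      _ = _ := by ring
  calc _ ≤ ∫ _ in window 𝔞.dT n, Real.exp M * M ^ 2 * ‖θ - θs‖ ^ 2 :=
        setIntegral_mono_on ((hi3 θs).sub (hi3 θ))
          (integrable_const _) hW hpt
    _ = _ := by
        rw [setIntegral_const, volume_window h.dT_pos, smul_eq_mul]
        ring

end Regular

end Algorithm

end

end OnlineNet

namespace OnlineNet

noncomputable section

/-! ## The block model under the regularity conditions -/

section transfer

variable {p K m : ℕ} {Ω : Type*} [MeasurableSpace Ω] {P : Measure Ω} [IsProbabilityMeasure P]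
  {θs : EuclideanSpace ℝ (Fin p)} {zs : Fin m → Fin K} {X : Ω → Fin m × Fin m → Measure ℝ}
  {κ : Consts}

/-- The constants of the analysis for a network of size `m`. -/
def Consts.params (κ : Consts) (dT W : ℝ) (m : ℕ) : Algorithm.Params where
  M := κ.M
  δ := κ.δ
  γ := min (κ.cGap / 2) (κ.cInit * κ.degLo / 2)
  curv := κ.cGrad
  kl := Real.exp κ.M * κ.M ^ 2 * dT
  d := (m : ℝ) ^ κ.rd
  degHi := κ.degHi
  W := W

/-- Together with the lower bound for the degrees this makes the number of pairs at least of order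
`m ^ rd`, so that variances divided by it vanish. -/
lemma degree_le_two_mul_card (A : Finset (Fin m × Fin m)) (i : Fin m) :
    degree A i ≤ 2 * A.card := by
  classical
  have hsub : (Finset.univ.filter fun j => (i, j) ∈ A ∨ (j, i) ∈ A)
      ⊆ A.image Prod.snd ∪ A.image Prod.fst := by
    intro j hj
    simp only [Finset.mem_filter, Finset.mem_univ, true_and] at hj
    rcases hj with hj | hj
    · exact Finset.mem_union_left _ (Finset.mem_image.2 ⟨_, hj, rfl⟩)
    · exact Finset.mem_union_right _ (Finset.mem_image.2 ⟨_, hj, rfl⟩)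
  rw [degree, two_mul]
  exact (Finset.card_le_card hsub).trans ((Finset.card_union_le _ _).trans
    (add_le_add Finset.card_image_le Finset.card_image_le))

lemma expectAt_div {q : Fin m → Fin K → ℝ} (i : Fin m) (k : Fin K) (f : (Fin m → Fin K) → ℝ)
    (c : ℝ) : expectAt q i k (fun z => f z / c) = expectAt q i k f / c := by
  simp only [expectAt, expect, mul_div_assoc', Finset.sum_div]

lemma hammingDist_update (zs : Fin m → Fin K) {i : Fin m} {k : Fin K} (hk : k ≠ zs i) :
    hammingDist (Function.update zs i k) zs = 1 := by
  rw [hammingDist, Finset.card_eq_one]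
  refine ⟨i, ?_⟩
  ext j
  by_cases hj : j = i
  · subst hj
    simpa using hk
  · simp [hj]

variable (𝔞 : Algorithm p K m)

/-- The mean edge data. -/
def Algorithm.mean (θs : EuclideanSpace ℝ (Fin p)) (zs : Fin m → Fin K) (N : ℕ) : EdgeData m :=
  meanData (N * 𝔞.dT) fun e => 𝔞.lam θs (zs e.1) (zs e.2)

/-- The law of the data. -/
def Algorithm.law (P : Measure Ω) (X : Ω → Fin m × Fin m → Measure ℝ) (N : ℕ) :
    Measure (EdgeData m) :=
  P.map fun ω => trimData 𝔞.A (N * 𝔞.dT) (X ω)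

variable {𝔞} {M : ℝ} {N : ℕ}

omit [IsProbabilityMeasure P] in
lemma IsBlockPoisson.ae_agreeAt (hX : IsBlockPoisson P 𝔞.lam θs 𝔞.A zs X) (h : 𝔞.Regular M)
    (N : ℕ) : ∀ᵐ ω ∂P, ∀ n, 1 ≤ n → n ≤ N →
      𝔞.AgreeAt (trimData 𝔞.A (N * 𝔞.dT) (X ω)) (X ω) n := by
  filter_upwards [hX.ae_trimData (N * 𝔞.dT)] with ω hω n hn hN e he
  rw [hω e he, restrict_window_trim h.dT_pos hn hN]

namespace Algorithm.Regular

lemma poissonData (h : 𝔞.Regular M) (hX : IsBlockPoisson P 𝔞.lam θs 𝔞.A zs X) (hθs : θs ∈ 𝔞.Θ)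
    (N : ℕ) : PoissonData 𝔞.A 𝔞.dT N (𝔞.mean θs zs N) (𝔞.law P X N) :=
  hX.poissonData h.dT_pos (fun k l => h.bdd.measurable θs hθs k l)
    (fun k l t ht => (h.bdd.pos θs hθs k l t ht).le) (fun k l t ht => h.bdd.bound θs hθs k l t ht) N

lemma mean_real_le (h : 𝔞.Regular M) (hθs : θs ∈ 𝔞.Θ) (zs : Fin m → Fin K) {n : ℕ} (hn : 1 ≤ n)
    (hN : n ≤ N) (e : Fin m × Fin m) :
    (𝔞.mean θs zs N e).1.real (window 𝔞.dT n) ≤ M * 𝔞.dT :=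
  meanData_real_window_le (ρ := fun e : Fin m × Fin m => 𝔞.lam θs (zs e.1) (zs e.2)) (e := e)
    (h.bdd.measurable θs hθs _ _) (fun t ht => h.bdd.bound θs hθs _ _ t ht)
    (fun t ht => (h.bdd.pos θs hθs _ _ t ht).le) h.dT_pos hn hN

/-- This turns the conditions on the expected likelihood under `P` into statements about the
likelihood at the mean data; combined with stationarity it does so for every window. -/
lemma integral_normLL (h : 𝔞.Regular M) (hM : 0 < M) (hA : 0 < 𝔞.A.card)
    (hX : IsBlockPoisson P 𝔞.lam θs 𝔞.A zs X) (hθs : θs ∈ 𝔞.Θ) {n : ℕ} (hn : 1 ≤ n) (hN : n ≤ N)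
    {θ : EuclideanSpace ℝ (Fin p)} (hθ : θ ∈ 𝔞.Θ) (z : Fin m → Fin K) :
    ∫ ω, normLL 𝔞.lam 𝔞.dT 𝔞.A (X ω) n θ z ∂P = 𝔞.LL (𝔞.mean θs zs N) n θ z / 𝔞.A.card := by
  have h1 : ∫ ω, normLL 𝔞.lam 𝔞.dT 𝔞.A (X ω) n θ z ∂P
      = ∫ ω, (1 / (𝔞.A.card : ℝ)) * 𝔞.LL (trimData 𝔞.A (N * 𝔞.dT) (X ω)) n θ z ∂P := by
    refine integral_congr_ae ?_
    filter_upwards [hX.ae_agreeAt h N] with ω hω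
    rw [normLL, h.windowLL_eq hn (hω n hn hN) hθ]
  have h2 := h.integral_LL hM (h.poissonData hX hθs N) hA hn hN
    (fun e _ => h.mean_real_le hθs zs hn hN e) θ z
  have hLL : Measurable fun x : EdgeData m => 𝔞.LL x n θ z :=
    h.measurable_LL measurable_id measurable_const n z
  rw [Algorithm.law, integral_map (hX.measurable_trimData _).aemeasurable
    hLL.aestronglyMeasurable] at h2
  rw [h1, integral_const_mul, h2]
  ring

/-- The regularity conditions yield the model for which the algorithm has been analysed. -/
lemma model (h : 𝔞.Regular κ.M) (hreg : OnlineNet.Regular P 𝔞.lam 𝔞.Θ θs 𝔞.dT 𝔞.A zs X 𝔞.q0 κ)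
    (hX : IsBlockPoisson P 𝔞.lam θs 𝔞.A zs X) (hm : 0 < m) (hM : 0 < κ.M)
    (hball : Metric.ball θs κ.δ ⊆ 𝔞.Θ) (hη : 0 < 𝔞.η) (hw0 : ∀ k, 0 < 𝔞.w0 k)
    (hw1 : ∑ k, 𝔞.w0 k = 1) {W : ℝ} (hW : ∀ k l, 𝔞.w0 k ≤ W * 𝔞.w0 l)
    (hθ0 : 𝔞.θ0 ∈ Metric.ball θs κ.δ)
    (hθ0' : 4 * κ.M * ((κ.M + 1) * 𝔞.dT) * ‖𝔞.θ0 - θs‖ ≤ κ.cInit / 2) (hN1 : 1 ≤ N) :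
    𝔞.Model N zs θs (𝔞.mean θs zs N) (𝔞.law P X N) (κ.params 𝔞.dT W m) := by
  have hδ := κ.δ_pos
  have hθsb : θs ∈ Metric.ball θs κ.δ := Metric.mem_ball_self hδ
  have hθs : θs ∈ 𝔞.Θ := hball hθsb
  have hdT := h.dT_pos
  have hd : 0 < (m : ℝ) ^ κ.rd := Real.rpow_pos_of_pos (by exact_mod_cast hm) _
  have hA : 0 < 𝔞.A.card := by
    have h1 := (hreg.degrees ⟨0, hm⟩).1
    have h2 : (0 : ℝ) < degree 𝔞.A ⟨0, hm⟩ := (mul_pos κ.degLo_pos hd).trans_le h1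
    have h3 : 0 < degree 𝔞.A ⟨0, hm⟩ := by exact_mod_cast h2
    have h4 := degree_le_two_mul_card 𝔞.A ⟨0, hm⟩
    omega
  have ha : (0 : ℝ) < 𝔞.A.card := by exact_mod_cast hA
  have hmean : ∀ n, 1 ≤ n → n ≤ N → ∀ θ ∈ 𝔞.Θ, ∀ z,
      meanLL P 𝔞.lam 𝔞.dT 𝔞.A X θ z = 𝔞.LL (𝔞.mean θs zs N) n θ z / 𝔞.A.card := by
    intro n hn hN θ hθ z
    rw [← hreg.stationary n hn θ hθ z]
    exact h.integral_normLL hM hA hX hθs hn hN hθ z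
  have hγ1 : (κ.params 𝔞.dT W m).γ ≤ κ.cGap / 2 := min_le_left _ _
  have hγ2 : (κ.params 𝔞.dT W m).γ ≤ κ.cInit * κ.degLo / 2 := min_le_right _ _
  refine
    { reg := h
      data := h.poissonData hX hθs N
      M_pos := hM
      m_pos := hm
      δ_pos := hδ
      γ_pos := lt_min (half_pos κ.cGap_pos) (half_pos (mul_pos κ.cInit_pos κ.degLo_pos))
      curv_pos := κ.cGrad_pos
      kl_nonneg := by
        change 0 ≤ Real.exp κ.M * κ.M ^ 2 * 𝔞.dT
        positivity
      d_pos := hd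
      η_pos := hη
      card_pos := hA
      intensity := fun n hn hN e _ => h.mean_real_le hθs zs hn hN e
      ball_subset := hball
      degree_le := fun i => (hreg.degrees i).2
      gap := ?_
      init := ?_
      gradient := ?_
      likelihood := fun n hn hN θ hθ =>
        h.LL_mean_sub_le (convex_ball θs κ.δ) hball hθsb hθ hn hN
      meanField := hreg.init_meanField
      weight_pos := hw0
      weight_sum := hw1
      weight_ratio := hW }
  -- Identification is applied to a single changed membership, at Hamming distance one. Both sides
  -- carry the same factor `1 / |A|`, which cancels.
  · intro n hn hN θ hθ i k hk
    have hne : Function.update zs i k ≠ zs := fun heq => hk (by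
      have := congrFun heq i
      simpa using this)
    have h1 := hreg.identification _ hne θ hθ
    rw [hmean n hn hN θ (hball hθ), hmean n hn hN θ (hball hθ), hammingDist_update zs hk,
      Nat.cast_one, mul_one, mul_div_assoc', ← sub_div, div_le_div_iff_of_pos_right ha] at h1
    change _ ≤ -(2 * (κ.params 𝔞.dT W m).γ * (m : ℝ) ^ κ.rd)
    have h2 := mul_le_mul_of_nonneg_right hγ1 hd.le
    linarith
  · intro i k hk
    have h1 := hreg.init_gap i k hk
    rw [funext fun z => hmean 1 le_rfl hN1 θs hθs z, expectAt_div, expectAt_div,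
      mul_div_assoc', ← sub_div, div_le_div_iff_of_pos_right ha] at h1
    have hMy : 0 ≤ (κ.M + 1) * 𝔞.dT := by positivity
    -- Half of the initial gap pays for moving from `θs` to the starting point; the other half
    -- remains as drift.
    have h2 := h.incr_le_of_near (convex_ball θs κ.δ) hball hθ0 hθsb (𝔞.mean θs zs N)
      (n := 1) le_rfl hreg.init_meanField i k (zs i) (Y := (κ.M + 1) * 𝔞.dT) (fun e _ => by
        have := h.mean_real_le (N := N) hθs zs le_rfl hN1 e
        rw [Algorithm.edgeMass]
        linarith) hMy
    have h3 := mul_le_mul_of_nonneg_right hθ0' (Nat.cast_nonneg (α := ℝ) (degree 𝔞.A i))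
    have h4 := (hreg.degrees i).1
    have h5 : (κ.params 𝔞.dT W m).γ * (m : ℝ) ^ κ.rd ≤ κ.cInit / 2 * degree 𝔞.A i := by
      calc _ ≤ κ.cInit * κ.degLo / 2 * (m : ℝ) ^ κ.rd := mul_le_mul_of_nonneg_right hγ2 hd.le
        _ = κ.cInit / 2 * (κ.degLo * (m : ℝ) ^ κ.rd) := by ring
        _ ≤ _ := mul_le_mul_of_nonneg_left h4 (half_pos κ.cInit_pos).le
    change _ ≤ -((κ.params 𝔞.dT W m).γ * (m : ℝ) ^ κ.rd)
    have h6 : 𝔞.incr (𝔞.mean θs zs N) 1 θs 𝔞.q0 i k (zs i) ≤ -(κ.cInit * degree 𝔞.A i) := by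
      rw [Algorithm.incr]
      have h7 : ∀ l, expectAt 𝔞.q0 i l (𝔞.LL (𝔞.mean θs zs N) 1 θs)
          = expectAt 𝔞.q0 i l fun z => 𝔞.LL (𝔞.mean θs zs N) 1 θs z := fun _ => rfl
      rw [h7, h7]
      linarith
    linarith
  · intro n hn hN θ hθ
    obtain ⟨θq, hθq⟩ := hreg.maximiser
    -- At distance zero the bound on the maximiser forces it to equal `θs`, so the gradient
    -- condition becomes a contraction towards the true parameter.
    have htv : tvToPoint (pointField zs) zs = 0 := tvToPoint_pointField zs
    obtain ⟨-, -, h1, h2⟩ := hθq (pointField zs) (isMeanField_pointField zs)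
      (by rw [htv]; exact κ.ρ_pos.le)
    rw [htv, mul_zero] at h1
    have h3 : θq (pointField zs) = θs := sub_eq_zero.1 (norm_le_zero_iff.1 h1)
    rw [h3] at h2
    have h4 := (h2 θ ⟨hθ, hball hθ⟩).1
    have hgrad : _root_.gradient (fun θ => Qbar P 𝔞.lam 𝔞.dT 𝔞.A X θ (pointField zs)) θ
        = (1 / (𝔞.A.card : ℝ)) • 𝔞.grad (𝔞.mean θs zs N) n θ (pointField zs) := by
      refine HasGradientAt.gradient ?_
      have h5 := (h.hasGradientAt_expect_LL (𝔞.mean θs zs N) hn (hball hθ)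
        (pointField zs)).hasFDerivAt.const_mul (1 / (𝔞.A.card : ℝ))
      rw [hasGradientAt_iff_hasFDerivAt, map_smul]
      refine h5.congr_of_eventuallyEq ?_
      filter_upwards [h.isOpen.mem_nhds (hball hθ)] with θ' hθ'
      simp only [Qbar, Qfun, expect_pointField]
      have := hmean n hn hN θ' hθ' zs
      rw [meanLL] at this
      rw [this]
      ring
    rw [hgrad, real_inner_smul_left, one_div, inv_mul_le_iff₀ ha] at h4
    refine h4.trans (le_of_eq ?_)
    change _ = -(κ.cGrad * 𝔞.A.card * ‖θ - θs‖ ^ 2)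
    ring

end Algorithm.Regular

end transfer

end

end OnlineNet

namespace OnlineNet

noncomputable section

/-! ## The regret bound -/

section regret

variable {p K m : ℕ} {Ω : Type*} [MeasurableSpace Ω] {P : Measure Ω} [IsProbabilityMeasure P]
  {θs : EuclideanSpace ℝ (Fin p)} {zs : Fin m → Fin K} {X : Ω → Fin m × Fin m → Measure ℝ}
  {𝔞 : Algorithm p K m} {N : ℕ}

omit [IsProbabilityMeasure P] in
/-- Events for the extended algorithm control the regret of the original one. -/
lemma IsBlockPoisson.measure_regret_gt_le (hX : IsBlockPoisson P 𝔞.lam θs 𝔞.A zs X) {M δ L L' : ℝ}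
    (h : 𝔞.Regular M) (hball : Metric.ball θs δ ⊆ 𝔞.Θ) (hδ : 0 < δ) (hL : L ≤ L') :
    P {ω | L' < regret 𝔞.lam 𝔞.dT 𝔞.A (X ω) 𝔞.η 𝔞.θ0 𝔞.q0 𝔞.w0 θs zs N}
      ≤ 𝔞.law P X N {x | ¬ ((∀ n ≤ N, (𝔞.run x n).θ ∈ Metric.ball θs δ) ∧
        (∑ s ∈ Finset.range N, (𝔞.LL x (s + 1) θs zs - 𝔞.LL x (s + 1) (𝔞.run x (s + 1)).θ zs))
          / 𝔞.A.card ≤ L)} := by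
  -- No measurability of the event is needed: the inequality between the measure of a preimage and
  -- the image measure holds for arbitrary sets in this direction.
  refine le_trans (measure_mono_ae ?_)
    (Measure.le_map_apply (hX.measurable_trimData (N * 𝔞.dT)).aemeasurable _)
  filter_upwards [hX.ae_agreeAt h N] with ω hω
  intro hlt
  change ¬ _
  rintro ⟨h1, h2⟩
  have hlt' : L' < regret 𝔞.lam 𝔞.dT 𝔞.A (X ω) 𝔞.η 𝔞.θ0 𝔞.q0 𝔞.w0 θs zs N := hlt
  rw [h.regret_eq hω (fun n hn => hball (h1 n hn)) (hball (Metric.mem_ball_self hδ)) zs] at hlt'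
  exact absurd (h2.trans hL) (not_le.2 hlt')

end regret

/-- The bound is made of terms in `√N`, `1 / η` and `N * η`; with `η` proportional to `1 / √T` each
is an exact multiple of `√T`. -/
lemma Algorithm.Model.lossBound_eq (𝔭 : Algorithm.Params) {dT c N : ℝ} (hdT : 0 < dT) (hc : 0 < c)
    (hN : 0 < N) (hM : 0 < 𝔭.M) (hκ : 0 < 𝔭.curv) :
    Algorithm.Model.lossBound 𝔭 dT (c / √(N * dT)) N
      = (1 / √dT + 𝔭.kl * ((𝔭.δ ^ 2 + 2 * c ^ 2 * 𝔭.M ^ 2 * ((𝔭.M + 1) * dT) ^ 2 / dT)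
          / (2 * c * 𝔭.curv)) + 𝔭.δ ^ 2 / (16 * c)
          + 2 * c * 𝔭.M ^ 2 * ((𝔭.M + 1) * dT) ^ 2 / dT) * √(N * dT) := by
  have h1 : √(N * dT) = √N * √dT := Real.sqrt_mul hN.le dT
  obtain ⟨a, ha, rfl⟩ : ∃ a : ℝ, 0 < a ∧ N = a ^ 2 := ⟨√N, Real.sqrt_pos.2 hN, (Real.sq_sqrt hN.le).symm⟩
  obtain ⟨b, hb, rfl⟩ : ∃ b : ℝ, 0 < b ∧ dT = b ^ 2 :=
    ⟨√dT, Real.sqrt_pos.2 hdT, (Real.sq_sqrt hdT.le).symm⟩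
  rw [Algorithm.Model.lossBound, h1, Real.sqrt_sq ha.le, Real.sqrt_sq hb.le]
  field_simp
  ring

/-! ### Limits as the network grows. -/

section asymptotics

variable {r : ℝ}

lemma tendsto_natCast_rpow_atTop (hr : 0 < r) :
    Tendsto (fun m : ℕ => (m : ℝ) ^ r) atTop atTop :=
  (tendsto_rpow_atTop hr).comp tendsto_natCast_atTop_atTop

lemma tendsto_exp_neg_mul_natCast_rpow (hr : 0 < r) {b : ℝ} (hb : 0 < b) :
    Tendsto (fun m : ℕ => Real.exp (-(b * (m : ℝ) ^ r))) atTop (𝓝 0) :=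
  Real.tendsto_exp_neg_atTop_nhds_zero.comp ((tendsto_natCast_rpow_atTop hr).const_mul_atTop hb)

/-- In terms of `m ^ r` the prefactor is the power with exponent `1 / r`, which any exponential
beats. -/
lemma tendsto_natCast_mul_exp_neg_mul_rpow (hr : 0 < r) {b : ℝ} (hb : 0 < b) :
    Tendsto (fun m : ℕ => (m : ℝ) * Real.exp (-(b * (m : ℝ) ^ r))) atTop (𝓝 0) := by
  have h := (tendsto_rpow_mul_exp_neg_mul_atTop_nhds_zero (1 / r) b hb).comp
    (tendsto_natCast_rpow_atTop hr)
  refine h.congr fun m => ?_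
  simp only [Function.comp]
  rw [← Real.rpow_mul (Nat.cast_nonneg m), mul_one_div_cancel hr.ne', Real.rpow_one, neg_mul]

lemma tendsto_max_mul_exp_neg_mul_rpow (hr : 0 < r) {b : ℝ} (hb : 0 < b) (K W : ℝ) :
    Tendsto (fun m : ℕ => K * max W (2 * m) * Real.exp (-(b * (m : ℝ) ^ r))) atTop (𝓝 0) := by
  have h1 := (tendsto_exp_neg_mul_natCast_rpow hr hb).const_mul W
  have h2 := (tendsto_natCast_mul_exp_neg_mul_rpow hr hb).const_mul 2
  have h3 := (h1.max h2).const_mul K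
  simp only [mul_zero, max_self] at h3
  refine h3.congr fun m => ?_
  rw [mul_assoc, max_mul_of_nonneg _ _ (Real.exp_pos _).le, mul_assoc 2]

/-- The probability that the algorithm fails vanishes. -/
lemma tendsto_failure (hr : 0 < r) {b b' l : ℝ} (hb : 0 < b) (hb' : 0 < b') (hl : 0 < l)
    (K W B₁ B₂ B₃ B₄ : ℝ) :
    Tendsto (fun m : ℕ => ENNReal.ofReal (m * K * (2 * Real.exp (-(b * (m : ℝ) ^ r))))
      + ENNReal.ofReal (B₁ / (l * (m : ℝ) ^ r)) + ENNReal.ofReal (B₂ / (l * (m : ℝ) ^ r))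
      + ENNReal.ofReal (B₃ * (K * max W (2 * m) * Real.exp (-(b' * (m : ℝ) ^ r))))
      + ENNReal.ofReal (B₄ / (l * (m : ℝ) ^ r))) atTop (𝓝 0) := by
  have h0 : ∀ {f : ℕ → ℝ}, Tendsto f atTop (𝓝 0) →
      Tendsto (fun m => ENNReal.ofReal (f m)) atTop (𝓝 0) := fun hf => by
    simpa using ENNReal.tendsto_ofReal hf
  have hdiv : ∀ B : ℝ, Tendsto (fun m : ℕ => B / (l * (m : ℝ) ^ r)) atTop (𝓝 0) :=
    fun B => ((tendsto_natCast_rpow_atTop hr).const_mul_atTop hl).const_div_atTop B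
  have h1 : Tendsto (fun m : ℕ => m * K * (2 * Real.exp (-(b * (m : ℝ) ^ r)))) atTop (𝓝 0) := by
    have := (tendsto_natCast_mul_exp_neg_mul_rpow hr hb).const_mul (2 * K)
    rw [mul_zero] at this
    refine this.congr fun m => ?_
    ring
  have h2 := (tendsto_max_mul_exp_neg_mul_rpow hr hb' K W).const_mul B₃
  rw [mul_zero] at h2
  simpa using ((((h0 h1).add (h0 (hdiv _))).add (h0 (hdiv _))).add (h0 h2)).add (h0 (hdiv _))

end asymptotics

lemma exists_weight_ratio {K : ℕ} {w : Fin K → ℝ} (hw : ∀ k, 0 < w k) (hw1 : ∑ k, w k = 1) :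
    ∃ W, ∀ k l, w k ≤ W * w l := by
  refine ⟨∑ l, 1 / w l, fun k l => ?_⟩
  have h1 : w k ≤ 1 := by
    rw [← hw1]
    exact Finset.single_le_sum (fun k _ => (hw k).le) (Finset.mem_univ k)
  have h2 : 1 / w l ≤ ∑ l, 1 / w l :=
    Finset.single_le_sum (f := fun l => 1 / w l) (fun l _ => (one_div_pos.2 (hw l)).le)
      (Finset.mem_univ l)
  have h3 := mul_le_mul_of_nonneg_right h2 (hw l).le
  rw [one_div_mul_cancel (hw l).ne'] at h3
  exact h1.trans h3

/-- The sign of `B` is left open, so its role is taken by `|B| + 1`. -/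
lemma exists_pos_mul_le {a b : ℝ} (ha : 0 < a) (hb : 0 < b) (B : ℝ) :
    ∃ α : ℝ, 0 < α ∧ a * α ≤ 1 ∧ α * B ≤ b := by
  have hB : 0 < |B| + 1 := by positivity
  have hmin : 0 < min (1 / a) (b / (|B| + 1)) := by positivity
  refine ⟨min (1 / a) (b / (|B| + 1)), hmin, ?_, ?_⟩
  · calc _ ≤ a * (1 / a) := mul_le_mul_of_nonneg_left (min_le_left _ _) ha.le
      _ = 1 := mul_one_div_cancel ha.ne'
  · calc _ ≤ min (1 / a) (b / (|B| + 1)) * (|B| + 1) :=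
          mul_le_mul_of_nonneg_left (by linarith [le_abs_self B]) hmin.le
      _ ≤ b / (|B| + 1) * (|B| + 1) := mul_le_mul_of_nonneg_right (min_le_right _ _) hB.le
      _ = b := div_mul_cancel₀ _ hB.ne'

end

end OnlineNet

theorem theorem2 {p K : ℕ}
    (lam : OnlineNet.Intensity p K)
    (Θ : Set (EuclideanSpace ℝ (Fin p))) (θs : EuclideanSpace ℝ (Fin p))
    (dT : ℝ) (κ : OnlineNet.Consts)
    (A : ∀ m : ℕ, Finset (Fin m × Fin m)) (zs : ∀ m : ℕ, Fin m → Fin K)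
    (Ω : ℕ → Type*) [∀ m, MeasurableSpace (Ω m)]
    (P : ∀ m, Measure (Ω m)) [∀ m, IsProbabilityMeasure (P m)]
    (X : ∀ m, Ω m → Fin m × Fin m → Measure ℝ)
    (q0 : ∀ m : ℕ, Fin m → Fin K → ℝ) (w0 : Fin K → ℝ)
    (hdT : 0 < dT)
    (hΘ : IsOpen Θ) (hball : Metric.ball θs κ.δ ⊆ Θ)
    (hlam : OnlineNet.BoundedIntensity lam Θ κ.M)
    (hX : ∀ m, OnlineNet.IsBlockPoisson (P m) lam θs (A m) (zs m) (X m))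
    (hw0 : ∀ k, 0 < w0 k) (hw0_sum : ∑ k, w0 k = 1)
    (hreg : ∀ᶠ m in atTop,
      OnlineNet.Regular (P m) lam Θ θs dT (A m) (zs m) (X m) (q0 m) κ) :
    ∃ δ₀ > 0, ∃ η₀ > 0, ∀ c > 0, ∃ C₀ > 0,
      ∀ (N : ℕ → ℕ) (θ0 : ℕ → EuclideanSpace ℝ (Fin p)),
        (∀ m, 1 ≤ N m) →
        (∀ᶠ m in atTop, c / √((N m : ℝ) * dT) ≤ η₀) →
        (∀ m, θ0 m ∈ Metric.ball θs δ₀) →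
        Tendsto (fun m => P m {ω |
            C₀ * √((N m : ℝ) * dT) * Real.log (((N m : ℝ) * dT) * ((A m).card : ℝ)) ^ 2 <
              OnlineNet.regret lam dT (A m) (X m ω) (c / √((N m : ℝ) * dT))
                (θ0 m) (q0 m) w0 θs (zs m) (N m)})
          atTop (𝓝 0) := by
  obtain ⟨k₀⟩ : Nonempty (Fin K) := by
    by_contra hne
    rw [not_nonempty_iff] at hne
    simp at hw0_sum
  have hδ := κ.δ_pos
  have hθs : θs ∈ Θ := hball (Metric.mem_ball_self hδ)
  have hM : 0 < κ.M := (hlam.pos θs hθs k₀ k₀ 0 le_rfl).trans_le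
    ((le_abs_self _).trans (hlam.bound θs hθs k₀ k₀ 0 le_rfl))
  have hcI := κ.cInit_pos
  have hcG := κ.cGap_pos
  have hcurv := κ.cGrad_pos
  have hdL := κ.degLo_pos
  have hrd := κ.rd_pos
  obtain ⟨y, hy⟩ : ∃ y, y = (κ.M + 1) * dT := ⟨_, rfl⟩
  have hy0 : 0 < y := by
    rw [hy]
    positivity
  -- The first radius leaves room for the error budget in `mem_good`, the second spends half of the
  -- initial gap on the starting point. The two bounds on the step size keep the `η ^ 2` term below
  -- `δ ^ 2 / 16` and below what the contraction absorbs at that level.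
  refine ⟨min (κ.δ / 2) (κ.cInit / (8 * κ.M * y)), by positivity,
    min (κ.δ / (6 * κ.M * y)) (κ.cGrad * κ.δ ^ 2 / (16 * κ.M ^ 2 * y ^ 2)), by positivity, ?_⟩
  intro c hc
  -- The coefficient of `√T` in `lossBound_eq` for the present constants; it does not involve `m`,
  -- the horizon or the starting point.
  refine ⟨1 / √dT + Real.exp κ.M * κ.M ^ 2 * dT *
      ((κ.δ ^ 2 + 2 * c ^ 2 * κ.M ^ 2 * ((κ.M + 1) * dT) ^ 2 / dT) / (2 * c * κ.cGrad))
      + κ.δ ^ 2 / (16 * c) + 2 * c * κ.M ^ 2 * ((κ.M + 1) * dT) ^ 2 / dT, by positivity, ?_⟩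
  intro N θ0 hN hη hθ0
  set C₀ := 1 / √dT + Real.exp κ.M * κ.M ^ 2 * dT *
      ((κ.δ ^ 2 + 2 * c ^ 2 * κ.M ^ 2 * ((κ.M + 1) * dT) ^ 2 / dT) / (2 * c * κ.cGrad))
      + κ.δ ^ 2 / (16 * c) + 2 * c * κ.M ^ 2 * ((κ.M + 1) * dT) ^ 2 / dT with hC₀
  have hC₀pos : 0 < C₀ := by
    rw [hC₀]
    positivity
  obtain ⟨W, hW⟩ := OnlineNet.exists_weight_ratio hw0 hw0_sum
  obtain ⟨γ, hγ⟩ : ∃ γ, γ = min (κ.cGap / 2) (κ.cInit * κ.degLo / 2) := ⟨_, rfl⟩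
  have hγ0 : 0 < γ := by
    rw [hγ]
    positivity
  -- The exponent of the moment bound for the evidence: small enough for the quadratic estimate of
  -- the exponential and for the variance to be beaten by the drift, yet independent of `m`.
  obtain ⟨α, hα0, hα1, hα2⟩ := OnlineNet.exists_pos_mul_le (by positivity : 0 < 2 * κ.M)
    (half_pos hγ0) (8 * κ.M ^ 3 * dT * κ.degHi)
  obtain ⟨E, hEdef⟩ : ∃ E : ℕ → ℝ, E = fun m : ℕ =>
      K * max W (2 * m) * Real.exp (-(γ / 4 * (m : ℝ) ^ κ.rd)) := ⟨_, rfl⟩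
  have hE : Tendsto E atTop (𝓝 0) := by
    rw [hEdef]
    exact OnlineNet.tendsto_max_mul_exp_neg_mul_rpow hrd (by positivity) K W
  have hd := OnlineNet.tendsto_natCast_rpow_atTop hrd
  have hx1 := OnlineNet.tendsto_exp_neg_mul_natCast_rpow hrd
    (by positivity : 0 < α * (γ / 4))
  have hx2 := OnlineNet.tendsto_exp_neg_mul_natCast_rpow hrd (by positivity : 0 < γ / 4)
  have hbound := OnlineNet.tendsto_failure hrd (by positivity : 0 < α * (γ / 4))
    (by positivity : 0 < γ / 4) (by positivity : 0 < κ.degLo / 2) K W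
    (1024 * Real.exp (κ.M * dT) * κ.M ^ 2 / κ.δ ^ 2 * (c ^ 2 / dT))
    (16 * Real.exp (κ.M * dT) * κ.M ^ 2)
    (256 * ((κ.M + 1) * dT) * κ.M / κ.δ * (κ.δ / (6 * κ.M * y)))
    (128 * Real.exp (κ.M * dT) * κ.M ^ 2 / κ.δ ^ 2 * (c ^ 2 / dT))
  refine tendsto_of_tendsto_of_tendsto_of_le_of_le' tendsto_const_nhds hbound
    (Eventually.of_forall fun _ => zero_le) ?_
  have hE1 : ∀ᶠ m in atTop, E m < 1 / 2 := hE.eventually_lt_const (by norm_num)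
  have hE2 : ∀ᶠ m in atTop, 16 * κ.M * y * κ.degHi * E m < γ := by
    have := hE.const_mul (16 * κ.M * y * κ.degHi)
    rw [mul_zero] at this
    exact this.eventually_lt_const hγ0
  filter_upwards [hreg, hη, hE1, hE2, hx1.eventually_lt_const (by norm_num : (0 : ℝ) < 1 / 2),
    hx2.eventually_lt_const (by norm_num : (0 : ℝ) < 1 / 2), eventually_gt_atTop 0,
    (hd.const_mul_atTop (by positivity : 0 < dT * (κ.degLo / 2))).eventually_ge_atTop
      (Real.exp 1)] with m hregm hηm hE1m hE2m hx1m hx2m hm hlog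
  have hN0 : (0 : ℝ) < N m := by exact_mod_cast hN m
  have hN1 : (1 : ℝ) ≤ N m := by exact_mod_cast hN m
  have hT : 0 < (N m : ℝ) * dT := by positivity
  have hdm : 0 < (m : ℝ) ^ κ.rd := Real.rpow_pos_of_pos (by exact_mod_cast hm) _
  obtain ⟨η, hηdef⟩ : ∃ η, η = c / √((N m : ℝ) * dT) := ⟨_, rfl⟩
  have hη0 : 0 < η := by
    rw [hηdef]
    positivity
  rw [← hηdef] at hηm
  have hη1 : η ≤ κ.δ / (6 * κ.M * y) := hηm.trans (min_le_left _ _)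
  have hη2 : η ≤ κ.cGrad * κ.δ ^ 2 / (16 * κ.M ^ 2 * y ^ 2) := hηm.trans (min_le_right _ _)
  -- The horizon disappears from the variances here, so the failure probability vanishes however the
  -- horizon grows with the network.
  have hNη : (N m : ℝ) * η ^ 2 = c ^ 2 / dT := by
    rw [hηdef, div_pow, Real.sq_sqrt hT.le]
    field_simp
  have hcard : κ.degLo / 2 * (m : ℝ) ^ κ.rd ≤ ((A m).card : ℝ) := by
    have h1 := (hregm.degrees ⟨0, hm⟩).1
    have h2 : (OnlineNet.degree (A m) ⟨0, hm⟩ : ℝ) ≤ 2 * (A m).card := by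
      exact_mod_cast OnlineNet.degree_le_two_mul_card (A m) ⟨0, hm⟩
    linarith
  have hcard0 : 0 < κ.degLo / 2 * (m : ℝ) ^ κ.rd := by positivity
  have hθ0m := hθ0 m
  rw [Metric.mem_ball, dist_eq_norm] at hθ0m
  have hθ1 := hθ0m.trans_le (min_le_left _ _)
  have hθ2 := hθ0m.trans_le (min_le_right _ _)
  let 𝔞 : OnlineNet.Algorithm p K m := ⟨lam, Θ, dT, A m, η, θ0 m, q0 m, w0⟩
  have hR : 𝔞.Regular κ.M := ⟨hlam, hΘ, hdT, hM.le⟩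
  have hmodel : 𝔞.Model (N m) (zs m) θs (𝔞.mean θs (zs m) (N m)) (𝔞.law (P m) (X m) (N m))
      (κ.params dT W m) := by
    refine hR.model hregm (hX m) hm hM hball hη0 hw0 hw0_sum hW ?_ ?_ (hN m)
    · rw [Metric.mem_ball, dist_eq_norm]
      exact hθ1.trans (by linarith)
    · change 4 * κ.M * ((κ.M + 1) * dT) * ‖θ0 m - θs‖ ≤ κ.cInit / 2
      rw [← hy]
      calc _ ≤ 4 * κ.M * y * (κ.cInit / (8 * κ.M * y)) :=
            mul_le_mul_of_nonneg_left hθ2.le (by positivity)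
        _ = κ.cInit / 2 := by
            field_simp
            norm_num
  have herr : (κ.params dT W m).err K m 1 = E m := by
    simp [OnlineNet.Algorithm.Params.err, OnlineNet.Consts.params, hEdef, hγ]
  have hbad := hmodel.measure_bad_le (hN m) (by rw [herr]; exact hE1m.le)
    (by
      rw [herr]
      change 16 * κ.M * ((κ.M + 1) * dT) * κ.degHi * E m ≤ min _ _
      rw [← hy, ← hγ]
      exact hE2m.le) hα0 hα1
    (by
      change _ ≤ min _ _ / 2
      rw [← hγ]
      exact hα2)
    (by
      change Real.exp (-(α * (min _ _ / 4 * _))) ≤ _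
      rw [← hγ, ← mul_assoc α]
      exact hx1m.le)
    (by
      change Real.exp (-(min _ _ / 4 * _)) ≤ _
      rw [← hγ]
      exact hx2m.le) hθ1.le
    (by
      change 2 * η ^ 2 * κ.M ^ 2 * ((κ.M + 1) * dT) ^ 2 ≤ κ.δ ^ 2 / 16
      rw [← hy]
      calc _ ≤ 2 * (κ.δ / (6 * κ.M * y)) ^ 2 * κ.M ^ 2 * y ^ 2 := by gcongr
        _ = κ.δ ^ 2 / 18 := by
            field_simp
            norm_num
        _ ≤ _ := by gcongr; norm_num)
    (by
      change η * κ.M ^ 2 * ((κ.M + 1) * dT) ^ 2 ≤ κ.cGrad * (κ.δ ^ 2 / 16)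
      rw [← hy]
      calc _ ≤ κ.cGrad * κ.δ ^ 2 / (16 * κ.M ^ 2 * y ^ 2) * κ.M ^ 2 * y ^ 2 := by gcongr
        _ = _ := by field_simp)
  have hloss : OnlineNet.Algorithm.Model.lossBound (κ.params dT W m) dT η (N m)
      ≤ C₀ * √((N m : ℝ) * dT) * Real.log (((N m : ℝ) * dT) * ((A m).card : ℝ)) ^ 2 := by
    rw [hηdef, OnlineNet.Algorithm.Model.lossBound_eq _ hdT hc hN0 hM hcurv]
    change C₀ * √((N m : ℝ) * dT) ≤ _
    refine le_mul_of_one_le_right (by positivity) ?_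
    -- The horizon is at least one window and the number of pairs diverges, so the logarithm
    -- eventually exceeds one; this is all that is used of it.
    have h1 : 1 ≤ Real.log (((N m : ℝ) * dT) * ((A m).card : ℝ)) := by
      rw [Real.le_log_iff_exp_le (by have := hcard0.trans_le hcard; positivity)]
      calc Real.exp 1 ≤ dT * (κ.degLo / 2) * (m : ℝ) ^ κ.rd := hlog
        _ = 1 * dT * (κ.degLo / 2 * (m : ℝ) ^ κ.rd) := by ring
        _ ≤ _ := by gcongr
    nlinarith
  have hfin := ((hX m).measure_regret_gt_le (𝔞 := 𝔞) (N := N m) hR hball hδ hloss).trans hbad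
  rw [← hηdef]
  refine hfin.trans ?_
  have hE0 : 0 ≤ E m := by
    rw [hEdef]
    positivity
  rw [herr]
  refine add_le_add (add_le_add (add_le_add (add_le_add ?_ ?_) ?_) ?_) ?_
  · change ENNReal.ofReal (m * K * (2 * Real.exp (-(α * (min _ _ / 4 * _))))) ≤ _
    rw [← hγ, ← mul_assoc α]
    exact le_rfl
  · change ENNReal.ofReal (1024 * Real.exp (κ.M * dT) * κ.M ^ 2 / κ.δ ^ 2 * (N m * η ^ 2)
      / (A m).card) ≤ _
    rw [hNη]
    exact ENNReal.ofReal_le_ofReal (div_le_div_of_nonneg_left (by positivity) hcard0 hcard)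
  · exact ENNReal.ofReal_le_ofReal (div_le_div_of_nonneg_left (by positivity) hcard0 hcard)
  · refine ENNReal.ofReal_le_ofReal ?_
    change 256 * ((κ.M + 1) * dT) * κ.M / κ.δ * η * E m ≤ _
    rw [hEdef] at hE0 ⊢
    exact mul_le_mul_of_nonneg_right (mul_le_mul_of_nonneg_left hη1 (by positivity)) hE0
  · change ENNReal.ofReal (128 * Real.exp (κ.M * dT) * κ.M ^ 2 / κ.δ ^ 2 * (N m * η ^ 2)
      / (A m).card) ≤ _
    rw [hNη]
    exact ENNReal.ofReal_le_ofReal (div_le_div_of_nonneg_left (by positivity) hcard0 hcard)
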